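/- Notation. Logarithms are to base $2$. A treedepth decomposition of a finite simple graph $G$ is a rooted tree $T$ with node set $V(G)$ such that for each edge $uv$ of $G$ one of $u,v$ is an ancestor of the other; its depth is the largest number of nodes on a path from the root to a node. For a node $x$ let $P_x$ be the set of its proper ancestors. A table is a map $M$ from vertex sets to $\mathbb N\cup\{\infty\}$ (sets that are not stored have value $\infty$), and $(M_1*M_2)[X]=\min_{A\uplus B=X}\big(M_1[A]+M_2[B]\big)$ is the min-sum subset convolution. For a node $x$ and $D\subseteq P_x$ let $\mathrm{domset}(x,D)$ be the table defined recursively as follows. Let $E_{x,D}$ be the table with value $1$ at each $S\subseteq (N_G[x]\cap P_x)\setminus D$ and no other entries. - If $x$ is a leaf, $\mathrm{domset}(x,D)$ is $E_{x,D}$, with the value at $\varnothing$ replaced by $0$ if $x\in N_G[D]$. - If $x$ has children $y_1,\dots,y_l$, then $M_1=\mathrm{domset}(y_1,D)*\dots*\mathrm{domset}(y_l,D)$ ($x$ is not taken), where all entries $S\not\ni x$ are deleted if $x\notin N_G[D]$; $M_2=E_{x,D}*\mathrm{domset}(y_1,D\cup\{x\})*\dots*\mathrm{domset}(y_l,D\cup\{x\})$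 ($x$ is taken); $M=\min(M_1,M_2)$ pointwise; and $\mathrm{domset}(x,D)[S]=\min(M[S],M[S\cup\{x\}])$ if $x\notin S$, and $\infty$ if $x\in S$. The hybrid algorithm returns $\mathrm{domset}(r,\varnothing)[\varnothing]$, where $r$ is the root. Theorem. Let $G$ be a graph on $n\ge 1$ vertices with a treedepth decomposition $T$ of depth at most $t$, where $t\ge 2$. 1. $\mathrm{domset}(r,\varnothing)[\varnothing]$ is the size of a minimum dominating set of $G$. 2. For each node $x$ and each $D\subseteq P_x$, all finite entries of $M=\mathrm{domset}(x,D)$ are at sets $S\subseteq P_x\setminus D$, $M[\varnothing]$ is finite, and each finite entry satisfies $M[\varnothing]\le M[S]\le M[\varnothing]+t$; so the entries can be stored as offsets of at most $t$ from $M[\varnothing]$. 3. There are a fixed program for a random access machine (the same for all inputs, and not given $t$) and a constant $C$ such that on each such input the program halts with the value $\mathrm{domset}(r,\varnothing)[\varnothing]$, that is, the size of a minimum dominating set of $G$, after at most $C\cdot 3^t\log t\cdot n$ steps, and uses at most $C\cdot(2^t\,t\log t+t\log n)$ bits of working memory at any time. In part 3 the input is a read-only array with random access; it holds $n$, the root,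 the adjacency lists of $G$ and the lists of children in $T$, with vertices and lists ordered arbitrarily. A step is an assignment of a constant, an addition, subtraction, bitwise "and" or "or", shift, comparison, indirect load or store, read of an input word, or test for zero; all words that occur in the working memory have at most $C(t+\log n)$ bits. The space is counted as the sum, over all nonzero cells, of the binary lengths of address and content. -/

import Mathlib

open scoped Classical

universe u

namespace HybridDomset

/-! ### Dominating sets and treedepth decompositions -/

/-- The closed neighbourhood `N[x]`. -/
noncomputable def closedNbhd {V : Type u} [Fintype V] (G : SimpleGraph V) (x : V) : Finset V :=
  Finset.univ.filter fun v => v = x ∨ G.Adj x v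

/-- The closed neighbourhood `N[D]` of a vertex set. -/
noncomputable def closedNbhdSet {V : Type u} [Fintype V] (G : SimpleGraph V) (D : Finset V) :
    Finset V :=
  D.biUnion (closedNbhd G)

/-- The size of a minimum dominating set of `G`. (The whole vertex set is dominating, so the
infimum is over a nonempty set of natural numbers and is attained.) -/
noncomputable def dominationNumber {V : Type u} [Fintype V] (G : SimpleGraph V) : ℕ :=
  sInf {k | ∃ S : Finset V, closedNbhdSet G S = Finset.univ ∧ S.card = k}

/-- A rooted tree `T` (its order is the ancestor order: the root is `⊥` and `a ≤ b` says that `a`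
is `b` or an ancestor of `b`) is a treedepth decomposition of a graph `G` on the nodes of `T` if
the ends of each edge of `G` are in the ancestor relation. -/
def IsTreedepthDecomposition (T : RootedTree.{u}) (G : SimpleGraph T) : Prop :=
  ∀ a b : T, G.Adj a b → a ≤ b ∨ b ≤ a

/-- The set `P_x` of proper ancestors of `x`. -/
noncomputable def ancestors (T : RootedTree.{u}) [Fintype T] (x : T) : Finset T :=
  Finset.univ.filter fun v => v < x

/-- The depth (height) of a finite rooted tree: the largest number of nodes on a path from the root
to a node. -/
noncomputable def treeDepth (T : RootedTree.{u}) [Fintype T] : ℕ :=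
  Finset.univ.sup fun x : T => (ancestors T x).card + 1

/-- An instance of the problem as it is presented to an algorithm: the vertices are numbered
`0, …, n - 1` in an arbitrary way, the graph is given by adjacency lists and the decomposition by
lists of children, all of them in an arbitrary order. -/
structure Presentation (T : RootedTree.{u}) [Fintype T] (G : SimpleGraph T) where
  num : T ≃ Fin (Fintype.card T)
  adj : T → List T
  adj_nodup : ∀ x, (adj x).Nodup
  mem_adj : ∀ x y, y ∈ adj x ↔ G.Adj x y
  children : T → List T
  children_nodup : ∀ x, (children x).Nodup
  mem_children : ∀ x y, y ∈ children x ↔ x ⋖ y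

/-! ### The hybrid algorithm -/

/-- A table: an associative array indexed by sets of vertices. A set that is not in the array has
value `∞`. -/
abbrev Table (V : Type u) := Finset V → ℕ∞

/-- The min-sum subset convolution `(M₁ * M₂)[X] = min_{A ⊎ B = X} M₁[A] + M₂[B]`. -/
noncomputable def minConv {V : Type u} (M₁ M₂ : Table V) : Table V :=
  fun X => X.powerset.inf fun A => M₁ A + M₂ (X \ A)

/-- The table whose only entry is `∅ ↦ 0`; it is neutral for `minConv`. -/
noncomputable def unitTable {V : Type u} : Table V :=
  fun S => if S = ∅ then 0 else ⊤

/-- The table for taking `x` itself: cost one, dominating any set of neighbours of `x` among those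
ancestors of `x` that are not in `D`. -/
noncomputable def takeTable {T : RootedTree.{u}} [Fintype T] (G : SimpleGraph T) (x : T)
    (D : Finset T) : Table T :=
  fun S => if S ⊆ (closedNbhd G x ∩ ancestors T x) \ D then 1 else ⊤

/-- Forget `x`: `M[S] := min (M[S], M[S ∪ {x}])` where `x ∉ S`, and delete all entries `S` with
`x ∈ S`. -/
noncomputable def forget {V : Type u} (x : V) (M : Table V) : Table V :=
  fun S => if x ∈ S then ⊤ else min (M S) (M (insert x S))

/-- The recursive procedure of the hybrid algorithm at a node `x`, where `D` is the set of ancestors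
of `x` that have been put into the dominating set. The entry of the resulting table at a set `S` of
ancestors of `x` outside `D` is the cost of dominating, from the subtree of `x`, this set together
with the whole subtree, where `D` helps with the latter. -/
noncomputable def domsetTable {T : RootedTree.{u}} [Fintype T] {G : SimpleGraph T}
    (I : Presentation T G) (x : T) (D : Finset T) : Table T :=
  if I.children x = [] then
    -- a leaf is taken, or it is already dominated and is not taken
    fun S => if S = ∅ ∧ x ∈ closedNbhdSet G D then 0 else takeTable G x D S
  else
    -- `x` is not taken: merge the tables of the children
    let M₁ : Table T := (I.children x).attach.foldl
      (fun M y => minConv M (domsetTable I y.1 D)) unitTable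
    -- discard entries where `x` is undominated
    let M₁' : Table T := fun S => if x ∉ closedNbhdSet G D ∧ x ∉ S then ⊤ else M₁ S
    -- `x` is taken: pay for `x`, then merge the tables of the children
    let M₂ : Table T := (I.children x).attach.foldl
      (fun M y => minConv M (domsetTable I y.1 (insert x D))) (takeTable G x D)
    forget x fun S => min (M₁' S) (M₂ S)
termination_by (Finset.univ.filter fun v : T => x < v).card
decreasing_by
  all_goals
    have hxy : x < y.1 := ((I.mem_children x y.1).1 y.2).lt
    refine Finset.card_lt_card (Finset.ssubset_iff_subset_ne.2 ⟨fun v hv => ?_, fun h => ?_⟩)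
    · simp only [Finset.mem_filter, Finset.mem_univ, true_and] at hv ⊢
      exact hxy.trans hv
    · have : y.1 ∈ Finset.univ.filter fun v : T => y.1 < v := by
        rw [h]; simpa using hxy
      simp at this

/-- The value returned at the root: the entry at `∅` of the table computed with `D = ∅`. -/
noncomputable def hybridValue {T : RootedTree.{u}} [Fintype T] {G : SimpleGraph T}
    (I : Presentation T G) : ℕ∞ :=
  domsetTable I ⊥ ∅ ∅

/-! ### The machine model: a random access machine with a read-only input

The working memory is an array of cells, indexed by the natural numbers, that hold natural numbers
and are all `0` in the beginning. The size of the numbers is not limited by the semantics; bounds on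
it (the word size) are stated about runs. There is no multiplication or division. -/

/-- The binary operations on words. -/
inductive BinOp
  | add | sub | and | or | shiftLeft | shiftRight | lt | eq

/-- The meaning of the operations; subtraction is truncated, comparisons yield `0` or `1`. -/
def BinOp.eval : BinOp → ℕ → ℕ → ℕ
  | .add, a, b => a + b
  | .sub, a, b => a - b
  | .and, a, b => Nat.land a b
  | .or, a, b => Nat.lor a b
  | .shiftLeft, a, b => Nat.shiftLeft a b
  | .shiftRight, a, b => Nat.shiftRight a b
  | .lt, a, b => if a < b then 1 else 0
  | .eq, a, b => if a = b then 1 else 0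

/-- Programs. Below, `m[a]` is the content of the memory cell `a`. -/
inductive Program
  /-- `m[a] := c` -/
  | const (a c : ℕ)
  /-- `m[a] := m[b] ∘ m[c]` -/
  | op (o : BinOp) (a b c : ℕ)
  /-- `m[a] := m[m[b]]` -/
  | load (a b : ℕ)
  /-- `m[m[a]] := m[b]` -/
  | store (a b : ℕ)
  /-- `m[a] := input[m[b]]` -/
  | read (a b : ℕ)
  /-- run `p`, then `q` -/
  | seq (p q : Program)
  /-- if `m[a] ≠ 0` then `p` else `q` -/
  | ite (a : ℕ) (p q : Program)
  /-- while `m[a] ≠ 0` do `p` -/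
  | loop (a : ℕ) (p : Program)

/-- The state of the working memory. -/
abbrev Memory := ℕ →₀ ℕ

/-- `Run inp p m tr m'`: on the read-only input `inp`, the program `p` started in memory `m`
terminates in memory `m'`. The trace `tr` lists the memory at each elementary step, of which there
is one for each elementary instruction (which contributes the memory after it) and one for each
evaluation of the guard of a conditional or of a loop; hence `tr.length` is the running time. -/
inductive Run (inp : List ℕ) : Program → Memory → List Memory → Memory → Prop
  | const (a c : ℕ) (m : Memory) :
      Run inp (.const a c) m [m.update a c] (m.update a c)
  | op (o : BinOp) (a b c : ℕ) (m : Memory) :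
      Run inp (.op o a b c) m [m.update a (o.eval (m b) (m c))] (m.update a (o.eval (m b) (m c)))
  | load (a b : ℕ) (m : Memory) :
      Run inp (.load a b) m [m.update a (m (m b))] (m.update a (m (m b)))
  | store (a b : ℕ) (m : Memory) :
      Run inp (.store a b) m [m.update (m a) (m b)] (m.update (m a) (m b))
  | read (a b : ℕ) (m : Memory) :
      Run inp (.read a b) m [m.update a (inp.getD (m b) 0)] (m.update a (inp.getD (m b) 0))
  | seq {p q : Program} {m m₁ m₂ : Memory} {tr₁ tr₂ : List Memory} :
      Run inp p m tr₁ m₁ → Run inp q m₁ tr₂ m₂ → Run inp (.seq p q) m (tr₁ ++ tr₂) m₂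
  | ite_true {a : ℕ} {p q : Program} {m m' : Memory} {tr : List Memory} :
      m a ≠ 0 → Run inp p m tr m' → Run inp (.ite a p q) m (m :: tr) m'
  | ite_false {a : ℕ} {p q : Program} {m m' : Memory} {tr : List Memory} :
      m a = 0 → Run inp q m tr m' → Run inp (.ite a p q) m (m :: tr) m'
  | loop_true {a : ℕ} {p : Program} {m m₁ m₂ : Memory} {tr₁ tr₂ : List Memory} :
      m a ≠ 0 → Run inp p m tr₁ m₁ → Run inp (.loop a p) m₁ tr₂ m₂ →
        Run inp (.loop a p) m (m :: (tr₁ ++ tr₂)) m₂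
  | loop_false {a : ℕ} {p : Program} {m : Memory} :
      m a = 0 → Run inp (.loop a p) m [m] m

/-- The space of a memory state in bits: each cell that is in use is charged the length of its
address and the length of its content in binary. -/
def spaceBits (m : Memory) : ℕ := m.sum fun a v => Nat.size a + Nat.size v

/-! ### The input -/

/-- The array that represents a list `L` of lists and is placed at address `base`: a table of
`L.length + 1` pointers, followed by the concatenation of the lists. The `i`-th list occupies the
addresses from the `i`-th pointer up to, but not including, the address in the next pointer. -/
def encodeLists (base : ℕ) (L : List (List ℕ)) : List ℕ :=
  ((List.range (L.length + 1)).map fun i => base + (L.length + 1) + (L.take i).flatten.length) ++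
    L.flatten

/-- The lists of a family `f`, in the order of the vertex numbers, with vertices replaced by their
numbers. -/
def numberedLists {T : RootedTree.{u}} [Fintype T] {G : SimpleGraph T} (I : Presentation T G)
    (f : T → List T) : List (List ℕ) :=
  (List.finRange (Fintype.card T)).map fun i =>
    (f (I.num.symm i)).map fun v => (I.num v : ℕ)

/-- The input array: the number of vertices, the number of the root, the adjacency lists of the
graph, and the lists of children of the decomposition. -/
def inputArray {T : RootedTree.{u}} [Fintype T] {G : SimpleGraph T} (I : Presentation T G) :
    List ℕ :=
  let A := encodeLists 2 (numberedLists I I.adj)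
  [Fintype.card T, (I.num ⊥ : ℕ)] ++ A ++ encodeLists (2 + A.length) (numberedLists I I.children)

end HybridDomset

/-! The recursion and the machine are analysed separately; they meet only in the domination number.

Recursion. `domsetTable_realizes` identifies the entry at a set $S\subseteq P_x\setminus D$ as the
least size of a subset of the subtree of $x$ that dominates $S$ and, with the help of $D$, the whole
subtree. Subtrees of different children are disjoint and joined by no edge
(`separated_descendants_of_covBy`), so the solutions for their union are the free combinations of
solutions for each (`feasible_union`), and the min-sum convolution finds the best distribution of
the targets $S$ among them (`Realizes.minConv`). At the root this is plain domination. For the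
offsets (`domsetTable_bounds`), an optimum for $\varnothing$ is enlarged by one dominator for each
of the fewer than $t$ elements of $S$.

Machine. The program uses no convolutions. It tabulates the relaxed quantity `stateCost`: $D$ is
taken, $W$ consists of the vertices whose visit is complete, and each vertex of $S\cup W$ may stay
undominated at the price of one. For the whole graph the price changes nothing, since an undominated
vertex can be taken instead (`penaltyCost_univ`); but it makes all entries finite and at most $|S|$
above the entry at $\varnothing$. A table for $W$ is handed from child to child, each adding its
subtree to $W$. A visit of $x$ rests on three identities: `stateCost_insert_target` on entering,
`stateCost_insert_taken` for the branch that takes $x$, and `stateCost_insert_processed` on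
returning. The first two need that $x$ has no neighbour in $W$, which holds because edges join only
nodes in the ancestor relation.

Time and space. Each child is visited twice: with a table of double width if its parent is not
taken, since the parent is then a further possible target, and with the old width if it is taken. So
$e$ levels further down the widths sum to $2^{k+1}3^e$, which gives $O(3^t n)$ steps; the scans of
adjacency lists are absorbed by charging edges to their lower ends and by $d2^d\le 3^d$. The tables
of all levels share $2^{t+2}$ cells of $O(t)$ bits; apart from them only $O(t)$ words are nonzero.
Both factors $\log t$ in the theorem are slack.

The program is written in a small language with registers and arrays. `Env.WP` is a step-counting
program logic that also maintains the invariant `Inv` in every memory of the trace; the bounds on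
space and word size are read off from it. -/

namespace HybridDomset

/-! ### Domination in separated vertex sets -/

section Neighbourhoods

set_option linter.unusedSectionVars false

variable {V : Type u} [Fintype V] {G : SimpleGraph V}

theorem mem_closedNbhd {x v : V} : v ∈ closedNbhd G x ↔ v = x ∨ G.Adj x v := by
  simp [closedNbhd]

theorem mem_closedNbhdSet {D : Finset V} {v : V} :
    v ∈ closedNbhdSet G D ↔ ∃ d ∈ D, v = d ∨ G.Adj d v := by
  simp [closedNbhdSet, mem_closedNbhd]

theorem mem_closedNbhd_comm {x v : V} : v ∈ closedNbhd G x ↔ x ∈ closedNbhd G v := by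
  simp [mem_closedNbhd, eq_comm, G.adj_comm]

theorem closedNbhdSet_union (A B : Finset V) :
    closedNbhdSet G (A ∪ B) = closedNbhdSet G A ∪ closedNbhdSet G B := by
  ext v; simp [mem_closedNbhdSet, or_and_right, exists_or]

theorem closedNbhdSet_insert (x : V) (B : Finset V) :
    closedNbhdSet G (insert x B) = closedNbhd G x ∪ closedNbhdSet G B := by
  simp [closedNbhdSet, Finset.biUnion_insert]

theorem closedNbhdSet_mono {A B : Finset V} (h : A ⊆ B) :
    closedNbhdSet G A ⊆ closedNbhdSet G B :=
  Finset.biUnion_subset_biUnion_of_subset_left _ h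

theorem subset_closedNbhdSet (A : Finset V) : A ⊆ closedNbhdSet G A := fun v hv =>
  mem_closedNbhdSet.2 ⟨v, hv, Or.inl rfl⟩

/-- Two vertex sets are separated if they are disjoint and there is no edge between them. -/
def Separated (G : SimpleGraph V) (A B : Finset V) : Prop :=
  ∀ a ∈ A, ∀ b ∈ B, a ≠ b ∧ ¬ G.Adj a b

theorem Separated.disjoint {A B : Finset V} (h : Separated G A B) : Disjoint A B :=
  Finset.disjoint_left.2 fun a ha hb => (h a ha a hb).1 rfl

theorem Separated.notMem_closedNbhdSet {A B X : Finset V} (h : Separated G A B) (hX : X ⊆ A)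
    {b : V} (hb : b ∈ B) : b ∉ closedNbhdSet G X := by
  rw [mem_closedNbhdSet]
  rintro ⟨a, ha, rfl | e⟩
  · exact (h b (hX ha) b hb).1 rfl
  · exact (h a (hX ha) b hb).2 e

/-- `X` is contained in `U` and dominates `U` together with `D`. -/
def Feasible (G : SimpleGraph V) (U D X : Finset V) : Prop :=
  X ⊆ U ∧ U ⊆ closedNbhdSet G (X ∪ D)

/-- A vertex of one part is never dominated from the other part, so cutting `X` along the two parts
loses nothing. -/
theorem feasible_union {U₁ U₂ D X : Finset V} (h : Separated G U₁ U₂) :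
    Feasible G (U₁ ∪ U₂) D X ↔
      ∃ X₁ X₂, Feasible G U₁ D X₁ ∧ Feasible G U₂ D X₂ ∧ X = X₁ ∪ X₂ := by
  constructor
  · rintro ⟨hX, hU⟩
    refine ⟨X ∩ U₁, X ∩ U₂, ⟨Finset.inter_subset_right, fun v hv => ?_⟩,
      ⟨Finset.inter_subset_right, fun v hv => ?_⟩, ?_⟩
    · have := hU (Finset.mem_union_left _ hv)
      rw [closedNbhdSet_union] at this ⊢
      rcases Finset.mem_union.1 this with h1 | h1
      · obtain ⟨d, hd, e⟩ := mem_closedNbhdSet.1 h1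
        refine Finset.mem_union_left _ (mem_closedNbhdSet.2 ⟨d, Finset.mem_inter.2 ⟨hd, ?_⟩, e⟩)
        rcases Finset.mem_union.1 (hX hd) with h2 | h2
        · exact h2
        · rcases e with rfl | e
          · exact absurd rfl (h v hv v h2).1
          · exact absurd e.symm (h v hv d h2).2
      · exact Finset.mem_union_right _ h1
    · have := hU (Finset.mem_union_right _ hv)
      rw [closedNbhdSet_union] at this ⊢
      rcases Finset.mem_union.1 this with h1 | h1
      · obtain ⟨d, hd, e⟩ := mem_closedNbhdSet.1 h1
        refine Finset.mem_union_left _ (mem_closedNbhdSet.2 ⟨d, Finset.mem_inter.2 ⟨hd, ?_⟩, e⟩)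
        rcases Finset.mem_union.1 (hX hd) with h2 | h2
        · rcases e with rfl | e
          · exact absurd rfl (h v h2 v hv).1
          · exact absurd e (h d h2 v hv).2
        · exact h2
      · exact Finset.mem_union_right _ h1
    · rw [← Finset.inter_union_distrib_left, Finset.inter_eq_left.2 hX]
  · rintro ⟨X₁, X₂, h1, h2, rfl⟩
    refine ⟨Finset.union_subset_union h1.1 h2.1, Finset.union_subset ?_ ?_⟩
    · exact h1.2.trans (closedNbhdSet_mono (by
        intro v; simp only [Finset.mem_union]; tauto))
    · exact h2.2.trans (closedNbhdSet_mono (by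
        intro v; simp only [Finset.mem_union]; tauto))

end Neighbourhoods

/-! ### Tables as minima over families of vertex sets -/

section Tables

set_option linter.unusedSectionVars false

variable {V : Type u} [Fintype V] {G : SimpleGraph V}

/-- The entry of the table `M` at `S` is the least size of a member of the family `F` that
dominates `S`, if `S` is a subset of `Q`, and `∞` otherwise. -/
def Realizes (G : SimpleGraph V) (M : Table V) (F : Finset V → Prop) (Q : Finset V) : Prop :=
  ∀ (S : Finset V) (c : ℕ), M S ≤ c ↔ S ⊆ Q ∧ ∃ X, F X ∧ S ⊆ closedNbhdSet G X ∧ X.card ≤ c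

theorem add_le_natCast_iff {a b : ℕ∞} {c : ℕ} :
    a + b ≤ c ↔ ∃ c₁ c₂ : ℕ, a ≤ c₁ ∧ b ≤ c₂ ∧ c₁ + c₂ ≤ c := by
  constructor
  · intro h
    have ha : a ≠ ⊤ := by rintro rfl; simp at h
    have hb : b ≠ ⊤ := by rintro rfl; simp at h
    lift a to ℕ using ha
    lift b to ℕ using hb
    exact ⟨a, b, le_rfl, le_rfl, by exact_mod_cast h⟩
  · rintro ⟨c₁, c₂, h1, h2, h3⟩
    exact (add_le_add h1 h2).trans (by exact_mod_cast h3)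

theorem minConv_le_iff {M₁ M₂ : Table V} {S : Finset V} {c : ℕ} :
    minConv M₁ M₂ S ≤ c ↔
      ∃ A ⊆ S, ∃ c₁ c₂ : ℕ, M₁ A ≤ c₁ ∧ M₂ (S \ A) ≤ c₂ ∧ c₁ + c₂ ≤ c := by
  unfold minConv
  rw [Finset.inf_le_iff (by exact_mod_cast ENat.natCast_lt_top c)]
  simp only [Finset.mem_powerset, add_le_natCast_iff]

theorem Realizes.congr {M : Table V} {F F' : Finset V → Prop} {Q : Finset V}
    (h : Realizes G M F Q) (hF : ∀ X, F X ↔ F' X) : Realizes G M F' Q := by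
  intro S c; rw [h S c]; simp only [hF]

/-- Given a union `X₁ ∪ X₂` that dominates `S`, the first factor is asked for the part of `S`
dominated by `X₁` and the second for the rest. Disjointness makes the sizes add up exactly. -/
theorem Realizes.minConv {M₁ M₂ : Table V} {F₁ F₂ : Finset V → Prop} {Q : Finset V}
    (h₁ : Realizes G M₁ F₁ Q) (h₂ : Realizes G M₂ F₂ Q)
    (hd : ∀ X₁ X₂, F₁ X₁ → F₂ X₂ → Disjoint X₁ X₂) :
    Realizes G (minConv M₁ M₂) (fun X => ∃ X₁ X₂, F₁ X₁ ∧ F₂ X₂ ∧ X = X₁ ∪ X₂) Q := by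
  intro S c
  rw [minConv_le_iff]
  constructor
  · rintro ⟨A, hA, c₁, c₂, h1, h2, hc⟩
    obtain ⟨hQ1, X₁, hF1, hS1, hc1⟩ := (h₁ _ _).1 h1
    obtain ⟨hQ2, X₂, hF2, hS2, hc2⟩ := (h₂ _ _).1 h2
    refine ⟨fun v hv => ?_, X₁ ∪ X₂, ⟨X₁, X₂, hF1, hF2, rfl⟩, fun v hv => ?_, ?_⟩
    · by_cases hvA : v ∈ A
      · exact hQ1 hvA
      · exact hQ2 (Finset.mem_sdiff.2 ⟨hv, hvA⟩)
    · rw [closedNbhdSet_union]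
      by_cases hvA : v ∈ A
      · exact Finset.mem_union_left _ (hS1 hvA)
      · exact Finset.mem_union_right _ (hS2 (Finset.mem_sdiff.2 ⟨hv, hvA⟩))
    · rw [Finset.card_union_of_disjoint (hd _ _ hF1 hF2)]; omega
  · rintro ⟨hQ, X, ⟨X₁, X₂, hF1, hF2, rfl⟩, hS, hc⟩
    rw [Finset.card_union_of_disjoint (hd _ _ hF1 hF2)] at hc
    refine ⟨S ∩ closedNbhdSet G X₁, Finset.inter_subset_left, X₁.card, X₂.card,
      (h₁ _ _).2 ⟨Finset.inter_subset_left.trans hQ, X₁, hF1, Finset.inter_subset_right, le_rfl⟩,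
      (h₂ _ _).2 ⟨Finset.sdiff_subset.trans hQ, X₂, hF2, fun v hv => ?_, le_rfl⟩, hc⟩
    rw [closedNbhdSet_union] at hS
    simp only [Finset.mem_sdiff, Finset.mem_inter, not_and] at hv
    rcases Finset.mem_union.1 (hS hv.1) with h | h
    · exact absurd h (hv.2 hv.1)
    · exact h

theorem realizes_unitTable (Q : Finset V) : Realizes G unitTable (fun X => X = ∅) Q := by
  intro S c
  unfold unitTable
  by_cases hS : S = ∅
  · simp [hS]
  · simp [hS, closedNbhdSet]

/-- The start of the fold is an arbitrary family `F`, so that one statement serves both branches: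
`unitTable` if the vertex is not taken and `takeTable` if it is. -/
theorem Realizes.foldl {U : V → Finset V} {D Q : Finset V} {Mf : V → Table V} (ys : List V)
    (hM : ∀ y ∈ ys, Realizes G (Mf y) (Feasible G (U y) D) Q)
    (hsep : ys.Pairwise fun y z => Separated G (U y) (U z)) {M : Table V} {F : Finset V → Prop}
    (h : Realizes G M F Q) (hF : ∀ X, F X → ∀ y ∈ ys, Disjoint X (U y)) :
    Realizes G (ys.foldl (fun M y => HybridDomset.minConv M (Mf y)) M)
      (fun X => ∃ X₁ X₂, F X₁ ∧ Feasible G (ys.toFinset.biUnion U) D X₂ ∧ X = X₁ ∪ X₂) Q := by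
  induction ys generalizing M F with
  | nil =>
    refine h.congr fun X => ⟨fun hX => ⟨X, ∅, hX, ⟨by simp, by simp⟩, by simp⟩, ?_⟩
    rintro ⟨X₁, X₂, h1, h2, rfl⟩
    have : X₂ = ∅ := by simpa using h2.1
    simpa [this] using h1
  | cons y ys ih =>
    rw [List.foldl_cons]
    rw [List.pairwise_cons] at hsep
    have hsepU : Separated G (U y) (ys.toFinset.biUnion U) := by
      intro a ha b hb
      obtain ⟨z, hz, hbz⟩ := Finset.mem_biUnion.1 hb
      exact hsep.1 z (List.mem_toFinset.1 hz) a ha b hbz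
    have h1 := h.minConv (hM y List.mem_cons_self) fun X₁ X₂ a b =>
      (hF X₁ a y List.mem_cons_self).mono_right b.1
    refine (ih (fun z hz => hM z (List.mem_cons_of_mem _ hz)) hsep.2 h1 ?_).congr fun X => ?_
    · rintro X ⟨X₁, X₂, a, b, rfl⟩ z hz
      exact Finset.disjoint_union_left.2 ⟨hF X₁ a z (List.mem_cons_of_mem _ hz),
        (hsep.1 z hz).disjoint.mono_left b.1⟩
    · have e : (y :: ys).toFinset.biUnion U = U y ∪ ys.toFinset.biUnion U := by
        rw [List.toFinset_cons, Finset.biUnion_insert]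
      rw [e]
      simp only [feasible_union hsepU]
      constructor
      · rintro ⟨_, X₂, ⟨A, B, hA, hB, rfl⟩, h2, rfl⟩
        exact ⟨A, B ∪ X₂, hA, ⟨B, X₂, hB, h2, rfl⟩, Finset.union_assoc _ _ _⟩
      · rintro ⟨A, _, hA, ⟨B, X₂, hB, h2, rfl⟩, rfl⟩
        exact ⟨A ∪ B, X₂, ⟨A, B, hA, hB, rfl⟩, h2, (Finset.union_assoc _ _ _).symm⟩

end Tables

/-! ### Subtrees, and the correctness of the recursion -/

section Trees

theorem le_total_of_le_of_le {T : RootedTree.{u}} {a b z : T} (ha : a ≤ z) (hb : b ≤ z) : a ≤ b ∨ b ≤ a :=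
  (le_total_of_directed ha hb).symm

variable {T : RootedTree.{u}} [Fintype T] {G : SimpleGraph T}

/-- The set of nodes of the subtree rooted at `x`. -/
noncomputable def descendants (x : T) : Finset T := Finset.univ.filter fun v => x ≤ v

theorem mem_descendants {x v : T} : v ∈ descendants x ↔ x ≤ v := by simp [descendants]

theorem mem_ancestors {x v : T} : v ∈ ancestors T x ↔ v < x := by simp [ancestors]

theorem exists_covBy_le {x z : T} (h : x < z) : ∃ y, x ⋖ y ∧ y ≤ z := by
  obtain ⟨y, h1, h2⟩ := exists_covBy_le_of_lt h
  exact ⟨y, h1, h2⟩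

theorem ancestors_covBy {x y : T} (h : x ⋖ y) : ancestors T y = insert x (ancestors T x) := by
  ext v
  rw [Finset.mem_insert, mem_ancestors, mem_ancestors]
  constructor
  · intro hv
    rcases le_total_of_le_of_le hv.le h.le with h1 | h1
    · exact h1.eq_or_lt
    · rcases h1.eq_or_lt with h2 | h2
      · exact Or.inl h2.symm
      · exact absurd hv (h.2 h2)
  · rintro (rfl | hv)
    · exact h.lt
    · exact hv.trans h.lt

theorem self_notMem_ancestors (x : T) : x ∉ ancestors T x := by simp [mem_ancestors]

theorem card_ancestors_covBy {x y : T} (h : x ⋖ y) :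
    (ancestors T y).card = (ancestors T x).card + 1 := by
  rw [ancestors_covBy h, Finset.card_insert_of_notMem (self_notMem_ancestors x)]

/-- The ancestors of a node form a chain, so comparable nodes below `y` and `z` would make these two
children comparable. Edges join only comparable nodes. -/
theorem separated_descendants_of_covBy (hT : IsTreedepthDecomposition T G) {x y z : T}
    (hy : x ⋖ y) (hz : x ⋖ z) (hyz : y ≠ z) : Separated G (descendants y) (descendants z) := by
  have key : ∀ a b : T, y ≤ a → z ≤ b → ¬ a ≤ b := by
    intro a b ha hb hab
    rcases le_total_of_le_of_le (ha.trans hab) hb with h | h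
    · exact hz.2 hy.lt (h.lt_of_ne hyz)
    · exact hy.2 hz.lt (h.lt_of_ne hyz.symm)
  have key' : ∀ a b : T, y ≤ a → z ≤ b → ¬ b ≤ a := by
    intro a b ha hb hab
    rcases le_total_of_le_of_le ha (hb.trans hab) with h | h
    · exact hz.2 hy.lt (h.lt_of_ne hyz)
    · exact hy.2 hz.lt (h.lt_of_ne hyz.symm)
  intro a ha b hb
  rw [mem_descendants] at ha hb
  refine ⟨fun h => key a b ha hb h.le, fun h => ?_⟩
  rcases hT a b h with h | h
  · exact key a b ha hb h
  · exact key' a b ha hb h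

variable (I : Presentation T G)

theorem descendants_eq_insert (x : T) :
    descendants x = insert x ((I.children x).toFinset.biUnion descendants) := by
  ext v
  simp only [mem_descendants, Finset.mem_insert, Finset.mem_biUnion, List.mem_toFinset,
    I.mem_children]
  constructor
  · intro h
    rcases h.eq_or_lt with h | h
    · exact Or.inl h.symm
    · exact Or.inr (exists_covBy_le h)
  · rintro (rfl | ⟨y, h, h'⟩)
    · exact le_rfl
    · exact h.le.trans h'

theorem self_notMem_biUnion_descendants (x : T) :
    x ∉ (I.children x).toFinset.biUnion descendants := by
  simp only [mem_descendants, Finset.mem_biUnion, List.mem_toFinset, I.mem_children, not_exists,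
    not_and]
  exact fun y h h' => absurd h.lt h'.not_gt

theorem children_pairwise_separated (hT : IsTreedepthDecomposition T G) (x : T) :
    (I.children x).Pairwise fun y z => Separated G (descendants y) (descendants z) := by
  refine (I.children_nodup x).imp_of_mem fun {a b} ha hb hab => ?_
  exact separated_descendants_of_covBy hT ((I.mem_children _ _).1 ha) ((I.mem_children _ _).1 hb)
    hab

theorem realizes_takeTable (x : T) (D : Finset T) :
    Realizes G (takeTable G x D) (fun X => X = {x}) (ancestors T x \ D) := by
  intro S c
  have e : closedNbhdSet G {x} = closedNbhd G x := by simp [closedNbhdSet]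
  have e2 : S ⊆ (closedNbhd G x ∩ ancestors T x) \ D ↔
      S ⊆ ancestors T x \ D ∧ S ⊆ closedNbhd G x := by
    simp only [Finset.subset_iff, Finset.mem_sdiff, Finset.mem_inter]
    exact ⟨fun h => ⟨fun v hv => ⟨(h hv).1.2, (h hv).2⟩, fun v hv => (h hv).1.1⟩,
      fun h v hv => ⟨⟨h.2 hv, (h.1 hv).1⟩, (h.1 hv).2⟩⟩
  unfold takeTable
  simp only [e2]
  by_cases h : S ⊆ ancestors T x \ D ∧ S ⊆ closedNbhd G x
  · simp only [h, and_self, if_true, exists_eq_left, e, Finset.card_singleton, true_and]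
    exact_mod_cast Iff.rfl
  · simp only [if_neg h, exists_eq_left, e]
    simp only [top_le_iff, ENat.natCast_ne_top, false_iff]
    tauto

theorem domsetTable_leaf {x : T} {D : Finset T} (h : I.children x = []) :
    domsetTable I x D =
      fun S => if S = ∅ ∧ x ∈ closedNbhdSet G D then 0 else takeTable G x D S := by
  rw [domsetTable, if_pos h]

theorem domsetTable_node {x : T} {D : Finset T} (h : I.children x ≠ []) :
    domsetTable I x D = forget x fun S => min
      (if x ∉ closedNbhdSet G D ∧ x ∉ S then ⊤ else
        (I.children x).foldl (fun M y => minConv M (domsetTable I y D)) unitTable S)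
      ((I.children x).foldl (fun M y => minConv M (domsetTable I y (insert x D)))
        (takeTable G x D) S) := by
  rw [domsetTable, if_neg h, List.foldl_subtype (g := fun M y => minConv M (domsetTable I y D)),
    List.foldl_subtype (g := fun M y => minConv M (domsetTable I y (insert x D))),
    List.unattach_attach]
  all_goals intros; rfl

/-- Induction from the leaves upwards. The solutions inside the subtree of `x` are divided according
to whether they contain `x`; the two kinds are the families realized by the two folds. -/
theorem domsetTable_realizes (hT : IsTreedepthDecomposition T G) (x : T) (D : Finset T)
    (hD : D ⊆ ancestors T x) :
    Realizes G (domsetTable I x D) (Feasible G (descendants x) D) (ancestors T x \ D) := by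
  induction x using WellFoundedGT.induction generalizing D with
  | ind x ih =>
  have hxD : x ∉ D := fun h => self_notMem_ancestors x (hD h)
  by_cases hc : I.children x = []
  · rw [domsetTable_leaf I hc]
    have hdx : descendants x = {x} := by rw [descendants_eq_insert I, hc]; simp
    intro S c
    by_cases h : S = ∅ ∧ x ∈ closedNbhdSet G D
    · simp only [if_pos h, zero_le, true_iff]
      refine ⟨by simp [h.1], ∅, ⟨by simp, ?_⟩, by simp [h.1], by simp⟩
      rw [hdx, Finset.empty_union]; simpa using h.2
    · simp only [if_neg h]
      rw [realizes_takeTable x D S c]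
      refine and_congr_right fun hS => ⟨?_, ?_⟩
      · rintro ⟨X, rfl, h1⟩
        refine ⟨{x}, ⟨by rw [hdx], ?_⟩, h1⟩
        rw [hdx]
        exact Finset.subset_union_left.trans (subset_closedNbhdSet _)
      · rintro ⟨X, ⟨h1, h2⟩, h3, h4⟩
        rw [hdx] at h1 h2
        rcases Finset.subset_singleton_iff.1 h1 with rfl | rfl
        · refine absurd ⟨?_, ?_⟩ h
          · simpa [closedNbhdSet] using h3
          · simpa using h2
        · exact ⟨_, rfl, h3, h4⟩
  · rw [domsetTable_node I hc]
    set U := (I.children x).toFinset.biUnion descendants with hU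
    have hxU : x ∉ U := self_notMem_biUnion_descendants I x
    have hsep := children_pairwise_separated I hT x
    have hdx : descendants x = insert x U := descendants_eq_insert I x
    have hDx : insert x D ⊆ insert x (ancestors T x) := Finset.insert_subset_insert _ hD
    -- If `x` is not taken, it is an ancestor of the children outside `D`, hence a possible target.
    have h1 : Realizes G
        ((I.children x).foldl (fun M y => minConv M (domsetTable I y D)) unitTable)
        (Feasible G U D) (insert x (ancestors T x) \ D) := by
      refine (Realizes.foldl (U := descendants) (D := D) (I.children x) (fun y hy => ?_) hsep
        (realizes_unitTable _) ?_).congr ?_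
      · have hxy := (I.mem_children x y).1 hy
        have := ih y hxy.lt D (by
          rw [ancestors_covBy hxy]; exact hD.trans (Finset.subset_insert _ _))
        rwa [ancestors_covBy hxy] at this
      · rintro X rfl y _; simp
      · intro X; simp [← hU]
    -- If `x` is taken, it joins `D` and stops being a target, so the index sets are again those for
    -- `x` itself.
    have h2 : Realizes G
        ((I.children x).foldl (fun M y => minConv M (domsetTable I y (insert x D)))
          (takeTable G x D))
        (fun X => x ∈ X ∧ Feasible G (insert x U) D X) (ancestors T x \ D) := by
      refine (Realizes.foldl (U := descendants) (D := insert x D) (I.children x)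
        (fun y hy => ?_) hsep (realizes_takeTable x D) ?_).congr ?_
      · have hxy := (I.mem_children x y).1 hy
        have := ih y hxy.lt (insert x D) (by
          rw [ancestors_covBy hxy]; exact hDx)
        rwa [ancestors_covBy hxy, Finset.insert_sdiff_insert,
          Finset.sdiff_insert_of_notMem (self_notMem_ancestors x)] at this
      · rintro X rfl y hy
        rw [Finset.disjoint_singleton_left, mem_descendants]
        exact ((I.mem_children x y).1 hy).lt.not_ge
      · intro X
        rw [← hU]
        constructor
        · rintro ⟨_, X₂, rfl, ⟨h3, h4⟩, rfl⟩
          refine ⟨by simp, by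
            rw [← Finset.insert_eq]; exact Finset.insert_subset_insert _ h3, ?_⟩
          rw [Finset.insert_subset_iff]
          constructor
          · exact subset_closedNbhdSet _ (by simp)
          · refine h4.trans (closedNbhdSet_mono fun v => ?_)
            simp only [Finset.mem_union, Finset.mem_insert, Finset.mem_singleton]; tauto
        · rintro ⟨hx, h3, h4⟩
          refine ⟨{x}, X.erase x, rfl, ⟨?_, ?_⟩, ?_⟩
          · rwa [Finset.subset_insert_iff] at h3
          · refine ((Finset.subset_insert _ _).trans h4).trans (closedNbhdSet_mono fun v => ?_)
            simp only [Finset.mem_union, Finset.mem_insert, Finset.mem_erase]; tauto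
          · rw [← Finset.insert_eq, Finset.insert_erase hx]
    intro S c
    unfold forget
    by_cases hxS : x ∈ S
    · rw [if_pos hxS]
      simp only [top_le_iff, ENat.natCast_ne_top, false_iff]
      exact fun h => self_notMem_ancestors x (Finset.mem_sdiff.1 (h.1 hxS)).1
    · rw [if_neg hxS]
      have h2S := h2 S c
      -- Sets that contain `x` have no entry in the second table, so `forget` reads them from the
      -- first table only.
      have h2S' : ¬ ((I.children x).foldl (fun M y => minConv M (domsetTable I y (insert x D)))
          (takeTable G x D) (insert x S) ≤ c) := by
        rw [h2]
        exact fun h => self_notMem_ancestors x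
          (Finset.mem_sdiff.1 (h.1 (Finset.mem_insert_self _ _))).1
      have hQ : S ⊆ insert x (ancestors T x) \ D ↔ S ⊆ ancestors T x \ D := by
        simp only [Finset.subset_iff, Finset.mem_sdiff, Finset.mem_insert]
        refine forall₂_congr fun v hv => ?_
        have : v ≠ x := by rintro rfl; exact hxS hv
        tauto
      have hQ' : insert x S ⊆ insert x (ancestors T x) \ D ↔ S ⊆ ancestors T x \ D := by
        rw [Finset.insert_subset_iff, hQ]
        simp [hxD]
      have hF : ∀ X : Finset T, x ∉ X → (Feasible G (insert x U) D X ↔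
          Feasible G U D X ∧ x ∈ closedNbhdSet G (X ∪ D)) := by
        intro X hX
        unfold Feasible
        rw [Finset.insert_subset_iff, Finset.subset_insert_iff_of_notMem hX]
        tauto
      simp only [min_le_iff, h2S, h2S', or_false, hdx]
      have a1 := h1 S c
      have a2 := h1 (insert x S) c
      rw [hQ] at a1
      rw [hQ'] at a2
      by_cases hd : x ∈ closedNbhdSet G D
      · simp only [hd, not_true_eq_false, false_and, if_false, a1, a2]
        constructor
        · rintro ((⟨hS, X, hX, h3⟩ | ⟨hS, X, hX, h3⟩) | ⟨hS, X, hX, h3⟩)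
          · exact ⟨hS, X, (hF X fun h => hxU (hX.1 h)).2
              ⟨hX, closedNbhdSet_mono Finset.subset_union_right hd⟩, h3⟩
          · exact ⟨hS, X, hX.2, h3⟩
          · exact ⟨hS, X, (hF X fun h => hxU (hX.1 h)).2
              ⟨hX, closedNbhdSet_mono Finset.subset_union_right hd⟩,
              (Finset.subset_insert _ _).trans h3.1, h3.2⟩
        · rintro ⟨hS, X, hX, h3⟩
          by_cases hx : x ∈ X
          · exact Or.inl (Or.inr ⟨hS, X, ⟨hx, hX⟩, h3⟩)
          · exact Or.inl (Or.inl ⟨hS, X, ((hF X hx).1 hX).1, h3⟩)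
      -- Here `D` leaves `x` undominated. Of the first table only the entry at `insert x S`
      -- survives, and it states that `X` itself dominates `x`.
      · simp only [hd, hxS, not_false_eq_true, true_and, if_true, Finset.mem_insert_self,
          not_true_eq_false, if_false, a2, top_le_iff, ENat.natCast_ne_top, false_or]
        constructor
        · rintro (⟨hS, X, hX, h3⟩ | ⟨hS, X, hX, h3⟩)
          · exact ⟨hS, X, hX.2, h3⟩
          · rw [Finset.insert_subset_iff] at h3
            exact ⟨hS, X, (hF X fun h => hxU (hX.1 h)).2
              ⟨hX, closedNbhdSet_mono Finset.subset_union_left h3.1.1⟩, h3.1.2, h3.2⟩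
        · rintro ⟨hS, X, hX, h3⟩
          by_cases hx : x ∈ X
          · exact Or.inl ⟨hS, X, ⟨hx, hX⟩, h3⟩
          · refine Or.inr ⟨hS, X, ((hF X hx).1 hX).1, ?_, h3.2⟩
            rw [Finset.insert_subset_iff]
            refine ⟨?_, h3.1⟩
            have := ((hF X hx).1 hX).2
            rw [closedNbhdSet_union, Finset.mem_union] at this
            exact this.resolve_right hd

theorem exists_card_eq_dominationNumber {V : Type u} [Fintype V] (G : SimpleGraph V) :
    ∃ S : Finset V, closedNbhdSet G S = Finset.univ ∧ S.card = dominationNumber G :=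
  Nat.sInf_mem (s := {k | ∃ S : Finset V, closedNbhdSet G S = Finset.univ ∧ S.card = k})
    ⟨_, Finset.univ, Finset.eq_univ_of_forall fun v => subset_closedNbhdSet _ (Finset.mem_univ v),
      rfl⟩

theorem dominationNumber_le {V : Type u} [Fintype V] (G : SimpleGraph V) {S : Finset V}
    (h : closedNbhdSet G S = Finset.univ) : dominationNumber G ≤ S.card :=
  Nat.sInf_le ⟨S, h, rfl⟩

theorem hybridValue_eq (hT : IsTreedepthDecomposition T G) :
    hybridValue I = (dominationNumber G : ℕ∞) := by
  have h := domsetTable_realizes I hT ⊥ ∅ (by simp)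
  have hu : descendants (⊥ : T) = Finset.univ :=
    Finset.eq_univ_of_forall fun v => mem_descendants.2 bot_le
  apply le_antisymm
  · obtain ⟨S, h1, h2⟩ := exists_card_eq_dominationNumber G
    refine (h ∅ _).2 ⟨by simp, S, ⟨by simp [hu], by simp [h1]⟩, by simp, h2.le⟩
  · refine le_of_forall_ge fun c hc => ?_
    induction c with
    | top => exact le_top
    | coe c =>
      obtain ⟨_, X, ⟨_, hX⟩, _, h3⟩ := (h ∅ c).1 hc
      rw [hu, Finset.univ_subset_iff, Finset.union_empty] at hX
      exact_mod_cast (dominationNumber_le G hX).trans h3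

theorem card_ancestors_lt (x : T) : (ancestors T x).card < treeDepth T :=
  Nat.lt_of_succ_le (Finset.le_sup (f := fun x : T => (ancestors T x).card + 1)
    (Finset.mem_univ x))

/-- A solution for `S` is one for `∅`, which gives the lower bound; the whole subtree is a solution
for `∅`, which gives finiteness. -/
theorem domsetTable_bounds (hT : IsTreedepthDecomposition T G) {t : ℕ} (ht : treeDepth T ≤ t)
    (x : T) (D : Finset T) (hD : D ⊆ ancestors T x) :
    domsetTable I x D ∅ ≠ ⊤ ∧
      ∀ S : Finset T, domsetTable I x D S ≠ ⊤ →
        (S ⊆ ancestors T x ∧ Disjoint S D) ∧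
        domsetTable I x D ∅ ≤ domsetTable I x D S ∧
        domsetTable I x D S ≤ domsetTable I x D ∅ + (t : ℕ∞) := by
  have h := domsetTable_realizes I hT x D hD
  have h0 : domsetTable I x D ∅ ≠ ⊤ := by
    have := (h ∅ (descendants x).card).2 ⟨by simp, descendants x, ⟨subset_rfl,
      Finset.subset_union_left.trans (subset_closedNbhdSet _)⟩, by simp, le_rfl⟩
    exact ne_top_of_le_ne_top (ENat.natCast_ne_top _) this
  refine ⟨h0, fun S hS => ?_⟩
  obtain ⟨c, hc⟩ := ENat.ne_top_iff_exists.1 hS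
  obtain ⟨c₀, hc₀⟩ := ENat.ne_top_iff_exists.1 h0
  obtain ⟨hQ, X, hX, hSX, hXc⟩ := (h S c).1 hc.ge
  obtain ⟨-, X₀, hX₀, -, hXc₀⟩ := (h ∅ c₀).1 hc₀.ge
  have hQ' := Finset.subset_sdiff.1 hQ
  refine ⟨hQ', ?_, ?_⟩
  · rw [← hc]
    exact (h ∅ c).2 ⟨by simp, X, hX, by simp, hXc⟩
  · have hpick : ∀ s ∈ S, ∃ a ∈ X, s = a ∨ G.Adj a s := fun s hs => mem_closedNbhdSet.1 (hSX hs)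
    choose! f hf hf' using hpick
    rw [← hc₀]
    -- An optimum for `∅` together with one dominator `f s` for each target, borrowed from the
    -- witness of the finite entry; at most `S.card` vertices are added.
    have := (h S (c₀ + t)).2 ⟨hQ, X₀ ∪ S.image f, ⟨?_, ?_⟩, ?_, ?_⟩
    · exact_mod_cast this
    · refine Finset.union_subset hX₀.1 fun a ha => ?_
      obtain ⟨s, hs, rfl⟩ := Finset.mem_image.1 ha
      exact hX.1 (hf s hs)
    · refine hX₀.2.trans (closedNbhdSet_mono fun v => ?_)
      simp only [Finset.mem_union]; tauto
    · exact fun s hs => mem_closedNbhdSet.2 ⟨f s, Finset.mem_union_right _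
        (Finset.mem_image_of_mem f hs), hf' s hs⟩
    · refine (Finset.card_union_le _ _).trans (add_le_add hXc₀ ?_)
      exact Finset.card_image_le.trans ((Finset.card_le_card hQ'.1).trans
        ((card_ancestors_lt x).le.trans ht))

end Trees

end HybridDomset

namespace HybridDomset

/-! ### The relaxed cost with penalties -/

section Penalty

set_option linter.unusedSectionVars false

variable {V : Type u} [Fintype V] {G : SimpleGraph V}

/-- The least cost of dominating `Z` by vertices of `W`, where vertices of `Z` may be left
undominated at a cost of one each. -/
noncomputable def penaltyCost (G : SimpleGraph V) (W Z : Finset V) : ℕ :=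
  W.powerset.inf' (Finset.powerset_nonempty W) fun X => X.card + (Z \ closedNbhdSet G X).card

theorem penaltyCost_le_iff {W Z : Finset V} {c : ℕ} :
    penaltyCost G W Z ≤ c ↔ ∃ X ⊆ W, X.card + (Z \ closedNbhdSet G X).card ≤ c := by
  rw [penaltyCost, Finset.inf'_le_iff]
  simp only [Finset.mem_powerset]

theorem penaltyCost_le {W Z X : Finset V} (h : X ⊆ W) :
    penaltyCost G W Z ≤ X.card + (Z \ closedNbhdSet G X).card :=
  penaltyCost_le_iff.2 ⟨X, h, le_rfl⟩

theorem exists_penaltyCost_eq (W Z : Finset V) :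
    ∃ X ⊆ W, X.card + (Z \ closedNbhdSet G X).card ≤ penaltyCost G W Z :=
  penaltyCost_le_iff.1 le_rfl

/-- Either `x` is not used, or it is paid for and its closed neighbourhood is removed from the
targets. -/
theorem penaltyCost_insert_left {W Z : Finset V} {x : V} (hx : x ∉ W) :
    penaltyCost G (insert x W) Z =
      min (penaltyCost G W Z) (penaltyCost G W (Z \ closedNbhd G x) + 1) := by
  apply le_antisymm
  · rw [le_min_iff]
    constructor
    · obtain ⟨X, hX, h⟩ := exists_penaltyCost_eq (G := G) W Z
      exact (penaltyCost_le (hX.trans (Finset.subset_insert _ _))).trans h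
    · obtain ⟨X, hX, h⟩ := exists_penaltyCost_eq (G := G) W (Z \ closedNbhd G x)
      refine (penaltyCost_le (Finset.insert_subset_insert x hX)).trans ?_
      rw [closedNbhdSet_insert, Finset.card_insert_of_notMem fun h => hx (hX h), Finset.sdiff_union_distrib,
        ← Finset.inf_eq_inter, ← sdiff_sup, sup_comm]
      rw [sdiff_sdiff_left] at h
      have : (Z \ (closedNbhdSet G X ⊔ closedNbhd G x)).card =
        (Z \ (closedNbhd G x ⊔ closedNbhdSet G X)).card := by rw [sup_comm]
      omega
  · obtain ⟨X, hX, h⟩ := exists_penaltyCost_eq (G := G) (insert x W) Z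
    by_cases hxX : x ∈ X
    · refine (min_le_right _ _).trans (le_trans ?_ h)
      have := penaltyCost_le (G := G) (Z := Z \ closedNbhd G x) (Finset.subset_insert_iff.1 hX)
      rw [sdiff_sdiff_left, Finset.sup_eq_union, ← closedNbhdSet_insert,
        Finset.insert_erase hxX] at this
      have := Finset.card_erase_add_one hxX
      omega
    · rw [Finset.subset_insert_iff_of_notMem hxX] at hX
      exact (min_le_left _ _).trans ((penaltyCost_le hX).trans h)

theorem penaltyCost_mono {W Z Z' : Finset V} (h : Z ⊆ Z') :
    penaltyCost G W Z ≤ penaltyCost G W Z' := by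
  obtain ⟨X, hX, h'⟩ := exists_penaltyCost_eq (G := G) W Z'
  exact (penaltyCost_le hX).trans (le_trans
    (Nat.add_le_add_left (Finset.card_le_card (Finset.sdiff_subset_sdiff h subset_rfl)) _) h')

theorem penaltyCost_union_le (W Z S : Finset V) :
    penaltyCost G W (S ∪ Z) ≤ penaltyCost G W Z + S.card := by
  obtain ⟨X, hX, h⟩ := exists_penaltyCost_eq (G := G) W Z
  refine (penaltyCost_le hX).trans ?_
  have : ((S ∪ Z) \ closedNbhdSet G X).card ≤ S.card + (Z \ closedNbhdSet G X).card := by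
    rw [Finset.union_sdiff_distrib]
    exact (Finset.card_union_le _ _).trans
      (Nat.add_le_add_right (Finset.card_le_card Finset.sdiff_subset) _)
  omega

/-- No choice inside `W` reaches `x`, so its penalty is unavoidable. -/
theorem penaltyCost_insert_right {W Z : Finset V} {x : V} (hx : x ∉ Z)
    (hW : x ∉ closedNbhdSet G W) :
    penaltyCost G W (insert x Z) = penaltyCost G W Z + 1 := by
  apply le_antisymm
  · simpa using penaltyCost_union_le (G := G) W Z {x}
  · obtain ⟨X, hX, h⟩ := exists_penaltyCost_eq (G := G) W (insert x Z)
    have hxX : x ∉ closedNbhdSet G X := fun h => hW (closedNbhdSet_mono hX h)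
    rw [Finset.insert_sdiff_of_notMem _ hxX, Finset.card_insert_of_notMem (by simp [hx])] at h
    have := penaltyCost_le (G := G) (Z := Z) hX
    omega

theorem penaltyCost_empty_left (Z : Finset V) : penaltyCost G ∅ Z = Z.card := by
  simp [penaltyCost, closedNbhdSet]

theorem penaltyCost_le_card (W Z : Finset V) : penaltyCost G W Z ≤ Z.card := by
  simpa [closedNbhdSet] using penaltyCost_le (G := G) (Z := Z) (Finset.empty_subset W)

/-- Adding all undominated vertices to `X` yields a dominating set whose size is the penalized cost
of `X`. -/
theorem penaltyCost_univ : penaltyCost G Finset.univ Finset.univ = dominationNumber G := by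
  apply le_antisymm
  · obtain ⟨S, h1, h2⟩ := exists_card_eq_dominationNumber G
    refine (penaltyCost_le (Finset.subset_univ S)).trans ?_
    simp [h1, h2]
  · obtain ⟨X, -, h⟩ := exists_penaltyCost_eq (G := G) Finset.univ Finset.univ
    refine le_trans ?_ h
    rw [← Finset.card_union_of_disjoint
      (Finset.disjoint_sdiff.mono_left (subset_closedNbhdSet (G := G) X))]
    refine dominationNumber_le G (Finset.eq_univ_of_forall fun v => ?_)
    by_cases hv : v ∈ closedNbhdSet G X
    · exact closedNbhdSet_mono Finset.subset_union_left hv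
    · exact subset_closedNbhdSet _ (by simp [hv])

/-- The value of the state in which the vertices of `D` have been taken, `W` has been processed
completely, and the vertices of `S` are still to be dominated: the cost of `D` and of the best
choice of vertices in `W`. -/
noncomputable def stateCost (G : SimpleGraph V) (W D S : Finset V) : ℕ :=
  D.card + penaltyCost G W ((S ∪ W) \ closedNbhdSet G D)

theorem stateCost_mono {W D S S' : Finset V} (h : S ⊆ S') :
    stateCost G W D S ≤ stateCost G W D S' :=
  Nat.add_le_add_left (penaltyCost_mono
    (Finset.sdiff_subset_sdiff (Finset.union_subset_union h subset_rfl) subset_rfl)) _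

/-- At worst the penalty is paid for every vertex of `S`. This bounds the stored offsets by the
depth. -/
theorem stateCost_le_add_card (W D S : Finset V) :
    stateCost G W D S ≤ stateCost G W D ∅ + S.card := by
  unfold stateCost
  rw [Finset.union_sdiff_distrib, Finset.empty_union]
  have h1 := penaltyCost_union_le (G := G) W (W \ closedNbhdSet G D) (S \ closedNbhdSet G D)
  have h2 := Finset.card_le_card (Finset.sdiff_subset (s := S) (t := closedNbhdSet G D))
  omega

theorem stateCost_le (W D S : Finset V) : stateCost G W D S ≤ 2 * Fintype.card V := by
  have h1 := penaltyCost_le_card (G := G) W ((S ∪ W) \ closedNbhdSet G D)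
  have h2 := Finset.card_le_univ ((S ∪ W) \ closedNbhdSet G D)
  have h3 := Finset.card_le_univ D
  unfold stateCost; omega

/-- Used when `x` is entered: the half of the new table in which `x` is a target is the old table
plus a constant, `0` or `1`. The truncated difference is the form in which the program computes this
constant. -/
theorem stateCost_insert_target {W D S : Finset V} {x : V} (hS : x ∉ S)
    (hW : x ∉ closedNbhdSet G W) :
    stateCost G W D (insert x S) =
      stateCost G W D S + (1 - if x ∈ closedNbhdSet G D then 1 else 0) := by
  unfold stateCost
  rw [Finset.insert_union]
  by_cases hD : x ∈ closedNbhdSet G D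
  · rw [Finset.insert_sdiff_of_mem _ hD]; simp [hD]
  · have hxW : x ∉ W := fun h => hW (subset_closedNbhdSet _ h)
    rw [Finset.insert_sdiff_of_notMem _ hD, penaltyCost_insert_right (by simp [hS, hxW]) hW]
    simp [hD, add_assoc]

/-- Since `x` has no neighbour in `W`, taking it only relieves targets in `S`. So the table for the
second branch is obtained from the one before the visit by a change of index. -/
theorem stateCost_insert_taken {W D S : Finset V} {x : V} (hD : x ∉ D)
    (hW : x ∉ closedNbhdSet G W) :
    stateCost G W (insert x D) S = stateCost G W D (S \ closedNbhd G x) + 1 := by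
  unfold stateCost
  rw [Finset.card_insert_of_notMem hD, closedNbhdSet_insert]
  have : (S ∪ W) \ (closedNbhd G x ∪ closedNbhdSet G D) =
      (S \ closedNbhd G x ∪ W) \ closedNbhdSet G D := by
    ext v
    simp only [Finset.mem_sdiff, Finset.mem_union]
    have : v ∈ W → v ∉ closedNbhd G x := fun hv h =>
      hW (Finset.mem_biUnion.2 ⟨v, hv, mem_closedNbhd_comm.1 h⟩)
    tauto
  rw [this]; omega

/-- Used on return from `x`. Adjacency between `x` and `W` is allowed, as `W` then contains the
subtrees of the children. Of the first branch only the values with `x` as a target are needed. -/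
theorem stateCost_insert_processed {W D S : Finset V} {x : V} (hW : x ∉ W) (hD : x ∉ D) :
    stateCost G (insert x W) D S =
      min (stateCost G W D (insert x S)) (stateCost G W (insert x D) S) := by
  unfold stateCost
  rw [penaltyCost_insert_left hW, Finset.card_insert_of_notMem hD, closedNbhdSet_insert,
    Finset.union_insert, Finset.insert_union]
  have : (insert x (S ∪ W) \ closedNbhdSet G D) \ closedNbhd G x =
      (S ∪ W) \ (closedNbhd G x ∪ closedNbhdSet G D) := by
    ext v
    simp only [Finset.mem_sdiff, Finset.mem_union, Finset.mem_insert]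
    have : v = x → v ∈ closedNbhd G x := fun h => mem_closedNbhd.2 (Or.inl h)
    tauto
  rw [this, ← min_add_add_left]
  congr 1; omega

theorem stateCost_empty : stateCost G ∅ ∅ ∅ = 0 := by
  simp [stateCost, penaltyCost_empty_left]

theorem stateCost_univ : stateCost G Finset.univ ∅ ∅ = dominationNumber G := by
  simp [stateCost, closedNbhdSet, penaltyCost_univ]

end Penalty

/-! ### Vertex sets as bit patterns -/

section Codes

set_option linter.unusedSectionVars false

/-- The subtracted number has only bits of `i`, so no borrow occurs. This is a set difference
without a complement operation. -/
theorem testBit_sub_and (i N j : ℕ) :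
    (i - (i &&& N)).testBit j = (i.testBit j && !N.testBit j) := by
  induction j generalizing i N with
  | zero =>
    have h : (i &&& N) % 2 = (i % 2) &&& (N % 2) := by
      simpa using Nat.and_mod_two_pow (a := i) (b := N) (n := 1)
    have h' : i &&& N ≤ i := Nat.and_le_left
    have h2 : ∀ a b : ℕ, a < 2 → b < 2 → a &&& b = a * b := by
      intro a b ha hb; interval_cases a <;> interval_cases b <;> rfl
    rw [h2 _ _ (Nat.mod_lt _ two_pos) (Nat.mod_lt _ two_pos)] at h
    simp only [Nat.testBit_zero]
    rcases Nat.mod_two_eq_zero_or_one i with hi | hi <;>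
      rcases Nat.mod_two_eq_zero_or_one N with hN | hN <;> rw [hi, hN] at h <;>
      simp only [hi, hN] <;> simp <;> omega
  | succ j ih =>
    simp only [Nat.testBit_succ]
    rw [← ih]
    have h : (i &&& N) % 2 = (i % 2) &&& (N % 2) := by
      simpa using Nat.and_mod_two_pow (a := i) (b := N) (n := 1)
    have h' : i &&& N ≤ i := Nat.and_le_left
    have h'' : (i &&& N) / 2 = i / 2 &&& N / 2 := Nat.and_div_two
    have h3 : i % 2 &&& N % 2 ≤ i % 2 := Nat.and_le_left
    congr 1
    omega

theorem two_pow_and_ne_zero {j i : ℕ} : 2 ^ j &&& i ≠ 0 ↔ i.testBit j = true := by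
  rw [Nat.two_pow_and]
  cases i.testBit j <;> simp

variable {V : Type u} [Fintype V] {G : SimpleGraph V} {β : V → ℕ} {k : ℕ}

/-- A coding of a vertex set `P` and a subset `D`: vertices outside `P` have code `0`, those in `D`
have code `1`, and each of the others has its own power of two. -/
structure IsCode (β : V → ℕ) (k : ℕ) : Prop where
  pow : ∀ v, β v = 0 ∨ ∃ j ≤ k, β v = 2 ^ j
  inj : ∀ u v, β u = β v → β u ≠ 0 → β u ≠ 1 → u = v

/-- The vertices with code `1`. -/
noncomputable def takenSet (β : V → ℕ) : Finset V := Finset.univ.filter fun v => β v = 1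

/-- The set of vertices with index `i`. -/
noncomputable def indexedSet (β : V → ℕ) (i : ℕ) : Finset V :=
  Finset.univ.filter fun v => β v ≠ 1 ∧ β v &&& i ≠ 0

theorem mem_takenSet {v : V} : v ∈ takenSet β ↔ β v = 1 := by simp [takenSet]

theorem mem_indexedSet {v : V} {i : ℕ} : v ∈ indexedSet β i ↔ β v ≠ 1 ∧ β v &&& i ≠ 0 := by
  simp [indexedSet]

theorem indexedSet_zero : indexedSet β 0 = ∅ := by simp [indexedSet]

theorem notMem_indexedSet {x : V} (hx : β x = 0) (i : ℕ) : x ∉ indexedSet β i := by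
  simp [mem_indexedSet, hx]

theorem notMem_takenSet {x : V} (hx : β x = 0) : x ∉ takenSet β := by
  simp [mem_takenSet, hx]

/-- An entered vertex receives the next free bit. Bit `0` is reserved for taken vertices, so tables
have `2 ^ (k + 1)` entries for `k` undecided ancestors and the lowest bit of an index is idle. -/
theorem IsCode.update_new (h : IsCode β k) (x : V) :
    IsCode (Function.update β x (2 ^ (k + 1))) (k + 1) := by
  have hne : ∀ v, β v ≠ 2 ^ (k + 1) := by
    intro v hv
    rcases h.pow v with h1 | ⟨j, hj, h1⟩
    · have := Nat.two_pow_pos (k + 1); omega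
    · have := Nat.pow_right_injective (le_refl 2) (h1.symm.trans hv); omega
  constructor
  · intro v
    by_cases hv : v = x
    · subst hv; exact Or.inr ⟨k + 1, le_rfl, by simp⟩
    · rw [Function.update_of_ne hv]
      exact (h.pow v).imp id fun ⟨j, hj, e⟩ => ⟨j, by omega, e⟩
  · intro u v
    by_cases hu : u = x <;> by_cases hv : v = x
    · intros; rw [hu, hv]
    · subst hu; simp only [Function.update_self, Function.update_of_ne hv]
      intro e; exact absurd e.symm (hne v)
    · subst hv; simp only [Function.update_self, Function.update_of_ne hu]
      intro e; exact absurd e (hne u)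
    · simp only [Function.update_of_ne hu, Function.update_of_ne hv]
      exact h.inj u v

theorem IsCode.update_one (h : IsCode β k) (x : V) : IsCode (Function.update β x 1) k := by
  constructor
  · intro v
    by_cases hv : v = x
    · subst hv; exact Or.inr ⟨0, by omega, by simp⟩
    · rw [Function.update_of_ne hv]; exact h.pow v
  · intro u v
    by_cases hu : u = x <;> by_cases hv : v = x
    · intros; rw [hu, hv]
    · subst hu; simp
    · subst hv; simp only [Function.update_self, Function.update_of_ne hu]
      intro e _ h1; exact absurd e h1
    · simp only [Function.update_of_ne hu, Function.update_of_ne hv]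
      exact h.inj u v

theorem indexedSet_update_low (x : V) (hx : β x = 0) {i : ℕ} (hi : i < 2 ^ (k + 1)) :
    indexedSet (Function.update β x (2 ^ (k + 1))) i = indexedSet β i := by
  ext v
  rw [mem_indexedSet, mem_indexedSet]
  by_cases hv : v = x
  · subst hv
    rw [Function.update_self, hx, two_pow_and_ne_zero, Nat.testBit_lt_two_pow hi]
    simp
  · rw [Function.update_of_ne hv]

theorem indexedSet_update_high (h : IsCode β k) (x : V) {i : ℕ} (hi : i < 2 ^ (k + 1)) :
    indexedSet (Function.update β x (2 ^ (k + 1))) (2 ^ (k + 1) + i) =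
      insert x (indexedSet β i) := by
  ext v
  rw [mem_indexedSet, Finset.mem_insert, mem_indexedSet]
  by_cases hv : v = x
  · subst hv
    rw [Function.update_self, two_pow_and_ne_zero, Nat.testBit_two_pow_add_eq,
      Nat.testBit_lt_two_pow hi]
    simp
  · rw [Function.update_of_ne hv]
    simp only [hv, false_or]
    refine and_congr_right fun _ => ?_
    rcases h.pow v with h1 | ⟨j, hj, h1⟩
    · simp [h1]
    · rw [h1, two_pow_and_ne_zero, two_pow_and_ne_zero,
        Nat.testBit_two_pow_add_gt (by omega)]

theorem indexedSet_update_one (x : V) (hx : β x = 0) (i : ℕ) :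
    indexedSet (Function.update β x 1) i = indexedSet β i := by
  ext v
  rw [mem_indexedSet, mem_indexedSet]
  by_cases hv : v = x
  · subst hv; simp [hx]
  · rw [Function.update_of_ne hv]

theorem takenSet_update_new (x : V) (hx : β x = 0) :
    takenSet (Function.update β x (2 ^ (k + 1))) = takenSet β := by
  ext v
  rw [mem_takenSet, mem_takenSet]
  by_cases hv : v = x
  · subst hv; simp [hx]
  · rw [Function.update_of_ne hv]

theorem takenSet_update_one (x : V) :
    takenSet (Function.update β x 1) = insert x (takenSet β) := by
  ext v
  rw [mem_takenSet, Finset.mem_insert, mem_takenSet]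
  by_cases hv : v = x
  · subst hv; simp
  · rw [Function.update_of_ne hv]; simp [hv]

/-- The bitwise disjunction of the codes of the members of a list. -/
def codeMask (β : V → ℕ) (l : List V) : ℕ := l.foldl (fun a u => a ||| β u) 0

theorem codeMask_append_singleton (l : List V) (u : V) :
    codeMask β (l ++ [u]) = codeMask β l ||| β u := by
  simp [codeMask]

theorem testBit_codeMask (l : List V) (j : ℕ) :
    (codeMask β l).testBit j = true ↔ ∃ u ∈ l, (β u).testBit j = true := by
  induction l using List.reverseRecOn with
  | nil => simp [codeMask]
  | append_singleton l u ih =>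
    rw [codeMask_append_singleton, Nat.testBit_or, Bool.or_eq_true, ih]
    simp only [List.mem_append, List.mem_singleton, or_and_right, exists_or, exists_eq_left]

theorem IsCode.lt (h : IsCode β k) (v : V) : β v < 2 ^ (k + 1) := by
  rcases h.pow v with h1 | ⟨j, hj, h1⟩
  · rw [h1]; positivity
  · rw [h1]; exact Nat.pow_lt_pow_right (by norm_num) (by omega)

theorem IsCode.codeMask_lt (h : IsCode β k) (l : List V) : codeMask β l < 2 ^ (k + 1) := by
  induction l using List.reverseRecOn with
  | nil => simp [codeMask]
  | append_singleton l u ih =>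
    rw [codeMask_append_singleton]; exact Nat.or_lt_two_pow ih (h.lt u)

/-- Codes other than `0` and `1` are not shared, so a bit of `i` is cleared exactly if its owner is
a neighbour of `x`. The mask may also clear the idle bit `0`, which changes no set. -/
theorem indexedSet_sub_mask (h : IsCode β k) {x : V} (hx : β x = 0) {l : List V}
    (hl : ∀ u, u ∈ l ↔ G.Adj x u) (i : ℕ) :
    indexedSet β (i - (i &&& codeMask β l)) = indexedSet β i \ closedNbhd G x := by
  ext v
  rw [Finset.mem_sdiff, mem_indexedSet, mem_indexedSet, mem_closedNbhd, and_assoc]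
  refine and_congr_right fun h1 => ?_
  rcases h.pow v with h0 | ⟨j, hj, hv⟩
  · simp [h0]
  · rw [hv, two_pow_and_ne_zero, two_pow_and_ne_zero, testBit_sub_and]
    simp only [Bool.and_eq_true, Bool.not_eq_true', not_or, ← Bool.not_eq_true, testBit_codeMask]
    refine and_congr_right fun _ => ?_
    -- The code of `x` is still `0`, so open and closed neighbourhoods remove the same indexed
    -- vertices.
    have hvx : v ≠ x := by rintro rfl; rw [hx] at hv; exact absurd hv (by positivity)
    constructor
    · intro h2
      refine ⟨hvx, fun e => h2 ⟨v, (hl v).2 e, by simp [hv]⟩⟩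
    · rintro ⟨-, h2⟩ ⟨u, hu, hb⟩
      rcases h.pow u with h0 | ⟨j', hj', hu'⟩
      · simp [h0] at hb
      · rw [hu', Nat.testBit_two_pow] at hb
        have e : β u = β v := by rw [hu', hv, of_decide_eq_true hb]
        have := h.inj u v e (by rw [hu']; positivity) (by rw [e]; exact h1)
        subst this
        exact h2 ((hl u).1 hu)

/-- All taken vertices share bit `0`, so the one scan that collects the neighbours also tells
whether `x` is dominated. -/
theorem codeMask_and_one (h : IsCode β k) {x : V} (hx : β x = 0) {l : List V}
    (hl : ∀ u, u ∈ l ↔ G.Adj x u) :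
    codeMask β l &&& 1 = if x ∈ closedNbhdSet G (takenSet β) then 1 else 0 := by
  have e := Nat.and_two_pow (codeMask β l) 0
  rw [pow_zero, mul_one] at e
  rw [e]
  have : (codeMask β l).testBit 0 = true ↔ x ∈ closedNbhdSet G (takenSet β) := by
    rw [testBit_codeMask, mem_closedNbhdSet]
    constructor
    · rintro ⟨u, hu, hb⟩
      rcases h.pow u with h0 | ⟨j', hj', hu'⟩
      · simp [h0] at hb
      · rw [hu', Nat.testBit_two_pow] at hb
        have := of_decide_eq_true hb
        subst this
        exact ⟨u, mem_takenSet.2 hu', Or.inr ((hl u).1 hu).symm⟩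
    · rintro ⟨u, hu, rfl | e⟩
      · rw [mem_takenSet, hx] at hu; omega
      · rw [mem_takenSet] at hu
        exact ⟨u, (hl u).2 e.symm, by simp [hu]⟩
  by_cases hb : (codeMask β l).testBit 0 = true
  · rw [if_pos (this.1 hb), hb]; rfl
  · rw [if_neg fun h => hb (this.2 h), Bool.not_eq_true _ |>.mp hb]; rfl

end Codes

end HybridDomset

namespace HybridDomset

/-! ### A small structured language above the machine -/

/-- The contents of registers and of arrays; the arrays are numbered from `1` to `6`. -/
structure Store where
  reg : ℕ → ℕ
  arr : ℕ → ℕ → ℕ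

namespace Store

def setReg (σ : Store) (r v : ℕ) : Store := ⟨Function.update σ.reg r v, σ.arr⟩

def setArr (σ : Store) (j i v : ℕ) : Store :=
  ⟨σ.reg, Function.update σ.arr j (Function.update (σ.arr j) i v)⟩

@[simp] theorem setReg_reg (σ : Store) (r v s : ℕ) :
    (σ.setReg r v).reg s = if s = r then v else σ.reg s := by
  simp [setReg, Function.update_apply]

@[simp] theorem setReg_arr (σ : Store) (r v : ℕ) : (σ.setReg r v).arr = σ.arr := rfl

@[simp] theorem setArr_reg (σ : Store) (j i v : ℕ) : (σ.setArr j i v).reg = σ.reg := rfl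

@[simp] theorem setArr_arr (σ : Store) (j i v j' i' : ℕ) :
    (σ.setArr j i v).arr j' i' = if j' = j ∧ i' = i then v else σ.arr j' i' := by
  by_cases h : j' = j
  · subst h; simp [setArr, Function.update_apply]
  · simp [setArr, h]

end Store

/-- Expressions over registers, arrays, and the input. -/
inductive Expr
  | reg (r : ℕ)
  | lit (c : ℕ)
  | bin (o : BinOp) (e f : Expr)
  | arr (j : ℕ) (e : Expr)
  | inp (e : Expr)

namespace Expr

@[simp] def eval (w : List ℕ) (σ : Store) : Expr → ℕ
  | reg r => σ.reg r
  | lit c => c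
  | bin o e f => o.eval (e.eval w σ) (f.eval w σ)
  | arr j e => σ.arr j (e.eval w σ)
  | inp e => w.getD (e.eval w σ) 0

/-- The number of instructions for the evaluation of an expression. -/
@[simp] def size : Expr → ℕ
  | reg _ => 1
  | lit _ => 1
  | bin _ e f => e.size + f.size + 1
  | arr _ e => e.size + 6
  | inp e => e.size + 1

/-- All constants are small, all arrays exist, and there are no shifts to the left. -/
@[simp] def Tame : Expr → Prop
  | reg _ => True
  | lit c => c ≤ 8
  | bin o e f => (match o with | .shiftLeft => False | _ => True) ∧ e.Tame ∧ f.Tame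
  | arr j e => (1 ≤ j ∧ j ≤ 6) ∧ e.Tame
  | inp e => e.Tame

end Expr

/-- The code that replaces `i` by the address of the `i`-th element of the array `j`. -/
def addressCode (j τ : ℕ) : Program :=
  .seq (.op .add (8 * τ + 7) (8 * τ + 7) (8 * τ + 7)) <|
  .seq (.op .add (8 * τ + 7) (8 * τ + 7) (8 * τ + 7)) <|
  .seq (.op .add (8 * τ + 7) (8 * τ + 7) (8 * τ + 7)) <|
  .seq (.const (8 * (τ + 1) + 7) j) (.op .add (8 * τ + 7) (8 * τ + 7) (8 * (τ + 1) + 7))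

/-- The code that evaluates an expression into the temporary cell number `τ`. -/
def Expr.code : Expr → ℕ → Program
  | .reg r, τ => .op .and (8 * τ + 7) (8 * r) (8 * r)
  | .lit c, τ => .const (8 * τ + 7) c
  | .bin o e f, τ => .seq (e.code τ) <| .seq (f.code (τ + 1))
      (.op o (8 * τ + 7) (8 * τ + 7) (8 * (τ + 1) + 7))
  | .arr j e, τ => .seq (e.code τ) <| .seq (addressCode j τ) (.load (8 * τ + 7) (8 * τ + 7))
  | .inp e, τ => .seq (e.code τ) (.read (8 * τ + 7) (8 * τ + 7))

/-- The conjunction of a cell with itself serves as a move instruction; cell `7` is the first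
temporary cell. -/
def assign (r : ℕ) (e : Expr) : Program := .seq (e.code 0) (.op .and (8 * r) 7 7)

def put (j : ℕ) (e f : Expr) : Program :=
  .seq (e.code 0) <| .seq (addressCode j 0) <| .seq (f.code 1) (.store 7 15)

def ifte (e : Expr) (p q : Program) : Program := .seq (e.code 0) (.ite 7 p q)

/-- The machine tests only a cell, so the guard is evaluated before the loop and again at the end of
each round. -/
def loopWhile (e : Expr) (p : Program) : Program := .seq (e.code 0) (.loop 7 (.seq p (e.code 0)))

/-- The memory `m` represents the store `σ`. -/
def Represents (σ : Store) (m : Memory) : Prop :=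
  (∀ i, m (8 * i) = σ.reg i) ∧ ∀ j, 1 ≤ j → j ≤ 6 → ∀ i, m (8 * i + j) = σ.arr j i

/-- There are at most 64 temporary cells, with contents at most `W`. -/
def TempBounded (W : ℕ) (m : Memory) : Prop :=
  ∀ i, m (8 * i + 7) ≤ W ∧ (64 ≤ i → m (8 * i + 7) = 0)

/-- An input, an invariant for the stores that occur in a computation, and a bound on all numbers
in the input and in these stores. -/
structure Env where
  inp : List ℕ
  J : Store → Prop
  B : ℕ
  eight_le : 8 ≤ B
  inp_le : ∀ i, inp.getD i 0 ≤ B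
  reg_le : ∀ σ, J σ → ∀ r, σ.reg r ≤ B
  arr_le : ∀ σ, J σ → ∀ j i, 1 ≤ j → j ≤ 6 → σ.arr j i ≤ B

theorem update_temp_apply (m : Memory) (τ v a : ℕ) :
    (m.update (8 * τ + 7) v) a = if a = 8 * τ + 7 then v else m a := by
  rw [Finsupp.coe_update, Function.update_apply]

theorem Represents.update_temp {σ : Store} {m : Memory} (h : Represents σ m) (τ v : ℕ) :
    Represents σ (m.update (8 * τ + 7) v) := by
  constructor
  · intro i; rw [update_temp_apply, if_neg (by omega)]; exact h.1 i
  · intro j h1 h2 i; rw [update_temp_apply, if_neg (by omega)]; exact h.2 j h1 h2 i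

theorem TempBounded.update_temp {W : ℕ} {m : Memory} (h : TempBounded W m) {τ v : ℕ}
    (hτ : τ < 64) (hv : v ≤ W) : TempBounded W (m.update (8 * τ + 7) v) := by
  intro i
  rw [update_temp_apply]
  split_ifs with h1
  · exact ⟨hv, by omega⟩
  · exact h i

/-! ### Correctness of the compilation, and a program logic that counts steps -/

namespace Env

variable (E : Env)

/-- The factor `2 ^ 40` allows for intermediate values of expressions of size at most 40, see
`eval_le`. -/
def Rel (σ : Store) (m : Memory) : Prop :=
  E.J σ ∧ Represents σ m ∧ TempBounded (2 ^ 40 * E.B) m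

def Good (m : Memory) : Prop := ∃ σ, E.Rel σ m

variable {E}

theorem Rel.update_temp {σ : Store} {m : Memory} (h : E.Rel σ m) {τ v : ℕ} (hτ : τ < 64)
    (hv : v ≤ 2 ^ 40 * E.B) : E.Rel σ (m.update (8 * τ + 7) v) :=
  ⟨h.1, h.2.1.update_temp τ v, h.2.2.update_temp hτ hv⟩

theorem or_le_add (a b : ℕ) : a ||| b ≤ a + b := by
  induction a using Nat.strong_induction_on generalizing b with
  | _ a ih =>
    rcases Nat.eq_zero_or_pos a with rfl | ha
    · simp
    · have h1 := ih (a / 2) (by omega) (b / 2)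
      rw [← Nat.or_div_two] at h1
      have h2 : (a ||| b) % 2 = (a % 2) ||| (b % 2) := by
        simpa using Nat.or_mod_two_pow (a := a) (b := b) (n := 1)
      have h3 : ∀ a b : ℕ, a < 2 → b < 2 → a ||| b ≤ a + b := by
        intro a b ha hb; interval_cases a <;> interval_cases b <;> decide
      have h4 := h3 _ _ (Nat.mod_lt a two_pos) (Nat.mod_lt b two_pos)
      omega

theorem eval_binOp_le (o : BinOp) (ho : match o with | .shiftLeft => False | _ => True)
    {a b A C : ℕ} (ha : a ≤ A) (hb : b ≤ C) (hA : 1 ≤ A) : o.eval a b ≤ A + C := by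
  cases o with
  | add => exact add_le_add ha hb
  | sub => exact (Nat.sub_le _ _).trans (ha.trans (Nat.le_add_right _ _))
  | and => exact (Nat.and_le_left (n := a) (m := b)).trans (ha.trans (Nat.le_add_right _ _))
  | or =>
    exact (or_le_add a b).trans (add_le_add ha hb)
  | shiftLeft => exact ho.elim
  | shiftRight =>
    have : a >>> b ≤ a := Nat.shiftRight_le a b
    exact this.trans (ha.trans (Nat.le_add_right _ _))
  | lt => simp only [BinOp.eval]; split_ifs <;> omega
  | eq => simp only [BinOp.eval]; split_ifs <;> omega

/-- Without left shifts a result is bounded by the sum of the bounds for the two operands, and `2 ^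
a + 2 ^ b ≤ 2 ^ (a + b + 1)`. Values read from arrays or the input are bounded by `B` again. -/
theorem eval_le {σ : Store} (hσ : E.J σ) (e : Expr) (he : e.Tame) :
    e.eval E.inp σ ≤ 2 ^ e.size * E.B := by
  have hB := E.eight_le
  induction e with
  | reg r => simp; have := E.reg_le σ hσ r; omega
  | lit c => simp at he ⊢; omega
  | bin o e f ihe ihf =>
    simp only [Expr.Tame] at he
    have h1 : 1 ≤ 2 ^ e.size * E.B := Nat.mul_pos (by positivity) (by omega)
    refine (eval_binOp_le o he.1 (ihe he.2.1) (ihf he.2.2) h1).trans ?_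
    simp only [Expr.size, pow_add, pow_one]
    have h2 : 1 ≤ 2 ^ e.size := Nat.one_le_two_pow
    have h3 : 1 ≤ 2 ^ f.size := Nat.one_le_two_pow
    nlinarith [Nat.mul_le_mul_left (2 ^ e.size * E.B) h3, Nat.mul_le_mul_right E.B
      (Nat.mul_le_mul_right (2 ^ f.size) h2)]
  | arr j e ih =>
    exact (E.arr_le σ hσ _ _ he.1.1 he.1.2).trans (Nat.le_mul_of_pos_left _ (by positivity))
  | inp e ih =>
    exact (E.inp_le _).trans (Nat.le_mul_of_pos_left _ (by positivity))

theorem run_addressCode {σ : Store} {m : Memory} (hm : E.Rel σ m) {j τ : ℕ} (hj : j ≤ 8)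
    (hτ : τ + 1 < 64) (hv : 8 * m (8 * τ + 7) + 8 ≤ 2 ^ 40 * E.B) :
    ∃ tr m', Run E.inp (addressCode j τ) m tr m' ∧ E.Rel σ m' ∧
      m' (8 * τ + 7) = 8 * m (8 * τ + 7) + j ∧
      (∀ i < τ, m' (8 * i + 7) = m (8 * i + 7)) ∧ tr.length = 5 ∧ ∀ x ∈ tr, E.Rel σ x := by
  set v := m (8 * τ + 7) with hv'
  set m₁ := m.update (8 * τ + 7) (v + v) with h1
  set m₂ := m₁.update (8 * τ + 7) (m₁ (8 * τ + 7) + m₁ (8 * τ + 7)) with h2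
  set m₃ := m₂.update (8 * τ + 7) (m₂ (8 * τ + 7) + m₂ (8 * τ + 7)) with h3
  set m₄ := m₃.update (8 * (τ + 1) + 7) j with h4
  set m₅ := m₄.update (8 * τ + 7) (m₄ (8 * τ + 7) + m₄ (8 * (τ + 1) + 7)) with h5
  have e1 : m₁ (8 * τ + 7) = 2 * v := by rw [h1, update_temp_apply, if_pos rfl]; omega
  have e2 : m₂ (8 * τ + 7) = 4 * v := by rw [h2, update_temp_apply, if_pos rfl, e1]; omega
  have e3 : m₃ (8 * τ + 7) = 8 * v := by rw [h3, update_temp_apply, if_pos rfl, e2]; omega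
  have e4 : m₄ (8 * τ + 7) = 8 * v := by
    rw [h4, update_temp_apply, if_neg (by omega), e3]
  have e4' : m₄ (8 * (τ + 1) + 7) = j := by rw [h4, update_temp_apply, if_pos rfl]
  have e5 : m₅ (8 * τ + 7) = 8 * v + j := by
    rw [h5, update_temp_apply, if_pos rfl, e4, e4']
  have r1 : E.Rel σ m₁ := hm.update_temp (by omega) (by omega)
  have r2 : E.Rel σ m₂ := r1.update_temp (by omega) (by omega)
  have r3 : E.Rel σ m₃ := r2.update_temp (by omega) (by omega)
  have r4 : E.Rel σ m₄ := r3.update_temp (by omega) (by omega)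
  have r5 : E.Rel σ m₅ := r4.update_temp (by omega) (by omega)
  refine ⟨_, m₅, (Run.op .add _ _ _ m).seq ((Run.op .add _ _ _ m₁).seq
    ((Run.op .add _ _ _ m₂).seq ((Run.const _ _ m₃).seq (Run.op .add _ _ _ m₄)))), r5, e5, ?_,
    rfl, ?_⟩
  · intro i hi
    rw [h5, update_temp_apply, if_neg (by omega), h4, update_temp_apply, if_neg (by omega), h3,
      update_temp_apply, if_neg (by omega), h2, update_temp_apply, if_neg (by omega), h1,
      update_temp_apply, if_neg (by omega)]
  · intro x hx
    simp only [List.cons_append, List.nil_append, List.mem_cons, List.not_mem_nil, or_false] at hx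
    rcases hx with rfl | rfl | rfl | rfl | rfl
    exacts [r1, r2, r3, r4, r5]

/-- The temporary cells form a stack: cells below `τ` survive, so the left operand is intact when
the right one has been evaluated. The represented store never changes. -/
theorem run_code {σ : Store} (e : Expr) (he : e.Tame) (hs : e.size ≤ 40) {m : Memory}
    (hm : E.Rel σ m) {τ : ℕ} (hτ : τ + e.size ≤ 64) :
    ∃ tr m', Run E.inp (e.code τ) m tr m' ∧ E.Rel σ m' ∧ m' (8 * τ + 7) = e.eval E.inp σ ∧
      (∀ i < τ, m' (8 * i + 7) = m (8 * i + 7)) ∧ tr.length = e.size ∧ ∀ x ∈ tr, E.Rel σ x := by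
  have hle : ∀ e : Expr, e.Tame → e.size ≤ 40 → e.eval E.inp σ ≤ 2 ^ 40 * E.B := fun e he hs =>
    (eval_le hm.1 e he).trans (Nat.mul_le_mul_right _ (Nat.pow_le_pow_right (by norm_num) hs))
  induction e generalizing m τ with
  | reg r =>
    have hr : m (8 * r) = σ.reg r := hm.2.1.1 r
    have hv : Nat.land (m (8 * r)) (m (8 * r)) = σ.reg r := by
      rw [hr]; exact Nat.and_self _
    have h2 := hle _ he hs
    simp only [Expr.eval] at h2
    have hrel := hm.update_temp (τ := τ) (v := BinOp.eval .and (m (8 * r)) (m (8 * r)))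
      (by simp at hτ; omega) (by simp only [BinOp.eval]; rw [hv]; exact h2)
    refine ⟨_, _, Run.op .and _ _ _ m, hrel, ?_, ?_, rfl, ?_⟩
    · rw [update_temp_apply, if_pos rfl]; exact hv
    · intro i hi; rw [update_temp_apply, if_neg (by omega)]
    · simpa using hrel
  | lit c =>
    have hrel := hm.update_temp (τ := τ) (v := c) (by simp at hτ; omega) (hle _ he hs)
    refine ⟨_, _, Run.const _ _ m, hrel, ?_, ?_, rfl, ?_⟩
    · rw [update_temp_apply, if_pos rfl]; rfl
    · intro i hi; rw [update_temp_apply, if_neg (by omega)]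
    · simpa using hrel
  | bin o e f ihe ihf =>
    have hle' := hle _ he hs
    simp only [Expr.size, Expr.Tame] at hs hτ he
    obtain ⟨tr₁, m₁, R₁, rel₁, v₁, k₁, l₁, g₁⟩ := ihe he.2.1 (by omega) hm (τ := τ) (by omega)
    obtain ⟨tr₂, m₂, R₂, rel₂, v₂, k₂, l₂, g₂⟩ := ihf he.2.2 (by omega) rel₁ (τ := τ + 1)
      (by omega)
    have hv : o.eval (m₂ (8 * τ + 7)) (m₂ (8 * (τ + 1) + 7)) = (Expr.bin o e f).eval E.inp σ := by
      rw [k₂ τ (by omega), v₁, v₂]; rfl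
    have hrel := rel₂.update_temp (τ := τ)
      (v := o.eval (m₂ (8 * τ + 7)) (m₂ (8 * (τ + 1) + 7))) (by omega) (by rw [hv]; exact hle')
    refine ⟨_, _, R₁.seq (R₂.seq (Run.op o _ _ _ m₂)), hrel, ?_, ?_, ?_, ?_⟩
    · rw [update_temp_apply, if_pos rfl, hv]
    · intro i hi
      rw [update_temp_apply, if_neg (by omega), k₂ i (by omega), k₁ i hi]
    · simp [l₁, l₂]; omega
    · intro x hx
      simp only [List.mem_append, List.mem_singleton] at hx
      rcases hx with hx | hx | rfl
      exacts [g₁ x hx, g₂ x hx, hrel]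
  | arr j e ih =>
    have hle' := hle _ he hs
    simp only [Expr.size, Expr.Tame] at hs hτ he
    obtain ⟨tr₁, m₁, R₁, rel₁, v₁, k₁, l₁, g₁⟩ := ih he.2 (by omega) hm (τ := τ) (by omega)
    obtain ⟨tr₂, m₂, R₂, rel₂, v₂, k₂, l₂, g₂⟩ := run_addressCode rel₁ (j := j) (τ := τ)
      (by omega) (by omega) (by
        rw [v₁]
        have h1 := eval_le hm.1 e he.2
        -- An array access counts 6 in the size; this leaves room for the factor 8 in the address.
        have h2 : 2 ^ e.size * E.B ≤ 2 ^ 34 * E.B :=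
          Nat.mul_le_mul_right _ (Nat.pow_le_pow_right (by norm_num) (by omega))
        have := E.eight_le
        omega)
    have hv : m₂ (m₂ (8 * τ + 7)) = (Expr.arr j e).eval E.inp σ := by
      rw [v₂, v₁, rel₂.2.1.2 j he.1.1 he.1.2]; rfl
    have hrel := rel₂.update_temp (τ := τ) (v := m₂ (m₂ (8 * τ + 7))) (by omega)
      (by rw [hv]; exact hle')
    refine ⟨_, _, R₁.seq (R₂.seq (Run.load _ _ m₂)), hrel, ?_, ?_, ?_, ?_⟩
    · rw [update_temp_apply, if_pos rfl, hv]
    · intro i hi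
      rw [update_temp_apply, if_neg (by omega), k₂ i (by omega), k₁ i hi]
    · simp [l₁, l₂]
    · intro x hx
      simp only [List.mem_append, List.mem_singleton] at hx
      rcases hx with hx | hx | rfl
      exacts [g₁ x hx, g₂ x hx, hrel]
  | inp e ih =>
    have hle' := hle _ he hs
    simp only [Expr.size, Expr.Tame] at hs hτ he
    obtain ⟨tr₁, m₁, R₁, rel₁, v₁, k₁, l₁, g₁⟩ := ih he (by omega) hm (τ := τ) (by omega)
    have hv : E.inp.getD (m₁ (8 * τ + 7)) 0 = (Expr.inp e).eval E.inp σ := by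
      rw [v₁]; rfl
    have hrel := rel₁.update_temp (τ := τ) (v := E.inp.getD (m₁ (8 * τ + 7)) 0) (by omega)
      (by rw [hv]; exact hle')
    refine ⟨_, _, R₁.seq (Run.read _ _ m₁), hrel, ?_, ?_, ?_, ?_⟩
    · rw [update_temp_apply, if_pos rfl, hv]
    · intro i hi
      rw [update_temp_apply, if_neg (by omega), k₁ i (by omega)]
    · simp [l₁]
    · intro x hx
      simp only [List.mem_append, List.mem_singleton] at hx
      rcases hx with hx | rfl
      exacts [g₁ x hx, hrel]

/-- Started in any memory that represents `σ`, the program halts within `n` steps in a memory that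
represents a store with the property `Q`, and all memories in between represent stores that satisfy
the invariant. -/
def WP (E : Env) (p : Program) (n : ℕ) (Q : Store → Prop) (σ : Store) : Prop :=
  ∀ m, E.Rel σ m → ∃ tr m' σ', Run E.inp p m tr m' ∧ E.Rel σ' m' ∧ Q σ' ∧ tr.length ≤ n ∧
    ∀ x ∈ tr, E.Good x

theorem WP.of_inv {p : Program} {n : ℕ} {Q : Store → Prop} {σ : Store}
    (h : E.J σ → E.WP p n Q σ) : E.WP p n Q σ := fun m hm => h hm.1 m hm

theorem WP.mono {p : Program} {n n' : ℕ} {Q Q' : Store → Prop} {σ : Store} (h : E.WP p n Q σ)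
    (hn : n ≤ n') (hQ : ∀ σ', E.J σ' → Q σ' → Q' σ') : E.WP p n' Q' σ := by
  intro m hm
  obtain ⟨tr, m', σ', h1, h2, h3, h4, h5⟩ := h m hm
  exact ⟨tr, m', σ', h1, h2, hQ σ' h2.1 h3, h4.trans hn, h5⟩

theorem WP.seq {p q : Program} {n₁ n₂ : ℕ} {Q : Store → Prop} {σ : Store}
    (h : E.WP p n₁ (fun σ' => E.WP q n₂ Q σ') σ) : E.WP (.seq p q) (n₁ + n₂) Q σ := by
  intro m hm
  obtain ⟨tr, m', σ', h1, h2, h3, h4, h5⟩ := h m hm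
  obtain ⟨tr', m'', σ'', h1', h2', h3', h4', h5'⟩ := h3 m' h2
  refine ⟨_, m'', σ'', h1.seq h1', h2', h3', ?_, ?_⟩
  · rw [List.length_append]; omega
  · intro x hx
    exact (List.mem_append.1 hx).elim (h5 x) (h5' x)

theorem WP.assign {r : ℕ} {e : Expr} {Q : Store → Prop} {σ : Store} (he : e.Tame)
    (hs : e.size ≤ 40) (hJ : E.J σ → E.J (σ.setReg r (e.eval E.inp σ)))
    (hQ : Q (σ.setReg r (e.eval E.inp σ))) : E.WP (assign r e) 50 Q σ := by
  intro m hm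
  obtain ⟨tr, m', R, rel, v, -, l, g⟩ := run_code e he hs hm (τ := 0) (by omega)
  have hv : Nat.land (m' 7) (m' 7) = e.eval E.inp σ := by
    rw [← v]; exact Nat.and_self _
  have hrel : E.Rel (σ.setReg r (e.eval E.inp σ))
      (m'.update (8 * r) (BinOp.eval .and (m' 7) (m' 7))) := by
    simp only [BinOp.eval]
    rw [hv]
    refine ⟨hJ hm.1, ⟨fun i => ?_, fun j h1 h2 i => ?_⟩, fun i => ?_⟩
    · rw [Finsupp.coe_update, Function.update_apply, Store.setReg_reg, rel.2.1.1]
      simp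
    · rw [Finsupp.coe_update, Function.update_of_ne (by omega)]
      exact rel.2.1.2 j h1 h2 i
    · rw [Finsupp.coe_update, Function.update_of_ne (by omega)]
      exact rel.2.2 i
  refine ⟨_, _, _, R.seq (Run.op .and _ _ _ m'), hrel, hQ, ?_, ?_⟩
  · simp [l]; omega
  · intro x hx
    rcases List.mem_append.1 hx with hx | hx
    · exact ⟨σ, g x hx⟩
    · rw [List.mem_singleton.1 hx]; exact ⟨_, hrel⟩

theorem WP.put {j : ℕ} {e f : Expr} {Q : Store → Prop} {σ : Store} (hj : 1 ≤ j ∧ j ≤ 6)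
    (he : e.Tame) (hs : e.size ≤ 30) (hf : f.Tame) (hs' : f.size ≤ 40)
    (hJ : E.J σ → E.J (σ.setArr j (e.eval E.inp σ) (f.eval E.inp σ)))
    (hQ : Q (σ.setArr j (e.eval E.inp σ) (f.eval E.inp σ))) : E.WP (put j e f) 100 Q σ := by
  intro m hm
  obtain ⟨tr₁, m₁, R₁, rel₁, v₁, -, l₁, g₁⟩ := run_code e he (by omega) hm (τ := 0) (by omega)
  obtain ⟨tr₂, m₂, R₂, rel₂, v₂, k₂, l₂, g₂⟩ := run_addressCode rel₁ (j := j) (τ := 0)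
      (by omega) (by omega) (by
        rw [v₁]
        have h1 := eval_le hm.1 e he
        have h2 : 2 ^ e.size * E.B ≤ 2 ^ 34 * E.B :=
          Nat.mul_le_mul_right _ (Nat.pow_le_pow_right (by norm_num) (by omega))
        have := E.eight_le
        omega)
  obtain ⟨tr₃, m₃, R₃, rel₃, v₃, k₃, l₃, g₃⟩ := run_code f hf hs' rel₂ (τ := 1) (by omega)
  have ha : m₃ 7 = 8 * e.eval E.inp σ + j := by
    have := k₃ 0 (by omega)
    rw [v₂, v₁] at this
    exact this
  have hb : m₃ 15 = f.eval E.inp σ := v₃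
  have hrel : E.Rel (σ.setArr j (e.eval E.inp σ) (f.eval E.inp σ))
      (m₃.update (m₃ 7) (m₃ 15)) := by
    rw [ha, hb]
    refine ⟨hJ hm.1, ⟨fun i => ?_, fun j' h1 h2 i => ?_⟩, fun i => ?_⟩
    · rw [Finsupp.coe_update, Function.update_of_ne (by omega)]
      exact rel₃.2.1.1 i
    · rw [Finsupp.coe_update, Function.update_apply, Store.setArr_arr, rel₃.2.1.2 j' h1 h2]
      refine if_congr ?_ rfl rfl
      omega
    · rw [Finsupp.coe_update, Function.update_of_ne (by omega)]
      exact rel₃.2.2 i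
  refine ⟨_, _, _, R₁.seq (R₂.seq (R₃.seq (Run.store _ _ m₃))), hrel, hQ, ?_, ?_⟩
  · simp [l₁, l₂, l₃]; omega
  · intro x hx
    simp only [List.mem_append, List.mem_singleton] at hx
    rcases hx with hx | hx | hx | rfl
    exacts [⟨σ, g₁ x hx⟩, ⟨σ, g₂ x hx⟩, ⟨σ, g₃ x hx⟩, ⟨_, hrel⟩]

theorem WP.ifte {e : Expr} {p q : Program} {n : ℕ} {Q : Store → Prop} {σ : Store} (he : e.Tame)
    (hs : e.size ≤ 40) (hp : e.eval E.inp σ ≠ 0 → E.WP p n Q σ)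
    (hq : e.eval E.inp σ = 0 → E.WP q n Q σ) : E.WP (ifte e p q) (50 + n) Q σ := by
  intro m hm
  obtain ⟨tr₁, m₁, R₁, rel₁, v₁, -, l₁, g₁⟩ := run_code e he hs hm (τ := 0) (by omega)
  by_cases h : e.eval E.inp σ = 0
  · obtain ⟨tr, m', σ', h1, h2, h3, h4, h5⟩ := hq h m₁ rel₁
    refine ⟨_, m', σ', R₁.seq (Run.ite_false (v₁.trans h) h1), h2, h3, ?_, ?_⟩
    · simp [l₁]; omega
    · intro x hx
      simp only [List.mem_append, List.mem_cons] at hx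
      rcases hx with hx | rfl | hx
      exacts [⟨σ, g₁ x hx⟩, ⟨σ, rel₁⟩, h5 x hx]
  · obtain ⟨tr, m', σ', h1, h2, h3, h4, h5⟩ := hp h m₁ rel₁
    refine ⟨_, m', σ', R₁.seq (Run.ite_true (fun h' => h (v₁.symm.trans h')) h1), h2, h3, ?_, ?_⟩
    · simp [l₁]; omega
    · intro x hx
      simp only [List.mem_append, List.mem_cons] at hx
      rcases hx with hx | rfl | hx
      exacts [⟨σ, g₁ x hx⟩, ⟨σ, rel₁⟩, h5 x hx]

theorem WP.while_done {e : Expr} {p : Program} {Q : Store → Prop} {σ : Store} (he : e.Tame)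
    (hs : e.size ≤ 40) (h : e.eval E.inp σ = 0) (hQ : Q σ) : E.WP (loopWhile e p) 50 Q σ := by
  intro m hm
  obtain ⟨tr₁, m₁, R₁, rel₁, v₁, -, l₁, g₁⟩ := run_code e he hs hm (τ := 0) (by omega)
  refine ⟨_, m₁, σ, R₁.seq (Run.loop_false (v₁.trans h)), rel₁, hQ, ?_, ?_⟩
  · simp [l₁]; omega
  · intro x hx
    simp only [List.mem_append, List.mem_singleton] at hx
    rcases hx with hx | rfl
    exacts [⟨σ, g₁ x hx⟩, ⟨σ, rel₁⟩]

theorem WP.while_step {e : Expr} {p : Program} {c n : ℕ} {Q : Store → Prop} {σ : Store}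
    (he : e.Tame) (hs : e.size ≤ 40) (h : e.eval E.inp σ ≠ 0)
    (hp : E.WP p c (fun σ' => E.WP (loopWhile e p) n Q σ') σ) :
    E.WP (loopWhile e p) (c + 50 + n) Q σ := by
  intro m hm
  obtain ⟨tr₁, m₁, R₁, rel₁, v₁, -, l₁, g₁⟩ := run_code e he hs hm (τ := 0) (by omega)
  obtain ⟨tr, m', σ', h1, h2, h3, h4, h5⟩ := hp m₁ rel₁
  obtain ⟨tr', m'', σ'', h1', h2', h3', h4', h5'⟩ := h3 m' h2
  -- The run of the remaining loop starts with an evaluation of the guard. That part is cut off and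
  -- becomes the end of the current round.
  cases h1' with
  | seq ha hb =>
    refine ⟨_, m'', σ'', R₁.seq (Run.loop_true (fun h' => h (v₁.symm.trans h')) (h1.seq ha) hb),
      h2', h3', ?_, ?_⟩
    · simp only [List.length_append, List.length_cons] at h4' ⊢
      omega
    · intro x hx
      simp only [List.mem_append, List.mem_cons] at hx h5'
      rcases hx with hx | rfl | (hx | hx) | hx
      exacts [⟨σ, g₁ x hx⟩, ⟨σ, rel₁⟩, h5 x hx, h5' x (Or.inl hx), h5' x (Or.inr hx)]

/-- `P i` is the invariant after `i` rounds; the induction is on the number of rounds that remain.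
-/
theorem WP.while_count {e : Expr} {p : Program} {c : ℕ} (he : e.Tame) (hs : e.size ≤ 40)
    (P : ℕ → Store → Prop) (N : ℕ)
    (step : ∀ i < N, ∀ σ, P i σ → e.eval E.inp σ ≠ 0 ∧ E.WP p c (P (i + 1)) σ)
    (finish : ∀ σ, P N σ → e.eval E.inp σ = 0) {σ : Store} (h : P 0 σ) :
    E.WP (loopWhile e p) (N * (c + 50) + 50) (P N) σ := by
  have key : ∀ k ≤ N, ∀ σ, P (N - k) σ →
      E.WP (loopWhile e p) (k * (c + 50) + 50) (P N) σ := by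
    intro k
    induction k with
    | zero =>
      intro _ σ hσ
      exact (WP.while_done he hs (finish σ hσ) hσ).mono (by omega) fun _ _ h => h
    | succ k ih =>
      intro hk σ hσ
      obtain ⟨h1, h2⟩ := step _ (by omega) σ hσ
      refine (WP.while_step he hs h1 (n := k * (c + 50) + 50)
        (h2.mono le_rfl fun σ' _ h' => ih (by omega) σ' ?_)).mono (le_of_eq (by ring))
        fun _ _ h => h
      rwa [show N - (k + 1) + 1 = N - k by omega] at h'
  exact key N le_rfl σ (by rwa [Nat.sub_self])

end Env

end HybridDomset

namespace HybridDomset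

/-! ### Reading the input array -/

section Input

theorem flatten_length_take_succ (L : List (List ℕ)) {i : ℕ} (h : i < L.length) :
    (L.take (i + 1)).flatten.length = (L.take i).flatten.length + L[i].length := by
  rw [List.take_add_one, List.getElem?_eq_getElem h, Option.toList_some, List.flatten_append,
    List.length_append, List.flatten_singleton]

theorem encodeLists_length (base : ℕ) (L : List (List ℕ)) :
    (encodeLists base L).length = L.length + 1 + L.flatten.length := by
  simp [encodeLists]

theorem getD_encodeLists_pointer {w pre post : List ℕ} {base : ℕ} {L : List (List ℕ)}
    (hw : w = pre ++ (encodeLists base L ++ post)) (hb : pre.length = base) {i : ℕ}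
    (hi : i ≤ L.length) :
    w.getD (base + i) 0 = base + (L.length + 1) + (L.take i).flatten.length := by
  subst hw hb
  rw [List.getD_append_right _ _ _ _ (by omega), Nat.add_sub_cancel_left, encodeLists,
    List.append_assoc, List.getD_append _ _ _ _ (by simp; omega), List.getD_eq_getElem _ _ (by simp; omega)]
  simp

theorem getD_encodeLists_element {w pre post : List ℕ} {base : ℕ} {L : List (List ℕ)}
    (hw : w = pre ++ (encodeLists base L ++ post)) (hb : pre.length = base) {i : ℕ}
    (hi : i < L.length) {j : ℕ} (hj : j < L[i].length) :
    w.getD (base + (L.length + 1) + (L.take i).flatten.length + j) 0 = L[i][j] := by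
  subst hw hb
  have e : L.flatten = (L.take i).flatten ++ (L[i] ++ (L.drop (i + 1)).flatten) := by
    conv_lhs => rw [← List.take_append_drop i L, List.drop_eq_getElem_cons hi,
      List.flatten_append, List.flatten_cons]
  rw [List.getD_append_right _ _ _ _ (by omega), encodeLists, List.append_assoc,
    List.getD_append_right _ _ _ _ (by simp; omega), e, List.append_assoc,
    List.getD_append_right _ _ _ _ (by simp; omega), List.append_assoc,
    List.getD_append _ _ _ _ (by simp; omega), List.getD_eq_getElem _ _ (by simp; omega)]
  congr 1
  simp; omega

theorem le_of_mem_encodeLists {base M : ℕ} {L : List (List ℕ)}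
    (h1 : base + (encodeLists base L).length ≤ M) (h2 : ∀ l ∈ L, ∀ v ∈ l, v ≤ M) {v : ℕ}
    (hv : v ∈ encodeLists base L) : v ≤ M := by
  rw [encodeLists_length] at h1
  rw [encodeLists, List.mem_append] at hv
  rcases hv with hv | hv
  · obtain ⟨i, -, rfl⟩ := List.mem_map.1 hv
    have : (L.take i).flatten.length ≤ L.flatten.length := by
      conv_rhs => rw [← List.take_append_drop i L]
      rw [List.flatten_append, List.length_append]; omega
    omega
  · obtain ⟨l, hl, hvl⟩ := List.mem_flatten.1 hv
    exact h2 l hl v hvl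

variable {T : RootedTree.{u}} [Fintype T] {G : SimpleGraph T} (I : Presentation T G)

/-- The structure of the input array: `c` is the address of the table of pointers to the lists of
children, and `pa x` and `pc x` are the addresses of the lists that belong to `x`. -/
structure Layout (w : List ℕ) (c : ℕ) (pa pc : T → ℕ) : Prop where
  card : w.getD 0 0 = Fintype.card T
  root : w.getD 1 0 = I.num ⊥
  table : w.getD (Fintype.card T + 2) 0 = c
  adj_start : ∀ x, w.getD (I.num x + 2) 0 = pa x
  adj_end : ∀ x, w.getD (I.num x + 3) 0 = pa x + (I.adj x).length
  adj_get : ∀ x j (h : j < (I.adj x).length), w.getD (pa x + j) 0 = I.num (I.adj x)[j]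
  children_start : ∀ x, w.getD (c + I.num x) 0 = pc x
  children_end : ∀ x, w.getD (c + I.num x + 1) 0 = pc x + (I.children x).length
  children_get : ∀ x j (h : j < (I.children x).length),
    w.getD (pc x + j) 0 = I.num (I.children x)[j]
  le : ∀ i, w.getD i 0 ≤ 8 * Fintype.card T ^ 2

theorem numberedLists_length (f : T → List T) :
    (numberedLists I f).length = Fintype.card T := by simp [numberedLists]

theorem numberedLists_getElem (f : T → List T) (x : T)
    (h : (I.num x : ℕ) < (numberedLists I f).length) :
    (numberedLists I f)[(I.num x : ℕ)] = (f x).map fun v => (I.num v : ℕ) := by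
  simp [numberedLists]

theorem numberedLists_flatten_length_le {f : T → List T} (hf : ∀ x, (f x).Nodup) :
    (numberedLists I f).flatten.length ≤ Fintype.card T ^ 2 := by
  rw [List.length_flatten, sq]
  have : ∀ a ∈ (numberedLists I f).map List.length, a ≤ Fintype.card T := by
    intro a ha
    simp only [numberedLists, List.map_map, List.mem_map] at ha
    obtain ⟨i, -, rfl⟩ := ha
    simpa using (hf (I.num.symm i)).length_le_card
  have h := List.sum_le_card_nsmul _ _ this
  simpa [numberedLists_length] using h

/-- The last pointer of the adjacency part, at address `n + 2`, points just behind that part. This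
is where the pointers to the lists of children begin, so `c` can be read from the input. -/
theorem exists_layout : ∃ c pa pc, Layout I (inputArray I) c pa pc := by
  set n := Fintype.card T with hn
  have hn1 : 1 ≤ n := Fintype.card_pos_iff.2 ⟨⊥⟩
  set A := numberedLists I I.adj with hA
  set Cs := numberedLists I I.children with hC
  have lA : A.length = n := numberedLists_length I _
  have lC : Cs.length = n := numberedLists_length I _
  set eA := encodeLists 2 A with heA
  set eC := encodeLists (2 + eA.length) Cs with heC
  have hw : inputArray I = [n, (I.num ⊥ : ℕ)] ++ eA ++ eC := rfl
  have hw1 : inputArray I = [n, (I.num ⊥ : ℕ)] ++ (encodeLists 2 A ++ eC) := by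
    rw [hw, List.append_assoc]
  have hw2 : inputArray I =
      ([n, (I.num ⊥ : ℕ)] ++ eA) ++ (encodeLists (2 + eA.length) Cs ++ []) := by
    rw [hw, List.append_nil]
  have b1 : [n, (I.num ⊥ : ℕ)].length = 2 := rfl
  have b2 : ([n, (I.num ⊥ : ℕ)] ++ eA).length = 2 + eA.length := by
    rw [List.length_append, b1]
  have leA : eA.length = n + 1 + A.flatten.length := by rw [heA, encodeLists_length, lA]
  have leC : eC.length = n + 1 + Cs.flatten.length := by rw [heC, encodeLists_length, lC]
  have fA : A.flatten.length ≤ n ^ 2 := numberedLists_flatten_length_le I I.adj_nodup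
  have fC : Cs.flatten.length ≤ n ^ 2 := numberedLists_flatten_length_le I I.children_nodup
  have hsq : n ≤ n ^ 2 := Nat.le_self_pow two_ne_zero n
  refine ⟨2 + eA.length,
    fun x => 2 + (A.length + 1) + (A.take (I.num x)).flatten.length,
    fun x => 2 + eA.length + (Cs.length + 1) + (Cs.take (I.num x)).flatten.length,
    rfl, rfl, ?_, ?_, ?_, ?_, ?_, ?_, ?_, ?_⟩
  · rw [add_comm, getD_encodeLists_pointer hw1 b1 lA.ge, ← lA, List.take_length, leA, lA]
    omega
  · intro x
    have hx : (I.num x : ℕ) < A.length := by rw [lA]; exact (I.num x).2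
    rw [add_comm, getD_encodeLists_pointer hw1 b1 hx.le]
  · intro x
    have hx : (I.num x : ℕ) < A.length := by rw [lA]; exact (I.num x).2
    rw [show (I.num x : ℕ) + 3 = 2 + ((I.num x : ℕ) + 1) by omega,
      getD_encodeLists_pointer hw1 b1 hx, flatten_length_take_succ A hx,
      numberedLists_getElem, List.length_map]
    omega
  · intro x j h
    have hx : (I.num x : ℕ) < A.length := by rw [lA]; exact (I.num x).2
    have e := numberedLists_getElem I I.adj x hx
    rw [getD_encodeLists_element hw1 b1 hx (by rw [e, List.length_map]; exact h)]
    simp [hA, e]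
  · intro x
    have hx : (I.num x : ℕ) < Cs.length := by rw [lC]; exact (I.num x).2
    rw [getD_encodeLists_pointer hw2 b2 hx.le]
  · intro x
    have hx : (I.num x : ℕ) < Cs.length := by rw [lC]; exact (I.num x).2
    rw [add_assoc, getD_encodeLists_pointer hw2 b2 hx, flatten_length_take_succ Cs hx,
      numberedLists_getElem, List.length_map]
    omega
  · intro x j h
    have hx : (I.num x : ℕ) < Cs.length := by rw [lC]; exact (I.num x).2
    have e := numberedLists_getElem I I.children x hx
    rw [getD_encodeLists_element hw2 b2 hx (by rw [e, List.length_map]; exact h)]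
    simp [hC, e]
  · have hlist : ∀ f : T → List T, ∀ l ∈ numberedLists I f, ∀ v ∈ l, v ≤ 8 * n ^ 2 := by
      intro f l hl v hv
      simp only [numberedLists, List.mem_map] at hl
      obtain ⟨i, -, rfl⟩ := hl
      obtain ⟨y, -, rfl⟩ := List.mem_map.1 hv
      have := (I.num y).2
      omega
    have key : ∀ v ∈ inputArray I, v ≤ 8 * n ^ 2 := by
      intro v hv
      rw [hw, List.mem_append, List.mem_append] at hv
      rcases hv with (hv | hv) | hv
      · have := (I.num (⊥ : T)).2
        simp only [List.mem_cons, List.not_mem_nil, or_false] at hv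
        rcases hv with rfl | rfl <;> omega
      · refine le_of_mem_encodeLists ?_ (hlist _) hv
        change 2 + eA.length ≤ 8 * n ^ 2
        omega
      · refine le_of_mem_encodeLists ?_ (hlist _) hv
        change 2 + eA.length + eC.length ≤ 8 * n ^ 2
        omega
    intro i
    by_cases hi : i < (inputArray I).length
    · rw [List.getD_eq_getElem _ _ hi]; exact key _ (List.getElem_mem hi)
    · rw [List.getD_eq_default _ _ (by omega)]; omega

end Input

/-! ### The invariant of the memory and the space -/

/-- The invariant for stores; `n` is the number of vertices, `t` a bound on the depth, and `B` a
bound on all numbers. -/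
structure Inv (n t B : ℕ) (σ : Store) : Prop where
  reg_le : ∀ r, σ.reg r ≤ B
  reg_zero : ∀ r, 16 ≤ r → σ.reg r = 0
  tab_le : ∀ i, σ.arr 1 i ≤ t
  tab_zero : ∀ i, 2 ^ (t + 2) ≤ i → σ.arr 1 i = 0
  code_le : ∀ i, σ.arr 2 i ≤ B
  code_zero : ∃ Q : Finset ℕ, Q.card ≤ t ∧ (∀ q ∈ Q, q < n) ∧ ∀ i, i ∉ Q → σ.arr 2 i = 0
  frame_le : ∀ j, 3 ≤ j → j ≤ 6 → ∀ i, σ.arr j i ≤ B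
  frame_zero : ∀ j, 3 ≤ j → j ≤ 6 → ∀ i, t < i → σ.arr j i = 0

namespace Inv

variable {n t B : ℕ} {σ : Store}

theorem arr_le (h : Inv n t B σ) (ht : t ≤ B) (j i : ℕ) (h1 : 1 ≤ j) (h6 : j ≤ 6) :
    σ.arr j i ≤ B := by
  obtain rfl | rfl | h3 : j = 1 ∨ j = 2 ∨ 3 ≤ j := by omega
  · exact (h.tab_le i).trans ht
  · exact h.code_le i
  · exact h.frame_le j h3 h6 i

theorem setReg (h : Inv n t B σ) {r v : ℕ} (hr : r < 16) (hv : v ≤ B) :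
    Inv n t B (σ.setReg r v) := by
  refine ⟨fun s => ?_, fun s hs => ?_, h.tab_le, h.tab_zero, h.code_le, h.code_zero, h.frame_le,
    h.frame_zero⟩
  · rw [Store.setReg_reg]; split_ifs
    exacts [hv, h.reg_le s]
  · rw [Store.setReg_reg, if_neg (by omega)]; exact h.reg_zero s hs

theorem setTab (h : Inv n t B σ) {i v : ℕ} (hi : i < 2 ^ (t + 2)) (hv : v ≤ t) :
    Inv n t B (σ.setArr 1 i v) := by
  refine ⟨h.reg_le, h.reg_zero, fun s => ?_, fun s hs => ?_, ?_, ?_, ?_, ?_⟩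
  · rw [Store.setArr_arr]; split_ifs
    exacts [hv, h.tab_le s]
  · rw [Store.setArr_arr, if_neg (by omega)]; exact h.tab_zero s hs
  · simpa using h.code_le
  · simpa using h.code_zero
  · intro j h3 h6 i'; rw [Store.setArr_arr, if_neg (by omega)]; exact h.frame_le j h3 h6 i'
  · intro j h3 h6 i'; rw [Store.setArr_arr, if_neg (by omega)]; exact h.frame_zero j h3 h6 i'

theorem setCode (h : Inv n t B σ) {i v : ℕ} (hv : v ≤ B)
    (hQ : ∃ Q : Finset ℕ, Q.card ≤ t ∧ (∀ q ∈ Q, q < n) ∧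
      ∀ i', i' ∉ Q → (σ.setArr 2 i v).arr 2 i' = 0) :
    Inv n t B (σ.setArr 2 i v) := by
  refine ⟨h.reg_le, h.reg_zero, ?_, ?_, fun s => ?_, hQ, ?_, ?_⟩
  · simpa using h.tab_le
  · simpa using h.tab_zero
  · rw [Store.setArr_arr]; split_ifs
    exacts [hv, h.code_le s]
  · intro j h3 h6 i'; rw [Store.setArr_arr, if_neg (by omega)]; exact h.frame_le j h3 h6 i'
  · intro j h3 h6 i'; rw [Store.setArr_arr, if_neg (by omega)]; exact h.frame_zero j h3 h6 i'

theorem setFrame (h : Inv n t B σ) {j i v : ℕ} (h3 : 3 ≤ j) (hi : i ≤ t) (hv : v ≤ B) :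
    Inv n t B (σ.setArr j i v) := by
  refine ⟨h.reg_le, h.reg_zero, ?_, ?_, ?_, ?_, ?_, ?_⟩
  · intro i'; rw [Store.setArr_arr, if_neg (by omega)]; exact h.tab_le i'
  · intro i'; rw [Store.setArr_arr, if_neg (by omega)]; exact h.tab_zero i'
  · intro i'; rw [Store.setArr_arr, if_neg (by omega)]; exact h.code_le i'
  · obtain ⟨Q, h1, h2, h3'⟩ := h.code_zero
    refine ⟨Q, h1, h2, fun i' hi' => ?_⟩
    rw [Store.setArr_arr, if_neg (by omega)]; exact h3' i' hi'
  · intro j' _ h6 i'; rw [Store.setArr_arr]; split_ifs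
    exacts [hv, h.frame_le j' (by omega) h6 i']
  · intro j' _ h6 i' hi'; rw [Store.setArr_arr, if_neg (by omega)]
    exact h.frame_zero j' (by omega) h6 i' hi'

end Inv

theorem size_le_of_lt {m k : ℕ} (h : m < 2 ^ k) : Nat.size m ≤ k := Nat.size_le.2 h

/-- A bound for the contribution of a family of cells to the space. -/
theorem sum_image_le (m : Memory) (S : Finset ℕ) (f : ℕ → ℕ) (c : ℕ)
    (h : ∀ i ∈ S, Nat.size (f i) + Nat.size (m (f i)) ≤ c) :
    ∑ a ∈ S.image f, (Nat.size a + Nat.size (m a)) ≤ S.card * c := by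
  refine (Finset.sum_le_card_nsmul _ _ c fun a ha => ?_).trans ?_
  · obtain ⟨i, hi, rfl⟩ := Finset.mem_image.1 ha
    exact h i hi
  · rw [smul_eq_mul]
    exact Nat.mul_le_mul_right _ Finset.card_image_le

theorem sum_union_le (m : Memory) (S S' : Finset ℕ) :
    ∑ a ∈ S ∪ S', (Nat.size a + Nat.size (m a)) ≤
      ∑ a ∈ S, (Nat.size a + Nat.size (m a)) + ∑ a ∈ S', (Nat.size a + Nat.size (m a)) := by
  rw [← Finset.sum_union_inter]; omega

/-- The cells are sorted by their address modulo 8. A table cell costs at most `t + 5` bits for its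
address and `t` for its content. Only the array of codes has addresses that grow with `n`, and at
most `t` of its cells are nonzero. -/
theorem Inv.spaceBits_le {n t B W s β : ℕ} {σ : Store} {m : Memory} (h : Inv n t B σ)
    (hm : Represents σ m) (hW : TempBounded W m) (hBW : B ≤ W) (hs : W < 2 ^ s) (hn : n < 2 ^ β) :
    spaceBits m ≤ 16 * (7 + s) + 2 ^ (t + 2) * (2 * t + 5) + t * (β + 4 + s) +
      4 * ((t + 1) * (t + 4 + s)) + 64 * (9 + s) := by
  obtain ⟨Q, hQ1, hQ2, hQ3⟩ := h.code_zero
  have htwo : t < 2 ^ t := Nat.lt_two_pow_self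
  have szle : ∀ v, v ≤ W → Nat.size v ≤ s := fun v hv => size_le_of_lt (hv.trans_lt hs)
  have hreg : ∑ a ∈ (Finset.range 16).image (fun i => 8 * i), (Nat.size a + Nat.size (m a)) ≤
      16 * (7 + s) := by
    refine (sum_image_le m _ _ (7 + s) fun i hi => ?_).trans (by simp)
    rw [Finset.mem_range] at hi
    exact add_le_add (size_le_of_lt (by norm_num; omega))
      (szle _ (by rw [hm.1]; exact (h.reg_le i).trans hBW))
  have htab : ∑ a ∈ (Finset.range (2 ^ (t + 2))).image (fun i => 8 * i + 1),
      (Nat.size a + Nat.size (m a)) ≤ 2 ^ (t + 2) * (2 * t + 5) := by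
    refine (sum_image_le m _ _ (2 * t + 5) fun i hi => ?_).trans (by simp)
    rw [Finset.mem_range] at hi
    have h1 : Nat.size (8 * i + 1) ≤ t + 5 := size_le_of_lt (by
      rw [show t + 5 = (t + 2) + 3 by omega, pow_add _ (t + 2)]; omega)
    have h2 : Nat.size (m (8 * i + 1)) ≤ t := size_le_of_lt (by
      rw [hm.2 1 le_rfl (by omega)]; exact (h.tab_le i).trans_lt htwo)
    omega
  have hcode : ∑ a ∈ Q.image (fun i => 8 * i + 2), (Nat.size a + Nat.size (m a)) ≤
      t * (β + 4 + s) := by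
    refine (sum_image_le m _ _ (β + 4 + s) fun i hi => ?_).trans (Nat.mul_le_mul_right _ hQ1)
    have := hQ2 i hi
    have h1 : Nat.size (8 * i + 2) ≤ β + 4 := size_le_of_lt (by rw [pow_add]; omega)
    have h2 := szle (m (8 * i + 2)) (by
      rw [hm.2 2 (by omega) (by omega)]; exact (h.code_le i).trans hBW)
    omega
  have hframe : ∀ j, 3 ≤ j → j ≤ 6 → ∑ a ∈ (Finset.range (t + 1)).image (fun i => 8 * i + j),
      (Nat.size a + Nat.size (m a)) ≤ (t + 1) * (t + 4 + s) := by
    intro j h3 h6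
    refine (sum_image_le m _ _ (t + 4 + s) fun i hi => ?_).trans (by simp)
    rw [Finset.mem_range] at hi
    have h1 : Nat.size (8 * i + j) ≤ t + 4 := size_le_of_lt (by rw [pow_add]; omega)
    have h2 := szle (m (8 * i + j)) (by
      rw [hm.2 j (by omega) h6]; exact (h.frame_le j h3 h6 i).trans hBW)
    omega
  have htemp : ∑ a ∈ (Finset.range 64).image (fun i => 8 * i + 7),
      (Nat.size a + Nat.size (m a)) ≤ 64 * (9 + s) := by
    refine (sum_image_le m _ _ (9 + s) fun i hi => ?_).trans (by simp)
    rw [Finset.mem_range] at hi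
    exact add_le_add (size_le_of_lt (by norm_num; omega)) (szle _ (hW i).1)
  set S : Finset ℕ := (Finset.range 16).image (fun i => 8 * i) ∪
    ((Finset.range (2 ^ (t + 2))).image (fun i => 8 * i + 1) ∪
    (Q.image (fun i => 8 * i + 2) ∪
    (((Finset.range (t + 1)).image (fun i => 8 * i + 3) ∪
      (Finset.range (t + 1)).image (fun i => 8 * i + 4)) ∪
    (((Finset.range (t + 1)).image (fun i => 8 * i + 5) ∪
      (Finset.range (t + 1)).image (fun i => 8 * i + 6)) ∪
    (Finset.range 64).image (fun i => 8 * i + 7))))) with hS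
  have hsupp : m.support ⊆ S := by
    intro a ha
    rw [Finsupp.mem_support_iff] at ha
    have hfr : ∀ j, 3 ≤ j → j ≤ 6 → a % 8 = j →
        a ∈ (Finset.range (t + 1)).image (fun i => 8 * i + j) := by
      intro j h3 h6 hj
      refine Finset.mem_image.2 ⟨a / 8, Finset.mem_range.2 ?_, by omega⟩
      by_contra hc
      refine ha ?_
      rw [show a = 8 * (a / 8) + j by omega, hm.2 j (by omega) h6]
      exact h.frame_zero j h3 h6 _ (by omega)
    simp only [hS, Finset.mem_union]
    have hlt : a % 8 < 8 := Nat.mod_lt _ (by norm_num)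
    obtain h0 | h0 | h0 | h0 | h0 | h0 | h0 | h0 : a % 8 = 0 ∨ a % 8 = 1 ∨ a % 8 = 2 ∨ a % 8 = 3 ∨
      a % 8 = 4 ∨ a % 8 = 5 ∨ a % 8 = 6 ∨ a % 8 = 7 := by omega
    · refine Or.inl (Finset.mem_image.2 ⟨a / 8, Finset.mem_range.2 ?_, by omega⟩)
      by_contra hc
      refine ha ?_
      rw [show a = 8 * (a / 8) by omega, hm.1]
      exact h.reg_zero _ (by omega)
    · refine Or.inr (Or.inl (Finset.mem_image.2 ⟨a / 8, Finset.mem_range.2 ?_, by omega⟩))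
      by_contra hc
      refine ha ?_
      rw [show a = 8 * (a / 8) + 1 by omega, hm.2 1 (by omega) (by omega)]
      exact h.tab_zero _ (by omega)
    · refine Or.inr (Or.inr (Or.inl (Finset.mem_image.2 ⟨a / 8, ?_, by omega⟩)))
      by_contra hc
      refine ha ?_
      rw [show a = 8 * (a / 8) + 2 by omega, hm.2 2 (by omega) (by omega)]
      exact hQ3 _ hc
    · exact Or.inr <| Or.inr <| Or.inr <| Or.inl <| Or.inl <| 
        hfr 3 (by omega) (by omega) h0
    · exact Or.inr <| Or.inr <| Or.inr <| Or.inl <| Or.inr <| 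
        hfr 4 (by omega) (by omega) h0
    · exact Or.inr <| Or.inr <| Or.inr <| Or.inr <| Or.inl <| Or.inl <| 
        hfr 5 (by omega) (by omega) h0
    · exact Or.inr <| Or.inr <| Or.inr <| Or.inr <| Or.inl <| Or.inr <| 
        hfr 6 (by omega) (by omega) h0
    · have : a ∈ (Finset.range 64).image (fun i => 8 * i + 7) := by
        refine Finset.mem_image.2 ⟨a / 8, Finset.mem_range.2 ?_, by omega⟩
        by_contra hc
        refine ha ?_
        rw [show a = 8 * (a / 8) + 7 by omega]
        exact (hW _).2 (by omega)
      exact Or.inr <| Or.inr <| Or.inr <| Or.inr <| Or.inr <| this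
  have hsum : spaceBits m ≤ ∑ a ∈ S, (Nat.size a + Nat.size (m a)) :=
    Finset.sum_le_sum_of_subset hsupp
  have f3 := hframe 3 (by omega) (by omega)
  have f4 := hframe 4 (by omega) (by omega)
  have f5 := hframe 5 (by omega) (by omega)
  have f6 := hframe 6 (by omega) (by omega)
  refine hsum.trans ?_
  rw [hS]
  refine (sum_union_le m _ _).trans ?_
  refine (add_le_add_right (sum_union_le m _ _) _).trans ?_
  refine (add_le_add_right (add_le_add_right (sum_union_le m _ _) _) _).trans ?_
  refine (add_le_add_right (add_le_add_right (add_le_add_right ((sum_union_le m _ _).trans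
    (add_le_add (sum_union_le m _ _) ((sum_union_le m _ _).trans
      (add_le_add_left (sum_union_le m _ _) _)))) _) _) _).trans ?_
  omega

end HybridDomset

namespace HybridDomset

/-! ### The program -/

namespace BinOp

@[simp] theorem eval_add (a b : ℕ) : BinOp.add.eval a b = a + b := rfl
@[simp] theorem eval_sub (a b : ℕ) : BinOp.sub.eval a b = a - b := rfl
@[simp] theorem eval_and (a b : ℕ) : BinOp.and.eval a b = a &&& b := rfl
@[simp] theorem eval_or (a b : ℕ) : BinOp.or.eval a b = a ||| b := rfl
@[simp] theorem eval_shiftRight (a b : ℕ) : BinOp.shiftRight.eval a b = a >>> b := rfl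
@[simp] theorem eval_lt (a b : ℕ) : BinOp.lt.eval a b = if a < b then 1 else 0 := rfl
@[simp] theorem eval_eq (a b : ℕ) : BinOp.eq.eval a b = if a = b then 1 else 0 := rfl

end BinOp

namespace Expr

instance : Add Expr := ⟨bin .add⟩
instance : Sub Expr := ⟨bin .sub⟩

@[simp] theorem eval_add (w : List ℕ) (σ : Store) (e f : Expr) :
    (e + f).eval w σ = e.eval w σ + f.eval w σ := rfl
@[simp] theorem eval_sub (w : List ℕ) (σ : Store) (e f : Expr) :
    (e - f).eval w σ = e.eval w σ - f.eval w σ := rfl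
@[simp] theorem tame_sub (e f : Expr) : (e - f).Tame ↔ e.Tame ∧ f.Tame := by
  change True ∧ _ ↔ _; simp

end Expr

/-- Collect in register 8 the codes of the neighbours. -/
def scanLoop : Program :=
  loopWhile (.bin .lt (.reg 6) (.reg 7)) <|
    .seq (assign 8 (.bin .or (.reg 8) (.arr 2 (.inp (.reg 6))))) <|
    assign 6 (.reg 6 + .lit 1)

/-- Build the table for the branch in which the current vertex is not taken. -/
def growLoop : Program :=
  loopWhile (.bin .lt (.reg 9) (.reg 4)) <|
    .seq (assign 10 (.arr 1 (.reg 3 + .reg 9))) <|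
    .seq (put 1 (.reg 3 + .reg 3 + .reg 9) (.reg 10)) <|
    -- The table of the next level starts at twice the current start. In its upper half the entered
    -- vertex is a target, at the additional cost in register 11.
    .seq (put 1 (.reg 3 + .reg 3 + (.reg 4 + .reg 9)) (.reg 10 + .reg 11)) <|
    assign 9 (.reg 9 + .lit 1)

/-- Build the table for the branch in which the current vertex is taken. -/
def switchLoop : Program :=
  loopWhile (.bin .lt (.reg 9) (.reg 4)) <|
    .seq (put 1 (.reg 3 + .reg 9) (.arr 1 (.reg 13 + (.reg 9 - .bin .and (.reg 9) (.reg 8))))) <|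
    assign 9 (.reg 9 + .lit 1)

/-- Combine the tables of the two branches. -/
def finishLoop : Program :=
  loopWhile (.bin .lt (.reg 9) (.reg 4)) <|
    .seq (assign 10 (.reg 12 + .arr 1 (.reg 3 + (.reg 4 + .reg 9)))) <|
    .seq (assign 11 (.reg 0 + .arr 1 (.reg 3 + .reg 9))) <|
    .seq (put 1 (.reg 13 + .reg 9) (.reg 10 - (.reg 10 - .reg 11) - .reg 14)) <|
    assign 9 (.reg 9 + .lit 1)

/-- Visit the vertex in register 1. -/
def enterProgram : Program :=
  .seq (assign 8 (.lit 0)) <|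
  .seq (assign 6 (.inp (.reg 1 + .lit 2))) <|
  .seq (assign 7 (.inp (.reg 1 + .lit 3))) <|
  .seq scanLoop <|
  .seq (assign 11 (.lit 1 - .bin .and (.reg 8) (.lit 1))) <|
  .seq (assign 9 (.lit 0)) <|
  .seq growLoop <|
  .seq (assign 5 (.reg 5 + .lit 1)) <|
  .seq (put 3 (.reg 5) (.reg 1)) <|
  .seq (put 4 (.reg 5) (.reg 8)) <|
  .seq (put 5 (.reg 5) (.reg 0)) <|
  .seq (put 6 (.reg 5) (.inp (.reg 2 + .reg 1))) <|
  .seq (put 2 (.reg 1) (.reg 4)) <|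
  .seq (assign 3 (.reg 3 + .reg 3)) <|
  assign 4 (.reg 4 + .reg 4)

/-- Proceed to the second branch of the vertex in register 1. -/
def switchProgram : Program :=
  .seq (assign 4 (.arr 2 (.reg 1))) <|
  .seq (assign 8 (.arr 4 (.reg 5))) <|
  .seq (assign 13 (.bin .shiftRight (.reg 3) (.lit 1))) <|
  .seq (assign 9 (.lit 0)) <|
  .seq switchLoop <|
  .seq (assign 10 (.arr 5 (.reg 5))) <|
  .seq (put 5 (.reg 5) (.reg 0)) <|
  .seq (assign 0 (.reg 10 + .lit 1)) <|
  .seq (put 6 (.reg 5) (.inp (.reg 2 + .reg 1))) <|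
  put 2 (.reg 1) (.lit 1)

/-- Return from the vertex in register 1. -/
def finishProgram : Program :=
  .seq (assign 13 (.bin .shiftRight (.reg 3) (.lit 1))) <|
  .seq (assign 12 (.arr 5 (.reg 5))) <|
  .seq (assign 10 (.reg 12 + .arr 1 (.reg 3 + .reg 4))) <|
  .seq (assign 11 (.reg 0 + .arr 1 (.reg 3))) <|
  -- A minimum, by truncated subtraction. It is the new value at `∅`, from which the new offsets are
  -- measured.
  .seq (assign 14 (.reg 10 - (.reg 10 - .reg 11))) <|
  .seq (assign 9 (.lit 0)) <|
  .seq finishLoop <|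
  .seq (assign 0 (.reg 14)) <|
  .seq (put 2 (.reg 1) (.lit 0)) <|
  .seq (assign 3 (.reg 13)) <|
  assign 5 (.reg 5 - .lit 1)

/-- One step of the traversal. -/
def stepProgram : Program :=
  .seq (assign 1 (.arr 3 (.reg 5))) <|
  .seq (assign 6 (.arr 6 (.reg 5))) <|
  ifte (.bin .lt (.reg 6) (.inp (.reg 2 + .reg 1 + .lit 1)))
    (.seq (put 6 (.reg 5) (.reg 6 + .lit 1)) <| .seq (assign 1 (.inp (.reg 6))) enterProgram)
    -- All children are done. The code of the vertex tells which branch has ended: it is `1` in the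
    -- second branch only.
    (ifte (.bin .eq (.arr 2 (.reg 1)) (.lit 1)) finishProgram switchProgram)

def traversal : Program := loopWhile (.reg 5) stepProgram

/-- Register 0 holds the value at `∅`, register 1 the current vertex, register 2 the address of the
pointers to the lists of children, registers 3 and 4 start and width of the current table, and
register 5 the level. The first table, at the cells 2 and 3 of array 1, consists of zeros, as does
the initial memory. -/
def mainProgram : Program :=
  .seq (assign 2 (.inp (.inp (.lit 0) + .lit 2))) <|
  .seq (assign 1 (.inp (.lit 1))) <|
  .seq (assign 3 (.lit 2)) <|
  .seq (assign 4 (.lit 2)) <|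
  .seq enterProgram traversal

/-! ### The environment -/

/-- A bound on all numbers that are stored. -/
def wordBound (t n : ℕ) : ℕ := 2 ^ (t + 6) * n ^ 2

/-- These are the needs of table addresses and codes, of input words, and of costs with offsets, in
this order. -/
theorem wordBound_facts {t n : ℕ} (hn : 1 ≤ n) :
    2 ^ (t + 4) ≤ wordBound t n ∧ 8 * n ^ 2 + 8 ≤ wordBound t n ∧
      2 * n + 2 * t + 8 ≤ wordBound t n := by
  have h1 : t < 2 ^ t := Nat.lt_two_pow_self
  have h2 : n ≤ n ^ 2 := Nat.le_self_pow two_ne_zero n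
  have e : wordBound t n = 64 * (2 ^ t * n ^ 2) := by rw [wordBound, pow_add]; ring
  have h3 : 2 ^ t ≤ 2 ^ t * n ^ 2 := Nat.le_mul_of_pos_right _ (by positivity)
  have h4 : n ^ 2 ≤ 2 ^ t * n ^ 2 := Nat.le_mul_of_pos_left _ (by positivity)
  have h5 : 2 ^ (t + 4) = 16 * 2 ^ t := by rw [pow_add]; ring
  refine ⟨by omega, by omega, by omega⟩

variable {T : RootedTree.{u}} [Fintype T] {G : SimpleGraph T} (I : Presentation T G) (t : ℕ)

theorem card_tree_pos : 1 ≤ Fintype.card T := Fintype.card_pos_iff.2 ⟨⊥⟩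

/-- The environment for the computation on the instance `I`. -/
def machineEnv : Env where
  inp := inputArray I
  J := Inv (Fintype.card T) t (wordBound t (Fintype.card T))
  B := wordBound t (Fintype.card T)
  eight_le := by have := wordBound_facts (t := t) (card_tree_pos (T := T)); omega
  inp_le i := by
    obtain ⟨c, pa, pc, h⟩ := exists_layout I
    have := wordBound_facts (t := t) (card_tree_pos (T := T))
    have := h.le i
    omega
  reg_le σ h := h.reg_le
  arr_le σ h j i h1 h6 := h.arr_le
    (by have := wordBound_facts (t := t) (card_tree_pos (T := T)); omega) j i h1 h6

variable {I t}

theorem inv_of_env {σ : Store} (h : (machineEnv I t).J σ) :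
    Inv (Fintype.card T) t (wordBound t (Fintype.card T)) σ := h

theorem WP.assign' {r : ℕ} {e : Expr} {Q : Store → Prop} {σ : Store} (he : e.Tame)
    (hs : e.size ≤ 40) (hr : r < 16)
    (hv : Inv (Fintype.card T) t (wordBound t (Fintype.card T)) σ →
      e.eval (inputArray I) σ ≤ wordBound t (Fintype.card T))
    (hQ : Q (σ.setReg r (e.eval (inputArray I) σ))) :
    (machineEnv I t).WP (assign r e) 50 Q σ :=
  Env.WP.assign he hs (fun h => Inv.setReg h hr (hv h)) hQ

theorem WP.putTab {e f : Expr} {Q : Store → Prop} {σ : Store}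
    (he : e.Tame) (hs : e.size ≤ 30) (hf : f.Tame) (hs' : f.size ≤ 40)
    (hi : e.eval (inputArray I) σ < 2 ^ (t + 2)) (hv : f.eval (inputArray I) σ ≤ t)
    (hQ : Q (σ.setArr 1 (e.eval (inputArray I) σ) (f.eval (inputArray I) σ))) :
    (machineEnv I t).WP (put 1 e f) 100 Q σ :=
  Env.WP.put (by norm_num) he hs hf hs' (fun h => Inv.setTab h hi hv) hQ

theorem WP.putFrame {j : ℕ} {e f : Expr} {Q : Store → Prop} {σ : Store} (hj : 3 ≤ j ∧ j ≤ 6)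
    (he : e.Tame) (hs : e.size ≤ 30) (hf : f.Tame) (hs' : f.size ≤ 40)
    (hi : e.eval (inputArray I) σ ≤ t)
    (hv : Inv (Fintype.card T) t (wordBound t (Fintype.card T)) σ →
      f.eval (inputArray I) σ ≤ wordBound t (Fintype.card T))
    (hQ : Q (σ.setArr j (e.eval (inputArray I) σ) (f.eval (inputArray I) σ))) :
    (machineEnv I t).WP (put j e f) 100 Q σ :=
  Env.WP.put ⟨by omega, hj.2⟩ he hs hf hs' (fun h => Inv.setFrame h hj.1 hi (hv h)) hQ

theorem input_le (i : ℕ) : (inputArray I).getD i 0 + 8 ≤ wordBound t (Fintype.card T) := by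
  obtain ⟨c, pa, pc, h⟩ := exists_layout I
  have := wordBound_facts (t := t) (card_tree_pos (T := T))
  have := h.le i
  omega

/-! ### Specifications of the inner loops -/

variable {c : ℕ} {pa pc : T → ℕ}

theorem wp_scanLoop (hl : Layout I (inputArray I) c pa pc) {β : T → ℕ} {k : ℕ} (hβ : IsCode β k)
    (hk : k ≤ t) {x : T} {σ : Store} (h6 : σ.reg 6 = pa x)
    (h7 : σ.reg 7 = pa x + (I.adj x).length) (h8 : σ.reg 8 = 0)
    (hcode : ∀ v : T, σ.arr 2 (I.num v) = β v) :
    (machineEnv I t).WP scanLoop ((I.adj x).length * 150 + 50)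
      (fun σ' => σ'.arr = σ.arr ∧ σ'.reg 8 = codeMask β (I.adj x) ∧
        ∀ r, r ≠ 6 → r ≠ 8 → σ'.reg r = σ.reg r) σ := by
  have hB := wordBound_facts (t := t) (card_tree_pos (T := T))
  have hp : pa x + (I.adj x).length + 8 ≤ wordBound t (Fintype.card T) := by
    rw [← hl.adj_end]; exact input_le _
  refine Env.WP.mono (Env.WP.while_count (c := 100) (by simp) (by decide)
    (fun j σ' => σ'.arr = σ.arr ∧ σ'.reg 8 = codeMask β ((I.adj x).take j) ∧
      σ'.reg 6 = pa x + j ∧ ∀ r, r ≠ 6 → r ≠ 8 → σ'.reg r = σ.reg r) (I.adj x).length ?_ ?_ ?_)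
    (by omega) ?_
  · rintro j hj σ' ⟨ha, h8', h6', hr⟩
    have h7' : σ'.reg 7 = pa x + (I.adj x).length := by
      rw [hr 7 (by norm_num) (by norm_num), h7]
    have hmask : σ'.reg 8 ||| σ'.arr 2 ((inputArray I).getD (σ'.reg 6) 0) =
        codeMask β ((I.adj x).take (j + 1)) := by
      rw [h6', hl.adj_get x j hj, ha, hcode, h8', List.take_add_one, List.getElem?_eq_getElem hj,
        Option.toList_some, codeMask_append_singleton]
    have hlt : codeMask β ((I.adj x).take (j + 1)) < 2 ^ (t + 4) :=
      (hβ.codeMask_lt _).trans_le (Nat.pow_le_pow_right (by norm_num) (by omega))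
    constructor
    · simp [h6', h7', hj]
    · refine Env.WP.seq (WP.assign' (by simp) (by decide) (by norm_num) (fun _ => ?_)
        (WP.assign' (by simp) (by decide) (by norm_num) (fun _ => ?_) ?_))
      · simp only [Expr.eval, BinOp.eval_or, hmask]; omega
      · simp [h6']; omega
      · refine ⟨by simpa using ha, ?_, by simp [h6']; omega, fun r h1 h2 => ?_⟩
        · simpa using hmask
        · simpa [h1, h2] using hr r h1 h2
  · rintro σ' ⟨ha, h8', h6', hr⟩
    have h7' : σ'.reg 7 = pa x + (I.adj x).length := by
      rw [hr 7 (by norm_num) (by norm_num), h7]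
    simp [h6', h7']
  · exact ⟨rfl, by simp [h8, codeMask], by simp [h6], fun _ _ _ => rfl⟩
  · rintro σ' - ⟨ha, h8', h6', hr⟩
    exact ⟨ha, by simpa using h8', hr⟩

/-- Because `K ≤ L`, the source at `L` ends before the target at `2 * L` begins. -/
theorem wp_growLoop {L K : ℕ} (hKL : K ≤ L) (hL : 2 * L + 2 * K ≤ 2 ^ (t + 2)) {σ : Store}
    (h3 : σ.reg 3 = L) (h4 : σ.reg 4 = K) (h9 : σ.reg 9 = 0)
    (hv : ∀ i < K, σ.arr 1 (L + i) + σ.reg 11 ≤ t) :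
    (machineEnv I t).WP growLoop (K * 350 + 50)
      (fun σ' => (∀ j, j ≠ 1 → ∀ i, σ'.arr j i = σ.arr j i) ∧
        (∀ r, r ≠ 9 → r ≠ 10 → σ'.reg r = σ.reg r) ∧
        (∀ a, a < 2 * L → σ'.arr 1 a = σ.arr 1 a) ∧
        ∀ i < K, σ'.arr 1 (2 * L + i) = σ.arr 1 (L + i) ∧
          σ'.arr 1 (2 * L + (K + i)) = σ.arr 1 (L + i) + σ.reg 11) σ := by
  have hB := wordBound_facts (t := t) (card_tree_pos (T := T))
  have h24 : 2 ^ (t + 4) = 4 * 2 ^ (t + 2) := by rw [pow_add, pow_add]; ring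
  refine Env.WP.mono (Env.WP.while_count (c := 300) (by simp) (by decide)
    (fun i σ' => (∀ j, j ≠ 1 → ∀ i, σ'.arr j i = σ.arr j i) ∧
        (∀ r, r ≠ 9 → r ≠ 10 → σ'.reg r = σ.reg r) ∧ σ'.reg 9 = i ∧
        (∀ a, a < 2 * L → σ'.arr 1 a = σ.arr 1 a) ∧
        ∀ i' < i, σ'.arr 1 (2 * L + i') = σ.arr 1 (L + i') ∧
          σ'.arr 1 (2 * L + (K + i')) = σ.arr 1 (L + i') + σ.reg 11) K ?_ ?_ ?_)
    (by omega) ?_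
  · rintro i hi σ' ⟨ha, hr, h9', hlow, hnew⟩
    have h3' : σ'.reg 3 = L := by rw [hr 3 (by norm_num) (by norm_num), h3]
    have h4' : σ'.reg 4 = K := by rw [hr 4 (by norm_num) (by norm_num), h4]
    have h11' : σ'.reg 11 = σ.reg 11 := hr 11 (by norm_num) (by norm_num)
    have hvi := hv i hi
    have hcell : σ'.arr 1 (L + i) = σ.arr 1 (L + i) := hlow _ (by omega)
    constructor
    · simp [h9', h4', hi]
    · refine Env.WP.seq (WP.assign' (by simp) (by decide) (by norm_num) (fun _ => ?_) <|
        Env.WP.seq <| WP.putTab (by simp) (by decide) (by simp) (by decide) ?_ ?_ <|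
        Env.WP.seq <| WP.putTab (by simp) (by decide) (by simp) (by decide) ?_ ?_ <|
        WP.assign' (by simp) (by decide) (by norm_num) (fun _ => ?_) ?_)
      · simp [h3', h9', hcell]; omega
      · simp [h3', h9']; omega
      · simp [h3', h9', hcell]; omega
      · simp [h3', h4', h9']; omega
      · simp [h3', h9', h11', hcell]; omega
      · simp [h9']; omega
      · refine ⟨fun j hj i' => by simp [hj, ha j hj], fun r h1 h2 => ?_, by simp [h9'],
          fun a ha => ?_, fun i' hi' => ?_⟩
        · simp [h1, h2, hr r h1 h2]
        · simp only [Store.setArr_arr, Store.setReg_arr, Expr.eval, h3', h4', h9',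
            Store.setReg_reg, Store.setArr_reg]
          rw [if_neg (by norm_num; omega), if_neg (by norm_num; omega)]
          exact hlow a ha
        · simp only [Store.setArr_arr, Store.setReg_arr, Expr.eval, h3', h4', h9',
            Store.setReg_reg, Store.setArr_reg, h11']
          norm_num
          rcases Nat.lt_succ_iff_lt_or_eq.1 hi' with hlt | rfl
          · rw [if_neg (by omega), if_neg (by omega), if_neg (by omega), if_neg (by omega)]
            exact hnew i' hlt
          · rw [if_neg (by omega)]; simp [two_mul, hcell]
  · rintro σ' ⟨ha, hr, h9', -, -⟩
    have h4' : σ'.reg 4 = K := by rw [hr 4 (by norm_num) (by norm_num), h4]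
    simp [h9', h4']
  · exact ⟨fun _ _ _ => rfl, fun _ _ _ => rfl, h9, fun _ _ => rfl, fun _ h => absurd h (by omega)⟩
  · rintro σ' - ⟨ha, hr, h9', hlow, hnew⟩
    exact ⟨ha, hr, hlow, hnew⟩

/-- Cells from `L + K` on are left alone: they keep the upper half of the result of the first
branch. -/
theorem wp_switchLoop {L K H : ℕ} (hKL : H + K ≤ L) (hL : L + K ≤ 2 ^ (t + 2)) {σ : Store}
    (h3 : σ.reg 3 = L) (h4 : σ.reg 4 = K) (h13 : σ.reg 13 = H) (h9 : σ.reg 9 = 0) :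
    (machineEnv I t).WP switchLoop (K * 200 + 50)
      (fun σ' => (∀ j, j ≠ 1 → ∀ i, σ'.arr j i = σ.arr j i) ∧
        (∀ r, r ≠ 9 → σ'.reg r = σ.reg r) ∧
        (∀ a, a < L ∨ L + K ≤ a → σ'.arr 1 a = σ.arr 1 a) ∧
        ∀ i < K, σ'.arr 1 (L + i) = σ.arr 1 (H + (i - (i &&& σ.reg 8)))) σ := by
  refine Env.WP.of_inv fun hinv => ?_
  have hB := wordBound_facts (t := t) (card_tree_pos (T := T))
  have h24 : 2 ^ (t + 4) = 4 * 2 ^ (t + 2) := by rw [pow_add, pow_add]; ring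
  refine Env.WP.mono (Env.WP.while_count (c := 150) (by simp) (by decide)
    (fun i σ' => (∀ j, j ≠ 1 → ∀ i, σ'.arr j i = σ.arr j i) ∧
        (∀ r, r ≠ 9 → σ'.reg r = σ.reg r) ∧ σ'.reg 9 = i ∧
        (∀ a, a < L ∨ L + K ≤ a → σ'.arr 1 a = σ.arr 1 a) ∧
        ∀ i' < i, σ'.arr 1 (L + i') = σ.arr 1 (H + (i' - (i' &&& σ.reg 8)))) K ?_ ?_ ?_)
    (by omega) ?_
  · rintro i hi σ' ⟨ha, hr, h9', hlow, hnew⟩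
    have h3' : σ'.reg 3 = L := by rw [hr 3 (by norm_num), h3]
    have h4' : σ'.reg 4 = K := by rw [hr 4 (by norm_num), h4]
    have h13' : σ'.reg 13 = H := by rw [hr 13 (by norm_num), h13]
    have h8' : σ'.reg 8 = σ.reg 8 := hr 8 (by norm_num)
    have hcell : σ'.arr 1 (H + (i - (i &&& σ.reg 8))) = σ.arr 1 (H + (i - (i &&& σ.reg 8))) :=
      hlow _ (by omega)
    have hle := hinv.tab_le (H + (i - (i &&& σ.reg 8)))
    constructor
    · simp [h9', h4', hi]
    · refine Env.WP.seq (WP.putTab (by simp) (by decide) (by simp) (by decide) ?_ ?_ <|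
        WP.assign' (by simp) (by decide) (by norm_num) (fun _ => ?_) ?_)
      · simp [h3', h9']; omega
      · simpa [h13', h8', h9', hcell] using hle
      · simp [h9']; omega
      · refine ⟨fun j hj i' => by simp [hj, ha j hj], fun r h1 => ?_, by simp [h9'],
          fun a ha => ?_, fun i' hi' => ?_⟩
        · simp [h1, hr r h1]
        · simp only [Store.setArr_arr, Store.setReg_arr, Expr.eval, h3', h9']
          rw [if_neg (by norm_num; omega)]
          exact hlow a ha
        · simp only [Store.setArr_arr, Store.setReg_arr, Expr.eval, Expr.eval_sub,
            BinOp.eval_and, h3', h9', h13', h8']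
          norm_num
          rcases Nat.lt_succ_iff_lt_or_eq.1 hi' with hlt | rfl
          · rw [if_neg (by omega)]
            exact hnew i' hlt
          · simp [hcell]
  · rintro σ' ⟨ha, hr, h9', -, -⟩
    have h4' : σ'.reg 4 = K := by rw [hr 4 (by norm_num), h4]
    simp [h9', h4']
  · exact ⟨fun _ _ _ => rfl, fun _ _ => rfl, h9, fun _ _ => rfl, fun _ h => absurd h (by omega)⟩
  · rintro σ' - ⟨ha, hr, h9', hlow, hnew⟩
    exact ⟨ha, hr, hlow, hnew⟩

theorem sub_sub_self_eq_min (a b : ℕ) : a - (a - b) = min a b := by omega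

theorem wp_finishLoop {L K H : ℕ} (hKL : H + K ≤ L) (hL : L + 2 * K ≤ 2 ^ (t + 2)) {σ : Store}
    (h3 : σ.reg 3 = L) (h4 : σ.reg 4 = K) (h13 : σ.reg 13 = H) (h9 : σ.reg 9 = 0)
    (hb : σ.reg 0 + t ≤ wordBound t (Fintype.card T))
    (hb' : σ.reg 12 + t ≤ wordBound t (Fintype.card T))
    (hv : ∀ i < K, min (σ.reg 12 + σ.arr 1 (L + (K + i))) (σ.reg 0 + σ.arr 1 (L + i)) -
      σ.reg 14 ≤ t) :
    (machineEnv I t).WP finishLoop (K * 300 + 50)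
      (fun σ' => (∀ j, j ≠ 1 → ∀ i, σ'.arr j i = σ.arr j i) ∧
        (∀ r, r ≠ 9 → r ≠ 10 → r ≠ 11 → σ'.reg r = σ.reg r) ∧
        (∀ a, a < H ∨ H + K ≤ a → σ'.arr 1 a = σ.arr 1 a) ∧
        ∀ i < K, σ'.arr 1 (H + i) =
          min (σ.reg 12 + σ.arr 1 (L + (K + i))) (σ.reg 0 + σ.arr 1 (L + i)) - σ.reg 14) σ := by
  refine Env.WP.of_inv fun hinv => ?_
  have hB := wordBound_facts (t := t) (card_tree_pos (T := T))
  have h24 : 2 ^ (t + 4) = 4 * 2 ^ (t + 2) := by rw [pow_add, pow_add]; ring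
  refine Env.WP.mono (Env.WP.while_count (c := 250) (by simp) (by decide)
    (fun i σ' => (∀ j, j ≠ 1 → ∀ i, σ'.arr j i = σ.arr j i) ∧
        (∀ r, r ≠ 9 → r ≠ 10 → r ≠ 11 → σ'.reg r = σ.reg r) ∧ σ'.reg 9 = i ∧
        (∀ a, a < H ∨ H + K ≤ a → σ'.arr 1 a = σ.arr 1 a) ∧
        ∀ i' < i, σ'.arr 1 (H + i') =
          min (σ.reg 12 + σ.arr 1 (L + (K + i'))) (σ.reg 0 + σ.arr 1 (L + i')) - σ.reg 14) K
      ?_ ?_ ?_)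
    (by omega) ?_
  · rintro i hi σ' ⟨ha, hr, h9', hlow, hnew⟩
    have h0' : σ'.reg 0 = σ.reg 0 := hr 0 (by norm_num) (by norm_num) (by norm_num)
    have h3' : σ'.reg 3 = L := by rw [hr 3 (by norm_num) (by norm_num) (by norm_num), h3]
    have h4' : σ'.reg 4 = K := by rw [hr 4 (by norm_num) (by norm_num) (by norm_num), h4]
    have h12' : σ'.reg 12 = σ.reg 12 := hr 12 (by norm_num) (by norm_num) (by norm_num)
    have h13' : σ'.reg 13 = H := by rw [hr 13 (by norm_num) (by norm_num) (by norm_num), h13]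
    have h14' : σ'.reg 14 = σ.reg 14 := hr 14 (by norm_num) (by norm_num) (by norm_num)
    have c1 : σ'.arr 1 (L + (K + i)) = σ.arr 1 (L + (K + i)) := hlow _ (by omega)
    have c2 : σ'.arr 1 (L + i) = σ.arr 1 (L + i) := hlow _ (by omega)
    have hle1 := hinv.tab_le (L + (K + i))
    have hle2 := hinv.tab_le (L + i)
    have hvi := hv i hi
    constructor
    · simp [h9', h4', hi]
    · refine Env.WP.seq (WP.assign' (by simp) (by decide) (by norm_num) (fun _ => ?_) <|
        Env.WP.seq <| WP.assign' (by simp) (by decide) (by norm_num) (fun _ => ?_) <|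
        Env.WP.seq <| WP.putTab (by simp) (by decide) (by simp) (by decide) ?_ ?_ <|
        WP.assign' (by simp) (by decide) (by norm_num) (fun _ => ?_) ?_)
      · simp [h3', h4', h9', h12', c1]; omega
      · simp [h3', h9', h0', c2]; omega
      · simp [h13', h9']; omega
      · simp only [Expr.eval_sub, Expr.eval, Store.setReg_reg, Store.setReg_arr,
          sub_sub_self_eq_min]
        norm_num [h3', h4', h9', h12', h14', h0', c1, c2]
        omega
      · simp [h9']; omega
      · refine ⟨fun j hj i' => by simp [hj, ha j hj], fun r h1 h2 h3 => ?_, by simp [h9'],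
          fun a ha => ?_, fun i' hi' => ?_⟩
        · simp [h1, h2, h3, hr r h1 h2 h3]
        · simp only [Store.setArr_arr, Store.setReg_arr, Expr.eval,
            Store.setReg_reg]
          norm_num [h13', h9']
          rw [if_neg (by omega)]
          exact hlow a ha
        · simp only [Store.setArr_arr, Store.setReg_arr, Expr.eval, Expr.eval_sub,
            Store.setReg_reg, sub_sub_self_eq_min]
          norm_num [h3', h4', h9', h12', h13', h14', h0', c1, c2]
          rcases Nat.lt_succ_iff_lt_or_eq.1 hi' with hlt | rfl
          · rw [if_neg (by omega)]
            exact hnew i' hlt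
          · simp
  · rintro σ' ⟨ha, hr, h9', -, -⟩
    have h4' : σ'.reg 4 = K := by rw [hr 4 (by norm_num) (by norm_num) (by norm_num), h4]
    simp [h9', h4']
  · exact ⟨fun _ _ _ => rfl, fun _ _ _ _ => rfl, h9, fun _ _ => rfl,
      fun _ h => absurd h (by omega)⟩
  · rintro σ' - ⟨ha, hr, h9', hlow, hnew⟩
    exact ⟨ha, hr, hlow, hnew⟩

end HybridDomset

/-! ### Entering a vertex -/

namespace HybridDomset

variable {T : RootedTree.{u}} [Fintype T] {G : SimpleGraph T} {I : Presentation T G} {t : ℕ}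
variable {c : ℕ} {pa pc : T → ℕ}

/-- The situation before a visit of `x`, which has `d` proper ancestors: `β` is a code with `k` free
bits for the proper ancestors of `x`, and the vertices of `W` have been processed. -/
structure Config (G : SimpleGraph T) (β : T → ℕ) (W : Finset T) (x : T) (d k : ℕ) : Prop where
  code : IsCode β k
  supp : ∀ v, β v ≠ 0 → v < x
  le : k ≤ d
  depth : (ancestors T x).card = d
  sep : Separated G W (descendants x)

/-- The store holds the code `β` and, at level `d`, the table for the processed set `W`. -/
structure AtState (I : Presentation T G) (c : ℕ) (β : T → ℕ) (W : Finset T) (d k : ℕ)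
    (σ : Store) : Prop where
  base : σ.reg 2 = c
  start : σ.reg 3 = 2 ^ (d + 1)
  width : σ.reg 4 = 2 ^ (k + 1)
  depth : σ.reg 5 = d
  cost : σ.reg 0 = stateCost G W (takenSet β) ∅
  code : ∀ v : T, σ.arr 2 (I.num v) = β v
  tab : ∀ i < 2 ^ (k + 1), σ.arr 1 (2 ^ (d + 1) + i) =
    stateCost G W (takenSet β) (indexedSet β i) - stateCost G W (takenSet β) ∅

namespace Config

variable {β : T → ℕ} {W : Finset T} {x : T} {d k : ℕ}

theorem self_eq_zero (h : Config G β W x d k) : β x = 0 := by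
  by_contra hc
  exact lt_irrefl _ (h.supp x hc)

theorem notMem_closedNbhdSet (h : Config G β W x d k) : x ∉ closedNbhdSet G W :=
  h.sep.notMem_closedNbhdSet subset_rfl (mem_descendants.2 le_rfl)

theorem card_indexedSet_le (h : Config G β W x d k) (i : ℕ) : (indexedSet β i).card ≤ d := by
  rw [← h.depth]
  refine Finset.card_le_card fun v hv => mem_ancestors.2 (h.supp v fun h0 => ?_)
  rw [mem_indexedSet, h0] at hv
  simp at hv

theorem card_update_le (h : Config G β W x d k) (a : ℕ) :
    (Finset.univ.filter fun v => Function.update β x a v ≠ 0).card ≤ d + 1 := by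
  rw [← h.depth, ← Finset.card_insert_of_notMem (self_notMem_ancestors x)]
  refine Finset.card_le_card fun v hv => ?_
  rw [Finset.mem_insert, mem_ancestors]
  by_cases hvx : v = x
  · exact Or.inl hvx
  · simp only [Finset.mem_filter, Function.update_of_ne hvx] at hv
    exact Or.inr (h.supp v hv.2)

end Config

/-- The hypothesis `hcard` keeps the array of codes sparse, as the space bound requires. -/
theorem WP.putCode {x : T} {a : ℕ} {β : T → ℕ} {e f : Expr} {Q : Store → Prop} {σ : Store}
    (he : e.Tame) (hs : e.size ≤ 30) (hf : f.Tame) (hs' : f.size ≤ 40)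
    (hi : e.eval (inputArray I) σ = I.num x) (hv : f.eval (inputArray I) σ = a)
    (ha : a ≤ wordBound t (Fintype.card T)) (hcode : ∀ v : T, σ.arr 2 (I.num v) = β v)
    (hcard : (Finset.univ.filter fun v => Function.update β x a v ≠ 0).card ≤ t)
    (hQ : (∀ v : T, (σ.setArr 2 (I.num x) a).arr 2 (I.num v) = Function.update β x a v) →
      Q (σ.setArr 2 (I.num x) a)) :
    (machineEnv I t).WP (put 2 e f) 100 Q σ := by
  have hnew : ∀ v : T, (σ.setArr 2 (I.num x) a).arr 2 (I.num v) = Function.update β x a v := by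
    intro v
    rw [Store.setArr_arr]
    by_cases hvx : v = x
    · subst hvx; simp
    · rw [Function.update_of_ne hvx, if_neg, hcode]
      rintro ⟨-, h⟩
      exact hvx (I.num.injective (Fin.ext h))
  refine Env.WP.put (by norm_num) he hs hf hs' (fun h => ?_) ?_
  · change Inv _ _ _ (σ.setArr 2 (e.eval (inputArray I) σ) (f.eval (inputArray I) σ))
    rw [hi, hv]
    refine Inv.setCode h ha
      ⟨(Finset.univ.filter fun v => Function.update β x a v ≠ 0).image fun v => (I.num v : ℕ),
        Finset.card_image_le.trans hcard, fun q hq => ?_, fun i hi => ?_⟩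
    · obtain ⟨v, -, rfl⟩ := Finset.mem_image.1 hq
      exact (I.num v).2
    · by_cases hin : i < Fintype.card T
      · have hiv : i = I.num (I.num.symm ⟨i, hin⟩) := by simp
        rw [hiv, hnew]
        by_contra h0
        exact hi (Finset.mem_image.2 ⟨I.num.symm ⟨i, hin⟩, by simpa using h0, hiv.symm⟩)
      · obtain ⟨Q', -, h2, h3⟩ := (inv_of_env h).code_zero
        have := (I.num x).2
        rw [Store.setArr_arr, if_neg (by omega)]
        exact h3 i fun hq => hin (h2 i hq)
  · change Q (σ.setArr 2 (e.eval (inputArray I) σ) (f.eval (inputArray I) σ))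
    rw [hi, hv]
    exact hQ hnew

theorem input_le' (i : ℕ) : (inputArray I).getD i 0 ≤ wordBound t (Fintype.card T) :=
  (Nat.le_add_right _ 8).trans (input_le i)

/-- What a visit of a vertex at level `d` finds after the vertex `x` has been entered. -/
structure Entered (I : Presentation T G) (pc : T → ℕ) (β : T → ℕ) (W : Finset T) (x : T)
    (d : ℕ) (σ : Store) : Prop where
  vertex : σ.arr 3 (d + 1) = I.num x
  mask : σ.arr 4 (d + 1) = codeMask β (I.adj x)
  cost : σ.arr 5 (d + 1) = stateCost G W (takenSet β) ∅
  pointer : σ.arr 6 (d + 1) = pc x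

theorem wp_enterProgram (hl : Layout I (inputArray I) c pa pc) {β : T → ℕ} {W : Finset T} {x : T}
    {d k : ℕ} (hC : Config G β W x d k) (hd : d + 1 ≤ t) {σ : Store}
    (hσ : AtState I c β W d k σ) (hx : σ.reg 1 = I.num x) :
    (machineEnv I t).WP enterProgram (1100 * ((I.adj x).length + 1 + 2 ^ (k + 1)))
      (fun σ' => AtState I c (Function.update β x (2 ^ (k + 1))) W (d + 1) (k + 1) σ' ∧
        Entered I pc β W x d σ' ∧
        (∀ j, 3 ≤ j → j ≤ 6 → ∀ i ≤ d, σ'.arr j i = σ.arr j i) ∧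
        ∀ a < 2 ^ (d + 2), σ'.arr 1 a = σ.arr 1 a) σ := by
  have hB := wordBound_facts (t := t) (card_tree_pos (T := T))
  have hx0 := hC.self_eq_zero
  have hxn := (I.num x).2
  have p1 : 2 ^ (d + 2) = 2 * 2 ^ (d + 1) := by rw [pow_succ _ (d + 1)]; ring
  have p2 : 2 ^ (k + 2) = 2 * 2 ^ (k + 1) := by rw [pow_succ _ (k + 1)]; ring
  have p3 : 2 ^ (k + 1) ≤ 2 ^ (d + 1) := Nat.pow_le_pow_right (by norm_num) (by have := hC.le; omega)
  have p4 : 2 * 2 ^ (d + 1) ≤ 2 ^ (t + 1) := by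
    rw [← p1]; exact Nat.pow_le_pow_right (by norm_num) (by omega)
  have p5 : 2 ^ (t + 2) = 2 * 2 ^ (t + 1) := by rw [pow_succ _ (t + 1)]; ring
  have p6 : 2 ^ (t + 4) = 8 * 2 ^ (t + 1) := by rw [pow_add, pow_add]; ring
  have hcode_le : 2 ^ (k + 1) ≤ wordBound t (Fintype.card T) := by omega
  have hdom : codeMask β (I.adj x) &&& 1 = if x ∈ closedNbhdSet G (takenSet β) then 1 else 0 :=
    codeMask_and_one hC.code hx0 (I.mem_adj x)
  refine Env.WP.mono (n := 50 + (50 + (50 + (((I.adj x).length * 150 + 50) + (50 + (50 +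
    ((2 ^ (k + 1) * 350 + 50) + (50 + (100 + (100 + (100 + (100 + (100 + (50 + 50))))))))))))))
    ?_ (by omega) (fun _ _ h => h)
  unfold enterProgram
  refine Env.WP.seq <| WP.assign' (by simp) (by decide) (by norm_num) (fun _ => by simp) <|
    Env.WP.seq <| WP.assign' (by simp) (by decide) (by norm_num) (fun _ => input_le' _) <|
    Env.WP.seq <| WP.assign' (by simp) (by decide) (by norm_num) (fun _ => input_le' _) <|
    Env.WP.seq <| (wp_scanLoop hl hC.code (x := x) (by have := hC.le; omega) ?_ ?_ ?_ ?_).mono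
      le_rfl ?_
  · have := hl.adj_start x
    simpa [hx] using this
  · have := hl.adj_end x
    simpa [hx] using this
  · simp
  · simpa using hσ.code
  rintro σ₁ - ⟨ha₁, h8, hr₁⟩
  have ha₁' : σ₁.arr = σ.arr := by rw [ha₁]; simp
  have hr₁' : ∀ r, r ≠ 6 → r ≠ 7 → r ≠ 8 → σ₁.reg r = σ.reg r := by
    intro r h6 h7 h8'
    rw [hr₁ r h6 h8']; simp [h6, h7, h8']
  clear ha₁ hr₁
  refine Env.WP.seq <| WP.assign' (by simp) (by decide) (by norm_num) (fun _ => ?_) <|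
    Env.WP.seq <| WP.assign' (by simp) (by decide) (by norm_num) (fun _ => by simp) <|
    Env.WP.seq <| (wp_growLoop (L := 2 ^ (d + 1)) (K := 2 ^ (k + 1)) p3 (by omega)
      ?_ ?_ ?_ ?_).mono le_rfl ?_
  · simp; omega
  · simp [hr₁' 3, hσ.start]
  · simp [hr₁' 4, hσ.width]
  · simp
  · intro i hi
    have h1 := stateCost_le_add_card (G := G) W (takenSet β) (indexedSet β i)
    have h2 := hC.card_indexedSet_le i
    simp [ha₁', hσ.tab i hi]
    omega
  rintro σ₂ - ⟨ha₂, hr₂, hlow, hnew⟩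
  have r0 : σ₂.reg 0 = stateCost G W (takenSet β) ∅ := by
    rw [hr₂ 0 (by norm_num) (by norm_num)]; simp [hr₁' 0, hσ.cost]
  have r1 : σ₂.reg 1 = I.num x := by
    rw [hr₂ 1 (by norm_num) (by norm_num)]; simp [hr₁' 1, hx]
  have r2 : σ₂.reg 2 = c := by
    rw [hr₂ 2 (by norm_num) (by norm_num)]; simp [hr₁' 2, hσ.base]
  have r3 : σ₂.reg 3 = 2 ^ (d + 1) := by
    rw [hr₂ 3 (by norm_num) (by norm_num)]; simp [hr₁' 3, hσ.start]
  have r4 : σ₂.reg 4 = 2 ^ (k + 1) := by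
    rw [hr₂ 4 (by norm_num) (by norm_num)]; simp [hr₁' 4, hσ.width]
  have r5 : σ₂.reg 5 = d := by
    rw [hr₂ 5 (by norm_num) (by norm_num)]; simp [hr₁' 5, hσ.depth]
  have r8 : σ₂.reg 8 = codeMask β (I.adj x) := by
    rw [hr₂ 8 (by norm_num) (by norm_num)]; simp [h8]
  have a2 : ∀ j, j ≠ 1 → ∀ i, σ₂.arr j i = σ.arr j i := by
    intro j hj i; rw [ha₂ j hj]; simp [ha₁']
  have alow : ∀ a < 2 ^ (d + 2), σ₂.arr 1 a = σ.arr 1 a := by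
    intro a ha; rw [hlow a (by omega)]; simp [ha₁']
  have hcode2 : ∀ v : T, σ₂.arr 2 (I.num v) = β v := fun v => by
    rw [a2 2 (by norm_num), hσ.code]
  have hcost := stateCost_le (G := G) W (takenSet β) ∅
  have hmask := hC.code.codeMask_lt (I.adj x)
  refine Env.WP.seq <| WP.assign' (by simp) (by decide) (by norm_num)
      (fun _ => by simp [r5]; omega) <|
    Env.WP.seq <| WP.putFrame (by norm_num) (by simp) (by decide) (by simp) (by decide)
      (by simp [r5]; omega) (fun _ => by simp [r1]; omega) <|
    Env.WP.seq <| WP.putFrame (by norm_num) (by simp) (by decide) (by simp) (by decide)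
      (by simp [r5]; omega) (fun _ => by simp [r8]; omega) <|
    Env.WP.seq <| WP.putFrame (by norm_num) (by simp) (by decide) (by simp) (by decide)
      (by simp [r5]; omega) (fun _ => by simp [r0]; omega) <|
    Env.WP.seq <| WP.putFrame (by norm_num) (by simp) (by decide) (by simp) (by decide)
      (by simp [r5]; omega) (fun _ => input_le' _) <|
    Env.WP.seq <| WP.putCode (x := x) (a := 2 ^ (k + 1)) (β := β) (by simp) (by decide) (by simp)
      (by decide) (by simp [r1]) (by simp [r4]) hcode_le (by simpa using hcode2)
      ((hC.card_update_le _).trans hd) fun hc =>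
    Env.WP.seq <| WP.assign' (by simp) (by decide) (by norm_num)
      (fun _ => by simp [r3]; omega) <|
    WP.assign' (by simp) (by decide) (by norm_num) (fun _ => by simp [r4]; omega) ?_
  have hpc : (inputArray I).getD (c + I.num x) 0 = pc x := hl.children_start x
  refine ⟨⟨?_, ?_, ?_, ?_, ?_, ?_, ?_⟩, ⟨?_, ?_, ?_, ?_⟩, ?_, ?_⟩
  · simp [r2]
  · simp [r3]; omega
  · simp [r4]; omega
  · simp [r5]
  · simp [r0, takenSet_update_new x hx0]
  · simpa using hc
  · intro i hi
    rw [takenSet_update_new x hx0]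
    have e : ∀ a, (2 ^ (d + 1 + 1) + a : ℕ) = 2 * 2 ^ (d + 1) + a := fun a => by omega
    -- Bit `k + 1` of the index says whether `x` is a target: the lower half copies the old table,
    -- the upper half adds the cost of `x`.
    by_cases hik : i < 2 ^ (k + 1)
    · rw [indexedSet_update_low x hx0 hik, ← hσ.tab i hik, e]
      simpa [ha₁'] using (hnew i hik).1
    · obtain ⟨i', rfl⟩ := Nat.exists_eq_add_of_le (not_lt.1 hik)
      have hi' : i' < 2 ^ (k + 1) := by omega
      have h1 := stateCost_mono (G := G) (W := W) (D := takenSet β)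
        (Finset.empty_subset (indexedSet β i'))
      rw [indexedSet_update_high hC.code x hi', stateCost_insert_target
        (notMem_indexedSet hx0 i') hC.notMem_closedNbhdSet, ← hdom, Nat.sub_add_comm h1,
        ← hσ.tab i' hi', e]
      simpa [ha₁', h8] using (hnew i' hi').2
  · simp [r5, r1]
  · simp [r5, r8]
  · simp [r5, r0]
  · simpa [r5, r2, r1] using hpc
  · intro j h3 h6 i hi
    have hij : i ≠ d + 1 := by omega
    have hj2 : j ≠ 2 := by omega
    simp [r5, hij, hj2, a2 j (by omega)]
  · intro a ha
    simpa using alow a ha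

end HybridDomset

/-! ### Switching to the second branch, and returning -/

namespace HybridDomset

variable {T : RootedTree.{u}} [Fintype T] {G : SimpleGraph T} {I : Presentation T G} {t : ℕ}
variable {c : ℕ} {pa pc : T → ℕ}

/-- The table for `W` from before the visit is still at level `d`, so the second branch starts from
it. It needs only the lower half of the space at level `d + 1`; the first branch's values with `x`
as a target, now for `W₁`, wait in the upper half. -/
theorem wp_switchProgram (hl : Layout I (inputArray I) c pa pc) {β : T → ℕ} {W W₁ : Finset T}
    {x : T} {d k : ℕ} (hC : Config G β W x d k) (hd : d + 1 ≤ t) {σ : Store}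
    (hσ : AtState I c (Function.update β x (2 ^ (k + 1))) W₁ (d + 1) (k + 1) σ)
    (hx : σ.reg 1 = I.num x) (hmask : σ.arr 4 (d + 1) = codeMask β (I.adj x))
    (hcost : σ.arr 5 (d + 1) = stateCost G W (takenSet β) ∅)
    (htab : ∀ i < 2 ^ (k + 1), σ.arr 1 (2 ^ (d + 1) + i) =
      stateCost G W (takenSet β) (indexedSet β i) - stateCost G W (takenSet β) ∅) :
    (machineEnv I t).WP switchProgram (800 + 200 * 2 ^ (k + 1))
      (fun σ' => AtState I c (Function.update β x 1) W (d + 1) k σ' ∧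
        σ'.arr 5 (d + 1) = stateCost G W₁ (takenSet β) ∅ ∧
        σ'.arr 6 (d + 1) = pc x ∧
        (∀ i < 2 ^ (k + 1), σ'.arr 1 (2 ^ (d + 2) + (2 ^ (k + 1) + i)) =
          stateCost G W₁ (takenSet β) (insert x (indexedSet β i)) -
            stateCost G W₁ (takenSet β) ∅) ∧
        (∀ j, 3 ≤ j → j ≤ 6 → ∀ i ≤ d, σ'.arr j i = σ.arr j i) ∧
        (∀ i, σ'.arr 3 i = σ.arr 3 i) ∧
        ∀ a < 2 ^ (d + 2), σ'.arr 1 a = σ.arr 1 a) σ := by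
  have hB := wordBound_facts (t := t) (card_tree_pos (T := T))
  have hx0 := hC.self_eq_zero
  have hxn := (I.num x).2
  have p1 : 2 ^ (d + 2) = 2 * 2 ^ (d + 1) := by rw [pow_succ _ (d + 1)]; ring
  have p2 : 2 ^ (k + 2) = 2 * 2 ^ (k + 1) := by rw [pow_succ _ (k + 1)]; ring
  have p3 : 2 ^ (k + 1) ≤ 2 ^ (d + 1) := Nat.pow_le_pow_right (by norm_num) (by have := hC.le; omega)
  have p4 : 2 * 2 ^ (d + 1) ≤ 2 ^ (t + 1) := by
    rw [← p1]; exact Nat.pow_le_pow_right (by norm_num) (by omega)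
  have p5 : 2 ^ (t + 2) = 2 * 2 ^ (t + 1) := by rw [pow_succ _ (t + 1)]; ring
  have p6 : 2 ^ (t + 4) = 8 * 2 ^ (t + 1) := by rw [pow_add, pow_add]; ring
  have hN := hC.code.codeMask_lt (I.adj x)
  have hcx : σ.arr 2 (I.num x) = 2 ^ (k + 1) := by rw [hσ.code]; simp
  have hhalf : (2 * 2 ^ (d + 1)) >>> 1 = 2 ^ (d + 1) := by
    rw [Nat.shiftRight_eq_div_pow]; omega
  have hstart : σ.reg 3 = 2 * 2 ^ (d + 1) := by rw [hσ.start, ← p1]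
  have hc1 := stateCost_le (G := G) W (takenSet β) ∅
  have hc2 := stateCost_le (G := G) W₁ (takenSet β) ∅
  have hr0 : σ.reg 0 = stateCost G W₁ (takenSet β) ∅ := by
    rw [hσ.cost, takenSet_update_new x hx0]
  refine Env.WP.mono (n := 50 + (50 + (50 + (50 + ((2 ^ (k + 1) * 200 + 50) + (50 + (100 +
    (50 + (100 + 100))))))))) ?_ (by omega) (fun _ _ h => h)
  unfold switchProgram
  refine Env.WP.seq <| WP.assign' (by simp) (by decide) (by norm_num)
      (fun _ => by simp [hx, hcx]; omega) <|
    Env.WP.seq <| WP.assign' (by simp) (by decide) (by norm_num)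
      (fun _ => by simp [hσ.depth, hmask]; omega) <|
    Env.WP.seq <| WP.assign' (by simp) (by decide) (by norm_num)
      (fun _ => by simp [hstart, hhalf]; omega) <|
    Env.WP.seq <| WP.assign' (by simp) (by decide) (by norm_num) (fun _ => by simp) <|
    Env.WP.seq <| (wp_switchLoop (L := 2 * 2 ^ (d + 1)) (K := 2 ^ (k + 1)) (H := 2 ^ (d + 1))
      (by omega) (by omega) (by simp [hstart]) (by simp [hx, hcx]) (by simp [hstart, hhalf])
      (by simp)).mono le_rfl ?_
  rintro σ₂ - ⟨ha₂, hr₂, hkeep, hnew⟩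
  have r0 : σ₂.reg 0 = stateCost G W₁ (takenSet β) ∅ := by
    rw [hr₂ 0 (by norm_num)]; simp [hr0]
  have r1 : σ₂.reg 1 = I.num x := by rw [hr₂ 1 (by norm_num)]; simp [hx]
  have r2 : σ₂.reg 2 = c := by rw [hr₂ 2 (by norm_num)]; simp [hσ.base]
  have r3 : σ₂.reg 3 = 2 * 2 ^ (d + 1) := by rw [hr₂ 3 (by norm_num)]; simp [hstart]
  have r4 : σ₂.reg 4 = 2 ^ (k + 1) := by rw [hr₂ 4 (by norm_num)]; simp [hx, hcx]
  have r5 : σ₂.reg 5 = d + 1 := by rw [hr₂ 5 (by norm_num)]; simp [hσ.depth]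
  have a2 : ∀ j, j ≠ 1 → ∀ i, σ₂.arr j i = σ.arr j i := by
    intro j hj i; rw [ha₂ j hj]; simp
  have akeep : ∀ a, a < 2 * 2 ^ (d + 1) ∨ 2 * 2 ^ (d + 1) + 2 ^ (k + 1) ≤ a →
      σ₂.arr 1 a = σ.arr 1 a := by
    intro a ha; rw [hkeep a ha]; simp
  have anew : ∀ i < 2 ^ (k + 1), σ₂.arr 1 (2 * 2 ^ (d + 1) + i) =
      stateCost G W (takenSet β) (indexedSet β i \ closedNbhd G x) -
        stateCost G W (takenSet β) ∅ := by
    intro i hi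
    rw [hnew i hi, ← indexedSet_sub_mask hC.code hx0 (I.mem_adj x), ← htab _ (by omega)]
    simp [hσ.depth, hmask]
  have f5 : σ₂.arr 5 (d + 1) = stateCost G W (takenSet β) ∅ := by
    rw [a2 5 (by norm_num), hcost]
  refine Env.WP.seq <| WP.assign' (by simp) (by decide) (by norm_num)
      (fun _ => by simp [r5, f5]; omega) <|
    Env.WP.seq <| WP.putFrame (by norm_num) (by simp) (by decide) (by simp) (by decide)
      (by simp [r5]; omega) (fun _ => by simp [r0]; omega) <|
    Env.WP.seq <| WP.assign' (by simp) (by decide) (by norm_num)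
      (fun _ => by simp [r5, f5]; omega) <|
    Env.WP.seq <| WP.putFrame (by norm_num) (by simp) (by decide) (by simp) (by decide)
      (by simp [r5]; omega) (fun _ => input_le' _) <|
    WP.putCode (x := x) (a := 1) (β := Function.update β x (2 ^ (k + 1))) (by simp) (by decide)
      (by simp) (by decide) (by simp [r1]) (by simp) (by omega) ?_ ?_ fun hc => ?_
  · intro v
    simpa [a2 2 (by norm_num)] using hσ.code v
  · rw [Function.update_idem]
    exact (hC.card_update_le _).trans hd
  rw [Function.update_idem] at hc
  have hpc : (inputArray I).getD (c + I.num x) 0 = pc x := hl.children_start x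
  have htaken := stateCost_insert_taken (G := G) (W := W) (S := ∅) (notMem_takenSet hx0)
    hC.notMem_closedNbhdSet
  rw [Finset.empty_sdiff] at htaken
  refine ⟨⟨?_, ?_, ?_, ?_, ?_, ?_, ?_⟩, ?_, ?_, ?_, ?_, ?_, ?_⟩
  · simp [r2]
  · simp [r3]; omega
  · simp [r4]
  · simp [r5]
  · simp [r5, f5, takenSet_update_one, htaken]
  · simpa using hc
  · intro i hi
    rw [takenSet_update_one, indexedSet_update_one x hx0, htaken,
      stateCost_insert_taken (notMem_takenSet hx0) hC.notMem_closedNbhdSet, Nat.add_sub_add_right,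
      ← anew i hi, ← p1]
    simp
  · simp [r5, r0]
  · simpa [r5, r2, r1] using hpc
  · intro i hi
    have h1 := hσ.tab (2 ^ (k + 1) + i) (by omega)
    rw [takenSet_update_new x hx0, indexedSet_update_high hC.code x hi] at h1
    rw [← h1]
    have h2 := akeep (2 * 2 ^ (d + 1) + (2 ^ (k + 1) + i)) (Or.inr (by omega))
    rw [← p1] at h2
    simpa using h2
  · intro j h3 h6 i hi
    have hij : i ≠ d + 1 := by omega
    have hj2 : j ≠ 2 := by omega
    simp [r5, hij, hj2, a2 j (by omega)]
  · intro i
    simp [a2 3 (by omega)]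
  · intro a ha
    simpa using akeep a (Or.inl (by omega))

/-- Both branches have now processed the same set `W₁`, and their tables lie side by side at level
`d + 1`. Their minimum, `stateCost_insert_processed`, overwrites the table at level `d`. -/
theorem wp_finishProgram {β : T → ℕ} {W W₁ : Finset T}
    {x : T} {d k : ℕ} (hC : Config G β W x d k) (hxW : x ∉ W₁) (hd : d + 1 ≤ t) {σ : Store}
    (hσ : AtState I c (Function.update β x 1) W₁ (d + 1) k σ)
    (hx : σ.reg 1 = I.num x) (hcost : σ.arr 5 (d + 1) = stateCost G W₁ (takenSet β) ∅)
    (htab : ∀ i < 2 ^ (k + 1), σ.arr 1 (2 ^ (d + 2) + (2 ^ (k + 1) + i)) =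
      stateCost G W₁ (takenSet β) (insert x (indexedSet β i)) -
        stateCost G W₁ (takenSet β) ∅) :
    (machineEnv I t).WP finishProgram (800 + 300 * 2 ^ (k + 1))
      (fun σ' => AtState I c β (insert x W₁) d k σ' ∧
        (∀ j, 3 ≤ j → j ≤ 6 → ∀ i, σ'.arr j i = σ.arr j i) ∧
        ∀ a, a < 2 ^ (d + 1) ∨ 2 ^ (d + 1) + 2 ^ (k + 1) ≤ a → σ'.arr 1 a = σ.arr 1 a) σ := by
  have hB := wordBound_facts (t := t) (card_tree_pos (T := T))
  have hx0 := hC.self_eq_zero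
  have p1 : 2 ^ (d + 2) = 2 * 2 ^ (d + 1) := by rw [pow_succ _ (d + 1)]; ring
  have p3 : 2 ^ (k + 1) ≤ 2 ^ (d + 1) := Nat.pow_le_pow_right (by norm_num) (by have := hC.le; omega)
  have p4 : 2 * 2 ^ (d + 1) ≤ 2 ^ (t + 1) := by
    rw [← p1]; exact Nat.pow_le_pow_right (by norm_num) (by omega)
  have p5 : 2 ^ (t + 2) = 2 * 2 ^ (t + 1) := by rw [pow_succ _ (t + 1)]; ring
  have p6 : 2 ^ (t + 4) = 8 * 2 ^ (t + 1) := by rw [pow_add, pow_add]; ring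
  have p0 : 0 < 2 ^ (k + 1) := by positivity
  have hhalf : (2 * 2 ^ (d + 1)) >>> 1 = 2 ^ (d + 1) := by
    rw [Nat.shiftRight_eq_div_pow]; omega
  have hstart : σ.reg 3 = 2 * 2 ^ (d + 1) := by rw [hσ.start, ← p1]
  have hcomb := fun S => stateCost_insert_processed (G := G) (S := S) hxW (notMem_takenSet hx0)
  have hv₁ : ∀ i < 2 ^ (k + 1), stateCost G W₁ (takenSet β) ∅ +
      σ.arr 1 (2 * 2 ^ (d + 1) + (2 ^ (k + 1) + i)) =
        stateCost G W₁ (takenSet β) (insert x (indexedSet β i)) := by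
    intro i hi
    rw [← p1, htab i hi, Nat.add_sub_cancel' (stateCost_mono (Finset.empty_subset _))]
  have hv₂ : ∀ i < 2 ^ (k + 1), σ.reg 0 + σ.arr 1 (2 * 2 ^ (d + 1) + i) =
        stateCost G W₁ (insert x (takenSet β)) (indexedSet β i) := by
    intro i hi
    have h1 := hσ.tab i hi
    rw [takenSet_update_one, indexedSet_update_one x hx0] at h1
    rw [hσ.cost, takenSet_update_one, ← p1, h1,
      Nat.add_sub_cancel' (stateCost_mono (Finset.empty_subset _))]
  have hmin : ∀ i < 2 ^ (k + 1), min (stateCost G W₁ (takenSet β) ∅ +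
      σ.arr 1 (2 * 2 ^ (d + 1) + (2 ^ (k + 1) + i))) (σ.reg 0 + σ.arr 1 (2 * 2 ^ (d + 1) + i)) =
        stateCost G (insert x W₁) (takenSet β) (indexedSet β i) := by
    intro i hi
    rw [hv₁ i hi, hv₂ i hi, hcomb]
  have hmin0 := hmin 0 p0
  have hv₁0 := hv₁ 0 p0
  have hv₂0 := hv₂ 0 p0
  rw [indexedSet_zero, add_zero, add_zero] at hmin0
  rw [indexedSet_zero, add_zero] at hv₁0 hv₂0
  have hc1 := stateCost_le (G := G) W₁ (takenSet β) ∅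
  have hc2 := stateCost_le (G := G) W₁ (insert x (takenSet β)) ∅
  have hc3 := stateCost_le (G := G) W₁ (takenSet β) {x}
  have hc4 := stateCost_le (G := G) (insert x W₁) (takenSet β) ∅
  have hc5 : σ.reg 0 ≤ 2 * Fintype.card T := by
    rw [hσ.cost]; exact stateCost_le _ _ _
  refine Env.WP.mono (n := 50 + (50 + (50 + (50 + (50 + (50 + ((2 ^ (k + 1) * 300 + 50) +
    (50 + (100 + (50 + 50)))))))))) ?_ (by omega) (fun _ _ h => h)
  unfold finishProgram
  refine Env.WP.seq <| WP.assign' (by simp) (by decide) (by norm_num)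
      (fun _ => by simp [hstart, hhalf]; omega) <|
    Env.WP.seq <| WP.assign' (by simp) (by decide) (by norm_num)
      (fun _ => by simp [hσ.depth, hcost]; omega) <|
    Env.WP.seq <| WP.assign' (by simp) (by decide) (by norm_num)
      (fun _ => by simp [hσ.depth, hcost, hstart, hσ.width, hv₁0]; omega) <|
    Env.WP.seq <| WP.assign' (by simp) (by decide) (by norm_num)
      (fun _ => by simp [hstart, hv₂0]; omega) <|
    Env.WP.seq <| WP.assign' (by simp) (by decide) (by norm_num)
      (fun _ => by
        simp [hσ.depth, hcost, hstart, hσ.width, sub_sub_self_eq_min, hv₁0]; omega) <|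
    Env.WP.seq <| WP.assign' (by simp) (by decide) (by norm_num) (fun _ => by simp) <|
    Env.WP.seq <| (wp_finishLoop (L := 2 * 2 ^ (d + 1)) (K := 2 ^ (k + 1)) (H := 2 ^ (d + 1))
      (by omega) (by omega) (by simp [hstart]) (by simp [hσ.width]) (by simp [hstart, hhalf])
      (by simp) (by simp; omega) (by simp [hσ.depth, hcost]; omega) ?_).mono le_rfl ?_
  · intro i hi
    have h1 := stateCost_le_add_card (G := G) (insert x W₁) (takenSet β) (indexedSet β i)
    have h2 := hC.card_indexedSet_le i
    simp [hσ.depth, hcost, hstart, hσ.width, sub_sub_self_eq_min, hmin i hi, hmin0]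
    omega
  rintro σ₂ - ⟨ha₂, hr₂, hkeep, hnew⟩
  have r14 : σ₂.reg 14 = stateCost G (insert x W₁) (takenSet β) ∅ := by
    rw [hr₂ 14 (by norm_num) (by norm_num) (by norm_num)]
    simp [hσ.depth, hcost, hstart, hσ.width, sub_sub_self_eq_min, hmin0]
  have r1 : σ₂.reg 1 = I.num x := by
    rw [hr₂ 1 (by norm_num) (by norm_num) (by norm_num)]; simp [hx]
  have r2 : σ₂.reg 2 = c := by
    rw [hr₂ 2 (by norm_num) (by norm_num) (by norm_num)]; simp [hσ.base]
  have r4 : σ₂.reg 4 = 2 ^ (k + 1) := by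
    rw [hr₂ 4 (by norm_num) (by norm_num) (by norm_num)]; simp [hσ.width]
  have r5 : σ₂.reg 5 = d + 1 := by
    rw [hr₂ 5 (by norm_num) (by norm_num) (by norm_num)]; simp [hσ.depth]
  have r13 : σ₂.reg 13 = 2 ^ (d + 1) := by
    rw [hr₂ 13 (by norm_num) (by norm_num) (by norm_num)]; simp [hstart, hhalf]
  have a2 : ∀ j, j ≠ 1 → ∀ i, σ₂.arr j i = σ.arr j i := by
    intro j hj i; rw [ha₂ j hj]; simp
  have hup : Function.update (Function.update β x 1) x 0 = β := by
    rw [Function.update_idem, ← hx0, Function.update_eq_self]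
  refine Env.WP.seq <| WP.assign' (by simp) (by decide) (by norm_num)
      (fun _ => by simp [r14]; omega) <|
    Env.WP.seq <| WP.putCode (x := x) (a := 0) (β := Function.update β x 1) (by simp) (by decide)
      (by simp) (by decide) (by simp [r1]) (by simp) (by omega) ?_ ?_ fun hc =>
    Env.WP.seq <| WP.assign' (by simp) (by decide) (by norm_num)
      (fun _ => by simp [r13]; omega) <|
    WP.assign' (by simp) (by decide) (by norm_num) (fun _ => by simp [r5]; omega) ?_
  · intro v
    simpa [a2 2 (by norm_num)] using hσ.code v
  · rw [Function.update_idem]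
    exact (hC.card_update_le _).trans hd
  rw [hup] at hc
  refine ⟨⟨?_, ?_, ?_, ?_, ?_, ?_, ?_⟩, ?_, ?_⟩
  · simp [r2]
  · simp [r13]
  · simp [r4]
  · simp [r5]
  · simp [r14]
  · simpa using hc
  · intro i hi
    have h1 := hnew i hi
    simp [hσ.depth, hcost, hstart, hσ.width, sub_sub_self_eq_min, hmin i hi, hmin0] at h1
    simpa using h1
  · intro j h3 h6 i
    have hj2 : j ≠ 2 := by omega
    simp [hj2, a2 j (by omega)]
  · intro a ha
    simpa using hkeep a ha

theorem wp_step_next (hl : Layout I (inputArray I) c pa pc) {x : T} {d j : ℕ} {σ : Store}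
    {n : ℕ} {Q : Store → Prop} (h2 : σ.reg 2 = c) (h5 : σ.reg 5 = d) (hd : d ≤ t)
    (hx : σ.arr 3 d = I.num x) (hp : σ.arr 6 d = pc x + j) (hj : j < (I.children x).length)
    (h : ∀ σ', σ'.reg 1 = (I.num (I.children x)[j] : ℕ) → (∀ r, r ≠ 1 → r ≠ 6 → σ'.reg r = σ.reg r) →
      (∀ j' i, ¬ (j' = 6 ∧ i = d) → σ'.arr j' i = σ.arr j' i) → σ'.arr 6 d = pc x + (j + 1) →
      (machineEnv I t).WP enterProgram n Q σ') :
    (machineEnv I t).WP stepProgram (300 + n) Q σ := by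
  have hB := wordBound_facts (t := t) (card_tree_pos (T := T))
  have hxn := (I.num x).2
  have hend := hl.children_end x
  have hle : pc x + (I.children x).length + 8 ≤ wordBound t (Fintype.card T) := by
    rw [← hend]; exact input_le _
  have hget := hl.children_get x j hj
  refine Env.WP.mono (n := 50 + (50 + (50 + (100 + (50 + n))))) ?_ (by omega) (fun _ _ h => h)
  unfold stepProgram
  refine Env.WP.seq <| WP.assign' (by simp) (by decide) (by norm_num)
      (fun _ => by simp [h5, hx]; omega) <|
    Env.WP.seq <| WP.assign' (by simp) (by decide) (by norm_num)
      (fun _ => by simp [h5, hp]; omega) <|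
    Env.WP.ifte (by simp) (by decide) (fun _ => ?_) (fun h0 => ?_)
  · refine Env.WP.seq <| WP.putFrame (by norm_num) (by simp) (by decide) (by simp) (by decide)
      (by simp [h5]; omega) (fun _ => by simp [h5, hp]; omega) <|
      Env.WP.seq <| WP.assign' (by simp) (by decide) (by norm_num) (fun _ => input_le' _) <|
      h _ ?_ ?_ ?_ ?_
    · simpa [h5, hp] using hget
    · intro r h1 h6; simp [h1, h6]
    · intro j' i hji
      simp [h5, hji]
    · simp [h5, hp, add_assoc]
  · exfalso
    change (if _ < (inputArray I).getD _ 0 then 1 else 0) = 0 at h0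
    have e : (inputArray I).getD (σ.reg 2 + I.num x + 1) 0 = pc x + (I.children x).length := by
      rw [h2]; exact hend
    simp [h5, hx, hp] at h0
    simp at e
    omega

theorem wp_step_return (hl : Layout I (inputArray I) c pa pc) {x : T} {d : ℕ} {σ : Store}
    {n : ℕ} {Q : Store → Prop} (h2 : σ.reg 2 = c) (h5 : σ.reg 5 = d)
    (hx : σ.arr 3 d = I.num x) (hp : σ.arr 6 d = pc x + (I.children x).length)
    (h : ∀ σ', σ'.reg 1 = (I.num x : ℕ) → (∀ r, r ≠ 1 → r ≠ 6 → σ'.reg r = σ.reg r) →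
      σ'.arr = σ.arr → (machineEnv I t).WP
        (if σ.arr 2 (I.num x) = 1 then finishProgram else switchProgram) n Q σ') :
    (machineEnv I t).WP stepProgram (200 + n) Q σ := by
  have hB := wordBound_facts (t := t) (card_tree_pos (T := T))
  have hxn := (I.num x).2
  have hend := hl.children_end x
  have hle : pc x + (I.children x).length + 8 ≤ wordBound t (Fintype.card T) := by
    rw [← hend]; exact input_le _
  refine Env.WP.mono (n := 50 + (50 + (50 + (50 + n)))) ?_ (by omega) (fun _ _ h => h)
  unfold stepProgram
  refine Env.WP.seq <| WP.assign' (by simp) (by decide) (by norm_num)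
      (fun _ => by simp [h5, hx]; omega) <|
    Env.WP.seq <| WP.assign' (by simp) (by decide) (by norm_num)
      (fun _ => by simp [h5, hp]; omega) ?_
  have h' := h ((σ.setReg 1 ((Expr.arr 3 (.reg 5)).eval (inputArray I) σ)).setReg 6
    ((Expr.arr 6 (.reg 5)).eval (inputArray I)
      (σ.setReg 1 ((Expr.arr 3 (.reg 5)).eval (inputArray I) σ))))
    (by simp [h5, hx]) (by intro r h1 h6; simp [h1, h6]) (by simp)
  refine Env.WP.ifte (by simp) (by decide) (fun h0 => ?_) (fun _ => ?_)
  · exfalso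
    change (if _ < (inputArray I).getD _ 0 then 1 else 0) ≠ 0 at h0
    have e : (inputArray I).getD (σ.reg 2 + I.num x + 1) 0 = pc x + (I.children x).length := by
      rw [h2]; exact hend
    simp [h5, hx, hp] at h0
    simp at e
    omega
  · refine Env.WP.ifte (by simp) (by decide) (fun h0 => ?_) (fun h0 => ?_)
    · rwa [if_pos] at h'
      simpa [h5, hx] using h0
    · rwa [if_neg] at h'
      simpa [h5, hx] using h0

end HybridDomset

/-! ### The traversal and its running time -/

namespace HybridDomset

variable {T : RootedTree.{u}} [Fintype T] {G : SimpleGraph T} {I : Presentation T G} {t : ℕ}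
variable {c : ℕ} {pa pc : T → ℕ}

/-- A bound on the time for a visit of `x` if `k` proper ancestors are undecided. -/
noncomputable def visitCost (I : Presentation T G) (x : T) (k : ℕ) : ℕ :=
  3000 * ∑ z ∈ descendants x,
    (2 ^ ((ancestors T z).card - (ancestors T x).card) * ((I.adj z).length + 1) +
      2 ^ (k + 1) * 3 ^ ((ancestors T z).card - (ancestors T x).card))

theorem card_ancestors_mono {x y : T} (h : x ≤ y) :
    (ancestors T x).card ≤ (ancestors T y).card :=
  Finset.card_le_card fun _ hv => mem_ancestors.2 ((mem_ancestors.1 hv).trans_le h)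

/-- The two visits of each child give `1 + 1 = 2` for the scans and `2 ^ (k + 2) + 2 ^ (k + 1) = 3 *
2 ^ (k + 1)` for the tables; hence the powers of 2 and 3. -/
theorem visitCost_eq (hT : IsTreedepthDecomposition T G) (x : T) (k : ℕ) :
    visitCost I x k = 3000 * ((I.adj x).length + 1 + 2 ^ (k + 1)) +
      (((I.children x).map fun y => visitCost I y (k + 1)).sum +
        ((I.children x).map fun y => visitCost I y k).sum) := by
  have hpd : Set.PairwiseDisjoint (↑(I.children x).toFinset : Set T) (descendants (T := T)) := by
    intro y hy z hz hyz
    exact (separated_descendants_of_covBy hT ((I.mem_children _ _).1 (by simpa using hy))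
      ((I.mem_children _ _).1 (by simpa using hz)) hyz).disjoint
  rw [← List.sum_toFinset _ (I.children_nodup x), ← List.sum_toFinset _ (I.children_nodup x),
    ← Finset.sum_add_distrib]
  unfold visitCost
  rw [descendants_eq_insert I x, Finset.sum_insert (self_notMem_biUnion_descendants I x),
    Finset.sum_biUnion hpd, Nat.mul_add, Finset.mul_sum]
  congr 1
  · simp
  · refine Finset.sum_congr rfl fun y hy => ?_
    rw [← Nat.mul_add, ← Finset.sum_add_distrib]
    congr 1
    refine Finset.sum_congr rfl fun z hz => ?_
    have hxy := (I.mem_children x y).1 (by simpa using hy)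
    have h1 := card_ancestors_covBy hxy
    have h2 := card_ancestors_mono (mem_descendants.1 hz)
    rw [show (ancestors T z).card - (ancestors T x).card =
      (ancestors T z).card - (ancestors T y).card + 1 by omega]
    ring

theorem le_visitCost (hT : IsTreedepthDecomposition T G) (x : T) (k : ℕ) :
    3000 * ((I.adj x).length + 1 + 2 ^ (k + 1)) ≤ visitCost I x k := by
  rw [visitCost_eq hT]; omega

/-- The parts of the memory that a visit at level `d` leaves as they are. -/
structure KeptAt (d k : ℕ) (σ σ' : Store) : Prop where
  frame : ∀ j, 3 ≤ j → j ≤ 6 → ∀ i ≤ d, σ'.arr j i = σ.arr j i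
  tab : ∀ a < 2 ^ (d + 2), a < 2 ^ (d + 1) ∨ 2 ^ (d + 1) + 2 ^ (k + 1) ≤ a →
    σ'.arr 1 a = σ.arr 1 a

/-- The rest of the visit of `x`, once it has been entered, can be carried out within the time
bound. -/
def VisitSpec (I : Presentation T G) (c : ℕ) (pc : T → ℕ) (t : ℕ) (x : T) : Prop :=
  ∀ (β : T → ℕ) (W : Finset T) (d k : ℕ), Config G β W x d k → ∀ σ : Store,
    AtState I c (Function.update β x (2 ^ (k + 1))) W (d + 1) (k + 1) σ →
    Entered I pc β W x d σ →
    (∀ i < 2 ^ (k + 1), σ.arr 1 (2 ^ (d + 1) + i) =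
      stateCost G W (takenSet β) (indexedSet β i) - stateCost G W (takenSet β) ∅) →
    ∀ (n m : ℕ) (Q : Store → Prop),
      n + visitCost I x k ≤ m + 1500 * ((I.adj x).length + 1 + 2 ^ (k + 1)) →
      (∀ σ', AtState I c β (W ∪ descendants x) d k σ' → KeptAt d k σ σ' →
        (machineEnv I t).WP traversal n Q σ') →
      (machineEnv I t).WP traversal m Q σ

theorem AtState.congr {β : T → ℕ} {W : Finset T} {d k : ℕ} {σ σ' : Store}
    (h : AtState I c β W d k σ) (hr : ∀ r, r ≠ 1 → r ≠ 6 → σ'.reg r = σ.reg r)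
    (h1 : σ'.arr 1 = σ.arr 1) (h2 : σ'.arr 2 = σ.arr 2) : AtState I c β W d k σ' := by
  refine ⟨?_, ?_, ?_, ?_, ?_, ?_, ?_⟩
  · rw [hr 2 (by norm_num) (by norm_num), h.base]
  · rw [hr 3 (by norm_num) (by norm_num), h.start]
  · rw [hr 4 (by norm_num) (by norm_num), h.width]
  · rw [hr 5 (by norm_num) (by norm_num), h.depth]
  · rw [hr 0 (by norm_num) (by norm_num), h.cost]
  · rw [h2]; exact h.code
  · rw [h1]; exact h.tab

theorem wp_traversal_step {σ : Store} {n m : ℕ} {Q : Store → Prop} (h5 : σ.reg 5 ≠ 0)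
    (h : (machineEnv I t).WP stepProgram m
      (fun σ' => (machineEnv I t).WP traversal n Q σ') σ) :
    (machineEnv I t).WP traversal (m + 50 + n) Q σ :=
  Env.WP.while_step (by simp) (by decide) h5 h

/-- Induction on the children still to be visited. The table left by one child is the input for the
next, with its subtree added to `W`; siblings stay separated from `W`. -/
theorem wp_children (hl : Layout I (inputArray I) c pa pc) (hT : IsTreedepthDecomposition T G)
    (ht : treeDepth T ≤ t) {x : T} (IH : ∀ y ∈ I.children x, VisitSpec I c pc t y) {β : T → ℕ}
    {d k : ℕ} (hcode : IsCode β k) (hsupp : ∀ v, β v ≠ 0 → v ≤ x) (hk : k ≤ d + 1)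
    (hdepth : (ancestors T x).card = d) (ys : List T) (j : ℕ)
    (hys : (I.children x).drop j = ys) (hj : j ≤ (I.children x).length) (W : Finset T)
    (hsep : Separated G W (ys.toFinset.biUnion descendants)) (σ : Store)
    (hσ : AtState I c β W (d + 1) k σ) (hx : σ.arr 3 (d + 1) = I.num x)
    (hp : σ.arr 6 (d + 1) = pc x + j) (n : ℕ) (Q : Store → Prop)
    (hQ : ∀ σ', AtState I c β (W ∪ ys.toFinset.biUnion descendants) (d + 1) k σ' →
      σ'.arr 6 (d + 1) = pc x + (I.children x).length →
      (∀ j, 3 ≤ j → j ≤ 5 → σ'.arr j (d + 1) = σ.arr j (d + 1)) →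
      (∀ j, 3 ≤ j → j ≤ 6 → ∀ i ≤ d, σ'.arr j i = σ.arr j i) →
      (∀ a < 2 ^ (d + 3), a < 2 ^ (d + 2) ∨ 2 ^ (d + 2) + 2 ^ (k + 1) ≤ a →
        σ'.arr 1 a = σ.arr 1 a) →
      (machineEnv I t).WP traversal n Q σ') :
    (machineEnv I t).WP traversal (n + (ys.map fun y => visitCost I y k).sum) Q σ := by
  induction ys generalizing j W σ with
  | nil =>
    have hjl : j = (I.children x).length := le_antisymm hj (List.drop_eq_nil_iff.1 hys)
    refine (hQ σ ?_ (by rw [hp, hjl]) (fun _ _ _ => rfl) (fun _ _ _ _ _ => rfl)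
      (fun _ _ _ => rfl)).mono (by simp) fun _ _ h => h
    simpa using hσ
  | cons y ys ih =>
    have hjl : j < (I.children x).length := by
      by_contra hc
      rw [List.drop_eq_nil_of_le (not_lt.1 hc)] at hys
      exact List.cons_ne_nil _ _ hys.symm
    rw [List.drop_eq_getElem_cons hjl, List.cons.injEq] at hys
    obtain ⟨hy, hys⟩ := hys
    have hyc : y ∈ I.children x := hy ▸ List.getElem_mem hjl
    have hxy := (I.mem_children x y).1 hyc
    have hdy := card_ancestors_covBy hxy
    have hdt : d + 1 + 1 ≤ t := by
      have := card_ancestors_lt y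
      omega
    have hbi : (y :: ys).toFinset.biUnion descendants =
        descendants y ∪ ys.toFinset.biUnion descendants := by
      rw [List.toFinset_cons, Finset.biUnion_insert]
    rw [hbi] at hsep
    have hC : Config G β W y (d + 1) k := by
      refine ⟨hcode, fun v hv => (hsupp v hv).trans_lt hxy.lt, hk, by omega, ?_⟩
      exact fun a ha b hb => hsep a ha b (Finset.mem_union_left _ hb)
    have hsepy : Separated G (descendants y) (ys.toFinset.biUnion descendants) := by
      intro a ha b hb
      obtain ⟨z, hz, hbz⟩ := Finset.mem_biUnion.1 hb
      rw [List.mem_toFinset] at hz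
      have hpw := (children_pairwise_separated I hT x).sublist (List.drop_sublist j _)
      rw [List.drop_eq_getElem_cons hjl, hy, hys, List.pairwise_cons] at hpw
      exact hpw.1 z hz a ha b hbz
    have hge := le_visitCost (I := I) hT y k
    set A := (I.adj y).length + 1 + 2 ^ (k + 1) with hA
    set n' := n + (ys.map fun y => visitCost I y k).sum with hn'
    -- Choosing the child and entering it costs at most `1500 * A`; this is the part of `visitCost`
    -- that `VisitSpec` regards as spent.
    refine Env.WP.mono (n := 300 + 1100 * A + 50 + (n' + visitCost I y k - 1500 * A))
      (wp_traversal_step (by rw [hσ.depth]; omega) ?_) ?_ (fun _ _ h => h)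
    · refine wp_step_next hl hσ.base hσ.depth (by omega) hx hp hjl ?_
      intro σ₁ h1 hr₁ ha₁ hp₁
      have e1 : σ₁.arr 1 = σ.arr 1 := funext fun i => ha₁ 1 i (by omega)
      have e2 : σ₁.arr 2 = σ.arr 2 := funext fun i => ha₁ 2 i (by omega)
      have hσ₁ := hσ.congr hr₁ e1 e2
      rw [hy] at h1
      refine (wp_enterProgram hl hC hdt hσ₁ h1).mono le_rfl ?_
      rintro σ₂ - ⟨hσ₂, hE, hf₂, ht₂⟩
      refine IH y hyc β W (d + 1) k hC σ₂ hσ₂ hE ?_ n' _ Q (by omega) ?_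
      · intro i hi
        rw [← hσ₁.tab i hi]
        refine ht₂ _ ?_
        have p1 : 2 ^ (d + 1 + 2) = 2 * 2 ^ (d + 1 + 1) := by rw [pow_succ _ (d + 2)]; ring
        have p3 : 2 ^ (k + 1) ≤ 2 ^ (d + 1 + 1) := Nat.pow_le_pow_right (by norm_num) (by omega)
        omega
      · intro σ₃ hσ₃ hK
        refine ih (j + 1) hys hjl _ ?_ σ₃ hσ₃ ?_ ?_ ?_
        · intro a ha b hb
          rcases Finset.mem_union.1 ha with ha | ha
          · exact hsep a ha b (Finset.mem_union_right _ hb)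
          · exact hsepy a ha b hb
        · rw [hK.frame 3 (by omega) (by omega) _ le_rfl, hf₂ 3 (by omega) (by omega) _ le_rfl,
            ha₁ 3 _ (by omega), hx]
        · rw [hK.frame 6 (by omega) (by omega) _ le_rfl, hf₂ 6 (by omega) (by omega) _ le_rfl,
            hp₁]
        · intro σ₄ hσ₄ hp₄ hf₄ hg₄ ht₄
          refine hQ σ₄ ?_ hp₄ ?_ ?_ ?_
          · rwa [hbi, ← Finset.union_assoc]
          · intro j h3 h5
            rw [hf₄ j h3 h5, hK.frame j h3 (by omega) _ le_rfl, hf₂ j h3 (by omega) _ le_rfl,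
              ha₁ j _ (by omega)]
          · intro j h3 h6 i hi
            rw [hg₄ j h3 h6 i hi, hK.frame j h3 h6 i (by omega), hf₂ j h3 h6 i (by omega),
              ha₁ j _ (by omega)]
          · intro a ha ha'
            rw [ht₄ a ha ha', hK.tab a ha ha', ht₂ a ha, ha₁ 1 _ (by omega)]
    · have p0 : 0 < 2 ^ (k + 1) := by positivity
      simp only [List.map_cons, List.sum_cons]
      omega

/-- The traversal is a single loop with an explicit stack, so a visit is not a subprogram with a
specification of its own. It is therefore described by what remains: if the loop succeeds from the
state after the visit, it succeeds from the state before, with a larger time bound. -/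
theorem visitSpec (hl : Layout I (inputArray I) c pa pc) (hT : IsTreedepthDecomposition T G)
    (ht : treeDepth T ≤ t) (x : T) : VisitSpec I c pc t x := by
  induction x using WellFoundedGT.induction with
  | ind x ih =>
  intro β W d k hC σ hσ hE htab n m Q hm hQ
  have IH : ∀ y ∈ I.children x, VisitSpec I c pc t y := fun y hy =>
    ih y ((I.mem_children x y).1 hy).lt
  have hdt : d + 1 ≤ t := by
    have := card_ancestors_lt x
    have := hC.depth
    omega
  set U := (I.children x).toFinset.biUnion descendants with hU
  have hdx : descendants x = insert x U := descendants_eq_insert I x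
  have hxU : x ∉ U := self_notMem_biUnion_descendants I x
  have hsepU : Separated G W U := fun a ha b hb =>
    hC.sep a ha b (by rw [hdx]; exact Finset.mem_insert_of_mem hb)
  have hxW : x ∉ W := fun h => (hC.sep x h x (mem_descendants.2 le_rfl)).1 rfl
  have hsupp : ∀ a v, Function.update β x a v ≠ 0 → v ≤ x := by
    intro a v hv
    by_cases hvx : v = x
    · exact hvx.le
    · rw [Function.update_of_ne hvx] at hv
      exact (hC.supp v hv).le
  have p1 : 2 ^ (d + 2) = 2 * 2 ^ (d + 1) := by rw [pow_succ _ (d + 1)]; ring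
  have p2 : 2 ^ (d + 3) = 2 * 2 ^ (d + 2) := by rw [pow_succ _ (d + 2)]; ring
  have p3 : 2 ^ (k + 1) ≤ 2 ^ (d + 1) :=
    Nat.pow_le_pow_right (by norm_num) (by have := hC.le; omega)
  have p4 : 2 ≤ 2 ^ (k + 1) := by
    have := Nat.one_le_two_pow (n := k); rw [pow_succ]; omega
  rw [visitCost_eq hT] at hm
  set S₁ := ((I.children x).map fun y => visitCost I y (k + 1)).sum with hS₁
  set S₂ := ((I.children x).map fun y => visitCost I y k).sum with hS₂
  refine Env.WP.mono (n := (200 + (800 + 200 * 2 ^ (k + 1)) + 50 +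
    ((200 + (800 + 300 * 2 ^ (k + 1)) + 50 + n) + S₂)) + S₁) ?_ (by omega) (fun _ _ h => h)
  refine wp_children hl hT ht IH (hC.code.update_new x) (hsupp _) (by have := hC.le; omega)
    hC.depth (I.children x) 0 rfl (Nat.zero_le _) W hsepU σ hσ hE.vertex hE.pointer _ Q ?_
  intro σ₁ hσ₁ hp₁ hf₁ hg₁ ht₁
  refine wp_traversal_step (by rw [hσ₁.depth]; omega) ?_
  refine wp_step_return hl hσ₁.base hσ₁.depth (by rw [hf₁ 3 le_rfl (by omega), hE.vertex]) hp₁ ?_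
  intro σ₂ hx₂ hr₂ ha₂
  -- After the first round the code of `x` is `2 ^ (k + 1)`, which is not `1`.
  rw [hσ₁.code, Function.update_self, if_neg (by omega)]
  have hσ₂ := hσ₁.congr hr₂ (by rw [ha₂]) (by rw [ha₂])
  refine (wp_switchProgram hl hC hdt hσ₂ hx₂ (by rw [ha₂, hf₁ 4 (by omega) (by omega), hE.mask])
    (by rw [ha₂, hf₁ 5 (by omega) (by omega), hE.cost]) ?_).mono le_rfl ?_
  · intro i hi
    rw [ha₂, ht₁ _ (by omega) (Or.inl (by omega)), htab i hi]
  rintro σ₃ - ⟨hσ₃, hc₃, hp₃, hh₃, hf₃, hv₃, ht₃⟩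
  have hx₃ : σ₃.arr 3 (d + 1) = I.num x := by
    rw [hv₃, ha₂, hf₁ 3 le_rfl (by omega), hE.vertex]
  refine wp_children hl hT ht IH (hC.code.update_one x) (hsupp _) (by have := hC.le; omega)
    hC.depth (I.children x) 0 rfl (Nat.zero_le _) W hsepU σ₃ hσ₃ hx₃ hp₃ _ Q ?_
  intro σ₄ hσ₄ hp₄ hf₄ hg₄ ht₄
  refine wp_traversal_step (by rw [hσ₄.depth]; omega) ?_
  refine wp_step_return hl hσ₄.base hσ₄.depth (by rw [hf₄ 3 le_rfl (by omega), hx₃]) hp₄ ?_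
  intro σ₅ hx₅ hr₅ ha₅
  rw [hσ₄.code, Function.update_self, if_pos rfl]
  have hσ₅ := hσ₄.congr hr₅ (by rw [ha₅]) (by rw [ha₅])
  refine (wp_finishProgram hC (by simp only [Finset.mem_union, not_or]; exact ⟨hxW, hxU⟩) hdt
    hσ₅ hx₅ (by rw [ha₅, hf₄ 5 (by omega) le_rfl, hc₃]) ?_).mono le_rfl ?_
  -- The second round over the children has width `2 ^ (k + 1)`, so the values behind its table are
  -- unchanged.
  · intro i hi
    rw [ha₅, ht₄ _ (by omega) (Or.inr (by omega)), hh₃ i hi]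
  rintro σ₆ - ⟨hσ₆, hf₆, ht₆⟩
  refine hQ σ₆ ?_ ⟨?_, ?_⟩
  · rwa [hdx, Finset.union_insert]
  · intro j h3 h6 i hi
    rw [hf₆ j h3 h6, ha₅, hg₄ j h3 h6 i hi, hf₃ j h3 h6 i hi, ha₂, hg₁ j h3 h6 i hi]
  · intro a ha ha'
    rw [ht₆ a ha', ha₅, ht₄ a (by omega) (Or.inl ha), ht₃ a ha, ha₂,
      ht₁ a (by omega) (Or.inl ha)]

theorem wp_mainProgram (hT : IsTreedepthDecomposition T G) (ht : treeDepth T ≤ t) :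
    (machineEnv I t).WP mainProgram (250 + visitCost I ⊥ 0)
      (fun σ => σ.reg 0 = dominationNumber G) ⟨0, 0⟩ := by
  obtain ⟨c, pa, pc, hl⟩ := exists_layout I
  have hB := wordBound_facts (t := t) (card_tree_pos (T := T))
  have hC : Config G (fun _ => 0) ∅ (⊥ : T) 0 0 := by
    refine ⟨⟨fun _ => Or.inl rfl, fun _ _ _ h => absurd rfl h⟩, fun _ h => absurd rfl h, le_rfl,
      ?_, fun a ha => by simp at ha⟩
    rw [Finset.card_eq_zero, Finset.eq_empty_iff_forall_notMem]
    intro v hv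
    exact not_lt_bot (mem_ancestors.1 hv)
  have hdt : 0 + 1 ≤ t := by
    have := card_ancestors_lt (⊥ : T); omega
  have htaken : takenSet (fun _ : T => 0) = ∅ := by simp [takenSet]
  have hindexed : ∀ i, indexedSet (fun _ : T => 0) i = ∅ := by simp [indexedSet]
  have hge := le_visitCost (I := I) hT ⊥ 0
  set A := (I.adj ⊥).length + 1 + 2 ^ (0 + 1) with hA
  refine Env.WP.mono (n := 50 + (50 + (50 + (50 + (1100 * A +
    (50 + visitCost I ⊥ 0 - 1500 * A)))))) ?_ (by omega) (fun _ _ h => h)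
  unfold mainProgram
  refine Env.WP.seq <| WP.assign' (by simp) (by decide) (by norm_num) (fun _ => input_le' _) <|
    Env.WP.seq <| WP.assign' (by simp) (by decide) (by norm_num) (fun _ => input_le' _) <|
    Env.WP.seq <| WP.assign' (by simp) (by decide) (by norm_num) (fun _ => by simp; omega) <|
    Env.WP.seq <| WP.assign' (by simp) (by decide) (by norm_num) (fun _ => by simp; omega) <|
    Env.WP.seq <| (wp_enterProgram hl hC hdt (c := c) ⟨?_, ?_, ?_, ?_, ?_, ?_, ?_⟩ ?_).mono
      le_rfl ?_
  · have h1 := hl.card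
    have h2 := hl.table
    rw [← h1] at h2
    simpa using h2
  · simp
  · simp
  · simp
  · simp [htaken, stateCost_empty]
  · simp
  · intro i _
    simp [htaken, hindexed]
  · have h1 := hl.root
    simpa using h1
  rintro σ₁ - ⟨hσ₁, hE, -, htab⟩
  refine visitSpec hl hT ht ⊥ _ ∅ 0 0 hC σ₁ hσ₁ hE ?_ 50 _ _ (by omega) ?_
  · intro i hi
    rw [htab _ (by norm_num at hi ⊢; omega)]
    simp [hindexed]
  intro σ₂ hσ₂ _
  refine Env.WP.while_done (by simp) (by decide) hσ₂.depth ?_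
  rw [hσ₂.cost, htaken, Finset.empty_union]
  have hu : descendants (⊥ : T) = Finset.univ :=
    Finset.eq_univ_of_forall fun v => mem_descendants.2 bot_le
  rw [hu, stateCost_univ]

end HybridDomset

namespace HybridDomset

/-! ### Summation of the running time and the final estimates -/

section Bounds

variable {T : RootedTree.{u}} [Fintype T] {G : SimpleGraph T} {I : Presentation T G} {t : ℕ}

/-- This lets the tables pay for the adjacency scans. The induction step needs `2 * d + 2 ≤ 3 * d`,
hence the start at 2. -/
theorem mul_two_pow_le_three_pow (d : ℕ) : d * 2 ^ d ≤ 3 ^ d := by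
  obtain hd | hd := Nat.lt_or_ge d 2
  · interval_cases d <;> norm_num
  · induction d, hd using Nat.le_induction with
    | base => norm_num
    | succ d hd ih =>
      calc (d + 1) * 2 ^ (d + 1) = (2 * d + 2) * 2 ^ d := by ring
        _ ≤ (3 * d) * 2 ^ d := Nat.mul_le_mul_right _ (by omega)
        _ = 3 * (d * 2 ^ d) := by ring
        _ ≤ 3 * 3 ^ d := Nat.mul_le_mul_left _ ih
        _ = 3 ^ (d + 1) := by ring

/-- The edges of `G` can be charged to their lower ends. -/
theorem sum_two_pow_mul_degree_le (I : Presentation T G) (hT : IsTreedepthDecomposition T G) :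
    ∑ z : T, 2 ^ (ancestors T z).card * (I.adj z).length ≤
      2 * ∑ z : T, (ancestors T z).card * 2 ^ (ancestors T z).card := by
  have hdeg : ∀ z : T, (I.adj z).length ≤
      (∑ v : T, if v < z then 1 else 0) + ∑ v : T, if z < v then 1 else 0 := by
    intro z
    rw [← List.toFinset_card_of_nodup (I.adj_nodup z), ← Finset.card_filter, ← Finset.card_filter]
    refine (Finset.card_le_card fun v hv => ?_).trans (Finset.card_union_le _ _)
    have hv : G.Adj z v := (I.mem_adj z v).1 (by simpa using hv)
    simp only [Finset.mem_union, Finset.mem_filter, Finset.mem_univ, true_and]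
    rcases hT z v hv with h | h
    · exact Or.inr (lt_of_le_of_ne h hv.ne)
    · exact Or.inl (lt_of_le_of_ne h hv.ne')
  have hlow : ∑ z : T, 2 ^ (ancestors T z).card * (∑ v : T, if v < z then 1 else 0) =
      ∑ z : T, (ancestors T z).card * 2 ^ (ancestors T z).card :=
    Finset.sum_congr rfl fun z _ => by rw [← Finset.card_filter, mul_comm]; rfl
  -- Pairs of a node and a proper descendant are moved to the descendant, whose weight is at least
  -- as large.
  have hhigh : ∑ z : T, 2 ^ (ancestors T z).card * (∑ v : T, if z < v then 1 else 0) ≤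
      ∑ z : T, 2 ^ (ancestors T z).card * (∑ v : T, if v < z then 1 else 0) := by
    simp only [Finset.mul_sum]
    rw [Finset.sum_comm]
    refine Finset.sum_le_sum fun v _ => Finset.sum_le_sum fun z _ => ?_
    split_ifs with h
    · exact Nat.mul_le_mul_right _ (Nat.pow_le_pow_right two_pos (card_ancestors_mono h.le))
    · simp
  calc ∑ z : T, 2 ^ (ancestors T z).card * (I.adj z).length
      ≤ ∑ z : T, 2 ^ (ancestors T z).card *
          ((∑ v : T, if v < z then 1 else 0) + ∑ v : T, if z < v then 1 else 0) :=
        Finset.sum_le_sum fun z _ => Nat.mul_le_mul_left _ (hdeg z)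
    _ ≤ _ := by
      simp only [Nat.mul_add, Finset.sum_add_distrib]
      omega

/-- Of the factor `15000 = 3000 * 5`, two parts come from the degrees, one from the visits
themselves and two from the tables. -/
theorem visitCost_bot_le (I : Presentation T G) (hT : IsTreedepthDecomposition T G)
    (ht : treeDepth T ≤ t) : visitCost I ⊥ 0 ≤ 15000 * (Fintype.card T * 3 ^ t) := by
  have h0 : (ancestors T (⊥ : T)).card = 0 := by
    rw [Finset.card_eq_zero, Finset.eq_empty_iff_forall_notMem]
    exact fun v hv => not_lt_bot (mem_ancestors.1 hv)
  have hu : descendants (⊥ : T) = Finset.univ :=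
    Finset.eq_univ_of_forall fun v => mem_descendants.2 bot_le
  have h1 := sum_two_pow_mul_degree_le I hT
  have h2 : ∑ z : T, (ancestors T z).card * 2 ^ (ancestors T z).card ≤
      ∑ z : T, 3 ^ (ancestors T z).card :=
    Finset.sum_le_sum fun z _ => mul_two_pow_le_three_pow _
  have h3 : ∑ z : T, 2 ^ (ancestors T z).card ≤ ∑ z : T, 3 ^ (ancestors T z).card :=
    Finset.sum_le_sum fun z _ => Nat.pow_le_pow_left (by norm_num) _
  have h4 : ∑ z : T, 3 ^ (ancestors T z).card ≤ Fintype.card T * 3 ^ t := by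
    refine (Finset.sum_le_card_nsmul _ _ (3 ^ t) fun z _ => ?_).trans (by simp)
    exact Nat.pow_le_pow_right (by norm_num) ((card_ancestors_lt z).le.trans ht)
  have h5 : visitCost I ⊥ 0 = 3000 * (∑ z : T, 2 ^ (ancestors T z).card * (I.adj z).length +
      ∑ z : T, 2 ^ (ancestors T z).card + 2 * ∑ z : T, 3 ^ (ancestors T z).card) := by
    rw [visitCost, h0, hu, Finset.mul_sum (a := 2), ← Finset.sum_add_distrib,
      ← Finset.sum_add_distrib]
    simp [Nat.mul_add]
  omega

theorem rel_machineEnv_zero (I : Presentation T G) (t : ℕ) :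
    (machineEnv I t).Rel ⟨0, 0⟩ 0 := by
  refine ⟨⟨?_, ?_, ?_, ?_, ?_, ⟨∅, ?_, ?_, ?_⟩, ?_, ?_⟩, ⟨?_, ?_⟩, ?_⟩ <;> simp [TempBounded]

theorem Represents.le {σ : Store} {m : Memory} {W : ℕ} (h : Represents σ m)
    (hr : ∀ i, σ.reg i ≤ W) (ha : ∀ j i, 1 ≤ j → j ≤ 6 → σ.arr j i ≤ W) (ht : TempBounded W m)
    (a : ℕ) : m a ≤ W := by
  have hmod : a % 8 < 8 := Nat.mod_lt _ (by norm_num)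
  obtain h0 | h7 | ⟨h1, h6⟩ : a % 8 = 0 ∨ a % 8 = 7 ∨ 1 ≤ a % 8 ∧ a % 8 ≤ 6 := by omega
  · have := h.1 (a / 8)
    rw [show 8 * (a / 8) = a by omega] at this
    exact this ▸ hr _
  · have := (ht (a / 8)).1
    rwa [show 8 * (a / 8) + 7 = a by omega] at this
  · have := h.2 _ h1 h6 (a / 8)
    rw [show 8 * (a / 8) + a % 8 = a by omega] at this
    exact this ▸ ha _ _ h1 h6

/-- The space and the word size in all states that occur in a run. -/
theorem good_bounds {m : Memory} (h : (machineEnv I t).Good m) :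
    let β := Nat.size (Fintype.card T)
    let s := t + 46 + 2 * β
    spaceBits m ≤ 16 * (7 + s) + 2 ^ (t + 2) * (2 * t + 5) + t * (β + 4 + s) +
      4 * ((t + 1) * (t + 4 + s)) + 64 * (9 + s) ∧ ∀ a, Nat.size (m a) ≤ s := by
  intro β s
  obtain ⟨σ, hJ, hm, hW⟩ := h
  have hβ : Fintype.card T < 2 ^ β := Nat.lt_size_self _
  -- Here `46 = 40 + 6`: 40 for intermediate values of expressions and 6 from `wordBound`.
  have hs : 2 ^ 40 * wordBound t (Fintype.card T) < 2 ^ s := by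
    have h2 : (Fintype.card T) ^ 2 < (2 ^ β) ^ 2 := Nat.pow_lt_pow_left hβ two_ne_zero
    calc 2 ^ 40 * wordBound t (Fintype.card T) = 2 ^ (40 + (t + 6)) * (Fintype.card T) ^ 2 := by
          rw [wordBound, pow_add 2 40, mul_assoc]
      _ < 2 ^ (40 + (t + 6)) * (2 ^ β) ^ 2 := Nat.mul_lt_mul_of_pos_left h2 (by positivity)
      _ = 2 ^ s := by
          rw [← pow_mul, ← pow_add]
          congr 1
          omega
  have hBW : wordBound t (Fintype.card T) ≤ 2 ^ 40 * wordBound t (Fintype.card T) :=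
    Nat.le_mul_of_pos_left _ (by positivity)
  refine ⟨Inv.spaceBits_le hJ hm hW hBW hs hβ, fun a => size_le_of_lt (lt_of_le_of_lt ?_ hs)⟩
  exact hm.le (fun i => ((machineEnv I t).reg_le σ hJ i).trans hBW)
    (fun j i h1 h6 => ((machineEnv I t).arr_le σ hJ j i h1 h6).trans hBW) hW a

end Bounds

theorem size_le_logb {n : ℕ} (hn : 1 ≤ n) : (Nat.size n : ℝ) ≤ Real.logb 2 n + 1 := by
  have h : 2 ^ (Nat.size n - 1) ≤ n := by
    refine Nat.lt_size.1 ?_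
    have := Nat.size_pos.2 hn
    omega
  have h1 : ((Nat.size n - 1 : ℕ) : ℝ) ≤ Real.logb 2 n := by
    rw [Real.le_logb_iff_rpow_le (by norm_num) (by exact_mod_cast hn), Real.rpow_natCast]
    exact_mod_cast h
  have h2 : Nat.size n ≤ (Nat.size n - 1) + 1 := by omega
  have h3 : (Nat.size n : ℝ) ≤ ((Nat.size n - 1 : ℕ) : ℝ) + 1 := by exact_mod_cast h2
  linarith

theorem one_le_logb_two {t : ℕ} (ht : 2 ≤ t) : 1 ≤ Real.logb 2 t := by
  have h : (2 : ℝ) ≤ t := by exact_mod_cast ht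
  rw [Real.le_logb_iff_rpow_le (by norm_num) (by linarith), Real.rpow_one]
  exact h

theorem word_size_bound {t β : ℕ} {L : ℝ} (ht : 2 ≤ t) (hL : 0 ≤ L) (hβ : (β : ℝ) ≤ L + 1) :
    ((t + 46 + 2 * β : ℕ) : ℝ) ≤ 20000 * (t + L) := by
  have h : (2 : ℝ) ≤ t := by exact_mod_cast ht
  push_cast
  linarith

/-- All lower terms are compared with `P * t * l` and `t * L` by means of `2 ≤ t` and `t ≤ 2 ^ t`;
what remains is linear in these products. -/
theorem space_bound {t β b : ℕ} {L l : ℝ} (ht : 2 ≤ t) (hL : 0 ≤ L) (hl : 1 ≤ l)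
    (hβ : (β : ℝ) ≤ L + 1)
    (hb : b ≤ 16 * (7 + (t + 46 + 2 * β)) + 2 ^ (t + 2) * (2 * t + 5) +
      t * (β + 4 + (t + 46 + 2 * β)) + 4 * ((t + 1) * (t + 4 + (t + 46 + 2 * β))) +
      64 * (9 + (t + 46 + 2 * β))) :
    (b : ℝ) ≤ 20000 * (2 ^ t * t * l + t * L) := by
  have h2 : (2 : ℝ) ≤ t := by exact_mod_cast ht
  have ht2 : (t : ℝ) ≤ 2 ^ t := by exact_mod_cast Nat.lt_two_pow_self.le
  set P : ℝ := 2 ^ t with hP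
  have hsq : (t : ℝ) * t ≤ P * t := mul_le_mul_of_nonneg_right ht2 (by linarith)
  have hPt : P * t ≤ P * t * l := le_mul_of_one_le_right (by positivity) hl
  have htL : 2 * L ≤ t * L := mul_le_mul_of_nonneg_right h2 hL
  have htβ : (t : ℝ) * β ≤ t * L + t := by
    have := mul_le_mul_of_nonneg_left hβ (by linarith : (0 : ℝ) ≤ t)
    linarith
  have h2t : 2 * (t : ℝ) ≤ t * t := mul_le_mul_of_nonneg_right h2 (by linarith)
  have hP2 : 2 * P ≤ P * t := by
    have := mul_le_mul_of_nonneg_left h2 (by linarith : (0 : ℝ) ≤ P)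
    linarith
  have hb' : (b : ℝ) ≤ 16 * (7 + (t + 46 + 2 * β)) + P * 4 * (2 * t + 5) +
      t * (β + 4 + (t + 46 + 2 * β)) + 4 * ((t + 1) * (t + 4 + (t + 46 + 2 * β))) +
      64 * (9 + (t + 46 + 2 * β)) := by
    have : (b : ℝ) ≤ ((16 * (7 + (t + 46 + 2 * β)) + 2 ^ (t + 2) * (2 * t + 5) +
      t * (β + 4 + (t + 46 + 2 * β)) + 4 * ((t + 1) * (t + 4 + (t + 46 + 2 * β))) +
      64 * (9 + (t + 46 + 2 * β)) : ℕ) : ℝ) := by exact_mod_cast hb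
    push_cast at this
    rw [pow_add, ← hP] at this
    linarith
  linarith

end HybridDomset

theorem mainTheorem4 :
    ∃ (p : HybridDomset.Program) (C : ℝ),
      ∀ (T : RootedTree.{u}) [Fintype T] (G : SimpleGraph T) (I : HybridDomset.Presentation T G)
        (t : ℕ),
        HybridDomset.IsTreedepthDecomposition T G → HybridDomset.treeDepth T ≤ t → 2 ≤ t →
        -- the recursion computes the size of a minimum dominating set
        HybridDomset.hybridValue I = (HybridDomset.dominationNumber G : ℕ∞) ∧
        -- its tables are indexed by the subsets of the part of the root path outside `D`, and
        -- their finite entries are offsets of at most `t` from the entry at `∅`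
        (∀ (x : T) (D : Finset T), D ⊆ HybridDomset.ancestors T x →
          HybridDomset.domsetTable I x D ∅ ≠ ⊤ ∧
          ∀ S : Finset T, HybridDomset.domsetTable I x D S ≠ ⊤ →
            (S ⊆ HybridDomset.ancestors T x ∧ Disjoint S D) ∧
            HybridDomset.domsetTable I x D ∅ ≤ HybridDomset.domsetTable I x D S ∧
            HybridDomset.domsetTable I x D S ≤ HybridDomset.domsetTable I x D ∅ + (t : ℕ∞)) ∧
        -- a machine computes its value within the time and space bounds
        ∃ (tr : List HybridDomset.Memory) (m : HybridDomset.Memory),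
          HybridDomset.Run (HybridDomset.inputArray I) p 0 tr m ∧
          (m 0 : ℕ∞) = HybridDomset.hybridValue I ∧
          (tr.length : ℝ) ≤ C * (3 ^ t * Real.logb 2 t * Fintype.card T) ∧
          ∀ m' ∈ tr,
            (HybridDomset.spaceBits m' : ℝ) ≤
              C * (2 ^ t * t * Real.logb 2 t + t * Real.logb 2 (Fintype.card T)) ∧
            ∀ a : ℕ, (Nat.size (m' a) : ℝ) ≤ C * (t + Real.logb 2 (Fintype.card T)) := by
  refine ⟨HybridDomset.mainProgram, 20000, fun T _ G I t hT ht h2 => ?_⟩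
  have hval := HybridDomset.hybridValue_eq I hT
  refine ⟨hval, fun x D hD => HybridDomset.domsetTable_bounds I hT ht x D hD, ?_⟩
  obtain ⟨tr, m, σ, hrun, ⟨-, hm, -⟩, hσ, hlen, htr⟩ :=
    HybridDomset.wp_mainProgram (I := I) hT ht 0 (HybridDomset.rel_machineEnv_zero I t)
  have hn : 1 ≤ Fintype.card T := HybridDomset.card_tree_pos
  have hl := HybridDomset.one_le_logb_two h2
  have hL : 0 ≤ Real.logb 2 (Fintype.card T) :=
    Real.logb_nonneg (by norm_num) (by exact_mod_cast hn)
  have hβ := HybridDomset.size_le_logb hn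
  refine ⟨tr, m, hrun, ?_, ?_, fun m' hm' => ?_⟩
  · have h0 := hm.1 0
    rw [Nat.mul_zero] at h0
    rw [hval, h0, hσ]
  · have h3 : tr.length ≤ 20000 * (Fintype.card T * 3 ^ t) := by
      have h4 := HybridDomset.visitCost_bot_le I hT ht
      have h5 : 1 ≤ Fintype.card T * 3 ^ t := Nat.mul_pos hn (by positivity)
      omega
    have h6 : (tr.length : ℝ) ≤ 20000 * (Fintype.card T * 3 ^ t) := by exact_mod_cast h3
    -- The program needs no logarithmic factor in the time bound; since `2 ≤ t`, it can be inserted.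
    have h7 : (Fintype.card T * 3 ^ t : ℝ) ≤ Fintype.card T * 3 ^ t * Real.logb 2 t :=
      le_mul_of_one_le_right (by positivity) hl
    linarith
  · obtain ⟨hs, hw⟩ := HybridDomset.good_bounds (htr m' hm')
    refine ⟨HybridDomset.space_bound h2 hL hl hβ hs, fun a => ?_⟩
    exact le_trans (by exact_mod_cast hw a) (HybridDomset.word_size_bound h2 hL hβ)
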